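/- Let $\mathsf{L}_\omega$ be the language of higher-order arithmetic: variables of all finite types ($0$ is the type of natural numbers, $\sigma\to\tau$ the type of functionals from type $\sigma$ to type $\tau$; $1=0\to0$, $2=1\to 0$), constants $0,1,+,\times,<,=$ at type $0$, the combinators $\Pi,\Sigma$, and recursors $\mathbf R_\sigma$; equality at higher types is pointwise. Let $\mathsf{RCA}_0^\omega$ be Kohlenbach's base theory, given in classical logic by: the axioms of (discretely) ordered semi-rings; the defining axioms of $\Pi,\Sigma$ and of $\mathbf R_0$, namely $\mathbf R_0(f,m,0)=m$ and $\mathbf R_0(f,m,n+1)=f(\mathbf R_0(f,m,n))$; extensionality $x=_\rho y\to\varphi(x)=_\tau\varphi(y)$ at all types; induction for quantifier-free formulas; and $\mathsf{QF\text{-}AC}^{1,0}$, i.e. $\forall x^1\exists y^0A(x,y)\to\exists Y^{2}\forall x^1A(x,Y(x))$ for quantifier-free $A$ (parameters of all types being allowed in both schemes). Let $\mathsf L_2$ be the second-order part of the language (variables of type $0$ and $1$ only, sets being given by characteristic functions). Consider the following sentences. - $\mathsf{WWKL}$: if a tree $T\subseteq 2^{<\mathbb N}$ has no infinite path, then $\lim_{n\to\infty}2^{-n}\,|\{\sigma\in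 T:|\sigma|=n\}|=0$. - $(\exists^2)$: there is a functional $\varphi^2\le 1$ such that for all $f^1$: $(\exists n)(f(n)=0)\leftrightarrow\varphi(f)=0$. - $\mathsf{WHBU}$: for every $\Psi:\mathbb R\to\mathbb R^+$ and every $k\in\mathbb N$ there is a finite sequence $y_1,\dots,y_n\in[0,1]$ such that the union of the intervals $I^\Psi_{y_i}=(y_i-\Psi(y_i),y_i+\Psi(y_i))$ covers $[0,1]$ up to measure $2^{-k}$, i.e. the total length (Lebesgue measure) of $[0,1]\cap\bigcup_{i\le n}I^\Psi_{y_i}$ is at least $1-2^{-k}$. Here real numbers are represented by sequences $(q_n)$ of rationals with $|q_n-q_{n+i}|<2^{-n}$ for all $n,i$, functions $\mathbb R\to\mathbb R$ are represented by functionals of type $1\to1$ respecting equality of reals, and the length of the union is expressed as the supremum of the total lengths of finite sets of dyadic intervals $[j2^{-l},(j+1)2^{-l}]\subseteq[0,1]$ of a common level $l$, each contained in some $I^\Psi_{y_i}$. Theorem. Let $\mathsf X$ be a sentence of $\mathsf L_2$ such that $\mathsf{ACA}_0\to\mathsf X\to\mathsf{WWKL}_0$, i.e. $\mathsf X$ is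 provable from arithmetical comprehension and $\mathsf{WWKL}$ is provable from $\mathsf X$, over the base theory. Then $\mathsf{RCA}_0^\omega$ proves $$\mathsf{WWKL}\leftrightarrow[(\exists^2)\vee\mathsf{WHBU}]\leftrightarrow[\mathsf X\vee\mathsf{WHBU}],$$ that is, $\mathsf{RCA}_0^\omega$ proves each of the two equivalences. -/

import Mathlib

namespace HORM

/-! ## Finite types, terms and formulas of the language of higher-order arithmetic -/

/-- The finite types: the type `nat` (type `0`) of numbers, and function types. -/
inductive Ty : Type
  | nat : Ty
  | arr : Ty → Ty → Ty

notation:60 a:61 " ⇾ " b:60 => Ty.arr a b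

/-- Type `0`. -/
abbrev tp0 : Ty := Ty.nat
/-- Type `1`, i.e. `0 → 0`. -/
abbrev tp1 : Ty := tp0 ⇾ tp0
/-- Type `2`, i.e. `(0 → 0) → 0`. -/
abbrev tp2 : Ty := tp1 ⇾ tp0

/-- A context lists the types of the variables that may occur free. -/
abbrev Ctx : Type := List Ty

/-- Variables of a given type in a context (typed de Bruijn indices). -/
inductive Var : Ctx → Ty → Type
  | zero {Γ : Ctx} {σ : Ty} : Var (σ :: Γ) σ
  | succ {Γ : Ctx} {σ τ : Ty} : Var Γ τ → Var (σ :: Γ) τ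

/-- Typed terms: variables, the arithmetical constants, the combinators `Π` (here `K`) and
`Σ` (here `S`), the recursors `R σ` for iteration on objects of type `σ`, and application. -/
inductive Tm : Ctx → Ty → Type
  | var {Γ : Ctx} {σ : Ty} : Var Γ σ → Tm Γ σ
  | zero {Γ : Ctx} : Tm Γ tp0
  | one {Γ : Ctx} : Tm Γ tp0
  | add {Γ : Ctx} : Tm Γ (tp0 ⇾ tp0 ⇾ tp0)
  | mul {Γ : Ctx} : Tm Γ (tp0 ⇾ tp0 ⇾ tp0)
  | K {Γ : Ctx} (σ τ : Ty) : Tm Γ (σ ⇾ τ ⇾ σ)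
  | S {Γ : Ctx} (ρ σ τ : Ty) : Tm Γ ((ρ ⇾ σ ⇾ τ) ⇾ (ρ ⇾ σ) ⇾ ρ ⇾ τ)
  | R {Γ : Ctx} (σ : Ty) : Tm Γ ((σ ⇾ σ) ⇾ σ ⇾ tp0 ⇾ σ)
  | app {Γ : Ctx} {σ τ : Ty} : Tm Γ (σ ⇾ τ) → Tm Γ σ → Tm Γ τ

notation:75 f:75 " ⬝ " x:76 => Tm.app f x

/-- Formulas. The prime formulas are `s = t` and `s < t` for terms of type `0`; the other
connectives and the existential quantifier are defined classically below. -/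
inductive Fm : Ctx → Type
  | eq {Γ : Ctx} : Tm Γ tp0 → Tm Γ tp0 → Fm Γ
  | lt {Γ : Ctx} : Tm Γ tp0 → Tm Γ tp0 → Fm Γ
  | fal {Γ : Ctx} : Fm Γ
  | imp {Γ : Ctx} : Fm Γ → Fm Γ → Fm Γ
  | all {Γ : Ctx} {σ : Ty} : Fm (σ :: Γ) → Fm Γ

/-- Sentences are formulas without free variables. -/
abbrev Sentence : Type := Fm []

/-! ## Renaming and substitution -/

/-- Renamings. -/
abbrev Ren (Γ Δ : Ctx) : Type := ∀ {σ : Ty}, Var Γ σ → Var Δ σ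

/-- Simultaneous substitutions. -/
abbrev Subst (Γ Δ : Ctx) : Type := ∀ {σ : Ty}, Var Γ σ → Tm Δ σ

/-- The renaming from the empty context. -/
def Ren.nil {Γ : Ctx} : Ren [] Γ := fun x => by cases x

/-- Apply a renaming to a term. -/
def Tm.ren {Γ Δ : Ctx} (r : Ren Γ Δ) : {σ : Ty} → Tm Γ σ → Tm Δ σ
  | _, .var x => .var (r x)
  | _, .zero => .zero
  | _, .one => .one
  | _, .add => .add
  | _, .mul => .mul
  | _, .K σ τ => .K σ τ
  | _, .S ρ σ τ => .S ρ σ τ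
  | _, .R σ => .R σ
  | _, .app f t => .app (f.ren r) (t.ren r)

/-- Apply a substitution to a term. -/
def Tm.subst {Γ Δ : Ctx} (s : Subst Γ Δ) : {σ : Ty} → Tm Γ σ → Tm Δ σ
  | _, .var x => s x
  | _, .zero => .zero
  | _, .one => .one
  | _, .add => .add
  | _, .mul => .mul
  | _, .K σ τ => .K σ τ
  | _, .S ρ σ τ => .S ρ σ τ
  | _, .R σ => .R σ
  | _, .app f t => .app (f.subst s) (t.subst s)

/-- Extend a renaming under a binder. -/
def Ren.lift {Γ Δ : Ctx} (r : Ren Γ Δ) {τ : Ty} : Ren (τ :: Γ) (τ :: Δ)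
  | _, .zero => .zero
  | _, .succ x => .succ (r x)

/-- Extend a substitution under a binder. -/
def Subst.lift {Γ Δ : Ctx} (s : Subst Γ Δ) {τ : Ty} : Subst (τ :: Γ) (τ :: Δ)
  | _, .zero => .var .zero
  | _, .succ x => (s x).ren .succ

/-- Extend a substitution by a term for the most recent variable. -/
def Subst.cons {Γ Δ : Ctx} {τ : Ty} (t : Tm Δ τ) (s : Subst Γ Δ) : Subst (τ :: Γ) Δ
  | _, .zero => t
  | _, .succ x => s x

/-- Apply a renaming to a formula. -/
def Fm.ren : {Γ Δ : Ctx} → Ren Γ Δ → Fm Γ → Fm Δ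
  | _, _, r, .eq s t => .eq (s.ren r) (t.ren r)
  | _, _, r, .lt s t => .lt (s.ren r) (t.ren r)
  | _, _, _, .fal => .fal
  | _, _, r, .imp φ ψ => .imp (φ.ren r) (ψ.ren r)
  | _, _, r, .all φ => .all (φ.ren (Ren.lift r))

/-- Apply a (capture-avoiding) substitution to a formula. -/
def Fm.subst : {Γ Δ : Ctx} → Subst Γ Δ → Fm Γ → Fm Δ
  | _, _, s, .eq a b => .eq (a.subst s) (b.subst s)
  | _, _, s, .lt a b => .lt (a.subst s) (b.subst s)
  | _, _, _, .fal => .fal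
  | _, _, s, .imp φ ψ => .imp (φ.subst s) (ψ.subst s)
  | _, _, s, .all φ => .all (φ.subst (Subst.lift s))

/-- `φ.inst t` replaces the most recent variable of `φ` by `t`. -/
def Fm.inst {Γ : Ctx} {σ : Ty} (φ : Fm (σ :: Γ)) (t : Tm Γ σ) : Fm Γ :=
  φ.subst (Subst.cons t (fun x => .var x))

/-- The universal closure of a formula. -/
def Fm.close : {Γ : Ctx} → Fm Γ → Sentence
  | [], φ => φ
  | _ :: _, φ => Fm.close (.all φ)

/-! ## Derivations -/

/-- Natural deduction for many-sorted classical logic with equality at type `0`.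
`Prv T Γ Δ φ` says that `φ` is derivable from the axioms `T` and the open assumptions `Δ`,
where `Γ` lists the variables that may occur free. -/
inductive Prv (T : Set Sentence) : (Γ : Ctx) → List (Fm Γ) → Fm Γ → Prop
  | ax {Γ : Ctx} {Δ : List (Fm Γ)} {φ : Sentence} :
      φ ∈ T → Prv T Γ Δ (φ.ren Ren.nil)
  | hyp {Γ : Ctx} {Δ : List (Fm Γ)} {φ : Fm Γ} : φ ∈ Δ → Prv T Γ Δ φ
  | impI {Γ : Ctx} {Δ : List (Fm Γ)} {φ ψ : Fm Γ} :
      Prv T Γ (φ :: Δ) ψ → Prv T Γ Δ (.imp φ ψ)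
  | impE {Γ : Ctx} {Δ : List (Fm Γ)} {φ ψ : Fm Γ} :
      Prv T Γ Δ (.imp φ ψ) → Prv T Γ Δ φ → Prv T Γ Δ ψ
  | raa {Γ : Ctx} {Δ : List (Fm Γ)} {φ : Fm Γ} :
      Prv T Γ (.imp φ .fal :: Δ) .fal → Prv T Γ Δ φ
  | allI {Γ : Ctx} {Δ : List (Fm Γ)} {σ : Ty} {φ : Fm (σ :: Γ)} :
      Prv T (σ :: Γ) (Δ.map (Fm.ren .succ)) φ → Prv T Γ Δ (.all φ)
  | allE {Γ : Ctx} {Δ : List (Fm Γ)} {σ : Ty} {φ : Fm (σ :: Γ)} (t : Tm Γ σ) :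
      Prv T Γ Δ (.all φ) → Prv T Γ Δ (φ.inst t)
  | eqRefl {Γ : Ctx} {Δ : List (Fm Γ)} (t : Tm Γ tp0) : Prv T Γ Δ (.eq t t)
  | eqSubst {Γ : Ctx} {Δ : List (Fm Γ)} {s t : Tm Γ tp0} (φ : Fm (tp0 :: Γ)) :
      Prv T Γ Δ (.eq s t) → Prv T Γ Δ (φ.inst s) → Prv T Γ Δ (φ.inst t)

/-- The theory with axioms `T` proves the sentence `φ`. -/
def Proves (T : Set Sentence) (φ : Sentence) : Prop := Prv T [] [] φ

/-! ## Defined connectives and notation for building formulas -/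

notation:30 a:31 " ➝ " b:30 => Fm.imp a b

/-- Negation. -/
def Fm.neg {Γ : Ctx} (φ : Fm Γ) : Fm Γ := φ ➝ Fm.fal

notation:max "∼" a:max => Fm.neg a

/-- Conjunction. -/
def Fm.conj {Γ : Ctx} (φ ψ : Fm Γ) : Fm Γ := ∼(φ ➝ ∼ψ)

/-- Disjunction. -/
def Fm.disj {Γ : Ctx} (φ ψ : Fm Γ) : Fm Γ := ∼φ ➝ ψ

notation:36 a:37 " ⋏ " b:36 => Fm.conj a b
notation:33 a:34 " ⋎ " b:33 => Fm.disj a b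

/-- Equivalence. -/
def Fm.iff {Γ : Ctx} (φ ψ : Fm Γ) : Fm Γ := (φ ➝ ψ) ⋏ (ψ ➝ φ)

notation:29 a:30 " ⭤ " b:30 => Fm.iff a b

/-- `Ext Γ Δ` says that `Δ` extends `Γ` by further variables in front. -/
class Ext (Γ Δ : Ctx) where
  /-- The induced weakening of variables. -/
  ren : Ren Γ Δ

instance Ext.refl (Γ : Ctx) : Ext Γ Γ := ⟨fun x => x⟩

instance Ext.step (Γ Δ : Ctx) (σ : Ty) [Ext Γ Δ] : Ext Γ (σ :: Δ) :=
  ⟨fun x => .succ (Ext.ren x)⟩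

/-- Weakening: regard a term as a term in a larger context. -/
def Tm.up {Γ Δ : Ctx} [Ext Γ Δ] {σ : Ty} (t : Tm Γ σ) : Tm Δ σ := t.ren Ext.ren

/-- Universal quantification, with the bound variable passed to the body. -/
def fa {Γ : Ctx} (σ : Ty) (F : Tm (σ :: Γ) σ → Fm (σ :: Γ)) : Fm Γ :=
  .all (F (.var .zero))

/-- Existential quantification, with the bound variable passed to the body. -/
def ex {Γ : Ctx} (σ : Ty) (F : Tm (σ :: Γ) σ → Fm (σ :: Γ)) : Fm Γ :=
  ∼(Fm.all ∼(F (.var .zero)))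

instance {Γ : Ctx} : Zero (Tm Γ tp0) := ⟨.zero⟩
instance {Γ : Ctx} : One (Tm Γ tp0) := ⟨.one⟩
instance {Γ : Ctx} : Add (Tm Γ tp0) := ⟨fun s t => Tm.add ⬝ s ⬝ t⟩
instance {Γ : Ctx} : Mul (Tm Γ tp0) := ⟨fun s t => Tm.mul ⬝ s ⬝ t⟩

notation:50 a:51 " ≐ " b:51 => Fm.eq a b
notation:50 a:51 " ≺ " b:51 => Fm.lt a b

/-- `s ≤ t` for terms of type `0`. -/
def Fm.le {Γ : Ctx} (s t : Tm Γ tp0) : Fm Γ := s ≺ t ⋎ s ≐ t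

notation:50 a:51 " ≼ " b:51 => Fm.le a b

/-- Equality at all finite types, defined pointwise from equality at type `0`. -/
def eqAt : {Γ : Ctx} → (τ : Ty) → Tm Γ τ → Tm Γ τ → Fm Γ
  | _, .nat, s, t => s ≐ t
  | _, .arr σ τ, s, t => fa σ fun z => eqAt τ (s.up ⬝ z) (t.up ⬝ z)

/-! ## Classes of formulas -/

/-- Quantifier-free formulas (with variables of arbitrary type). -/
def Fm.IsQF : {Γ : Ctx} → Fm Γ → Prop
  | _, .eq _ _ => True
  | _, .lt _ _ => True
  | _, .fal => True
  | _, .imp φ ψ => φ.IsQF ∧ ψ.IsQF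
  | _, .all _ => False

/-- All bound variables are of type `0`. -/
def Fm.IsArithmetical : {Γ : Ctx} → Fm Γ → Prop
  | _, .eq _ _ => True
  | _, .lt _ _ => True
  | _, .fal => True
  | _, .imp φ ψ => φ.IsArithmetical ∧ ψ.IsArithmetical
  | _, .all (σ := σ) φ => σ = tp0 ∧ φ.IsArithmetical

/-- All bound variables are of type `0` or `1`. For sentences, this is membership of the
language of second-order arithmetic, with sets given by characteristic functions (closed terms
of the language are admitted). -/
def Fm.IsSecondOrder : {Γ : Ctx} → Fm Γ → Prop
  | _, .eq _ _ => True
  | _, .lt _ _ => True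
  | _, .fal => True
  | _, .imp φ ψ => φ.IsSecondOrder ∧ ψ.IsSecondOrder
  | _, .all (σ := σ) φ => (σ = tp0 ∨ σ = tp1) ∧ φ.IsSecondOrder

/-! ## The base theory -/

/-- The axioms of (discretely) ordered semi-rings. -/
def basicAxioms : Set Sentence :=
  { fa tp0 fun x => fa tp0 fun y => fa tp0 fun z =>
      (x.up + y.up) + z ≐ x.up + (y.up + z),
    fa tp0 fun x => fa tp0 fun y => x.up + y ≐ y + x.up,
    fa tp0 fun x => x + 0 ≐ x,
    fa tp0 fun x => fa tp0 fun y => fa tp0 fun z =>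
      (x.up * y.up) * z ≐ x.up * (y.up * z),
    fa tp0 fun x => fa tp0 fun y => x.up * y ≐ y * x.up,
    fa tp0 fun x => x * 1 ≐ x,
    fa tp0 fun x => x * 0 ≐ 0,
    fa tp0 fun x => fa tp0 fun y => fa tp0 fun z =>
      x.up * (y.up + z) ≐ x.up * y.up + x.up * z,
    fa tp0 fun x => ∼(x ≺ x),
    fa tp0 fun x => fa tp0 fun y => fa tp0 fun z =>
      x.up ≺ y.up ➝ y.up ≺ z ➝ x.up ≺ z,
    fa tp0 fun x => fa tp0 fun y => x.up ≺ y ⋎ x.up ≐ y ⋎ y ≺ x.up,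
    fa tp0 fun x => fa tp0 fun y => fa tp0 fun z =>
      x.up ≺ y.up ➝ x.up + z ≺ y.up + z,
    fa tp0 fun x => fa tp0 fun y => fa tp0 fun z =>
      x.up ≺ y.up ➝ 0 ≺ z ➝ x.up * z ≺ y.up * z,
    fa tp0 fun x => 0 ≼ x,
    0 ≺ 1,
    fa tp0 fun x => fa tp0 fun y => x.up ≺ y ➝ x.up + 1 ≼ y }

/-- The defining axioms of the combinators. -/
def combinatorAxioms : Set Sentence :=
  { φ | ∃ σ τ : Ty, φ = fa σ fun x => fa τ fun y =>
      eqAt σ (Tm.K σ τ ⬝ x.up ⬝ y) x.up } ∪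
  { φ | ∃ ρ σ τ : Ty, φ = fa (ρ ⇾ σ ⇾ τ) fun x => fa (ρ ⇾ σ) fun y => fa ρ fun z =>
      eqAt τ (Tm.S ρ σ τ ⬝ x.up ⬝ y.up ⬝ z) (x.up ⬝ z ⬝ (y.up ⬝ z)) }

/-- The defining axioms of the recursor `R 0`. -/
def recursorAxioms : Set Sentence :=
  { fa tp1 fun f => fa tp0 fun m => Tm.R tp0 ⬝ f.up ⬝ m ⬝ 0 ≐ m,
    fa tp1 fun f => fa tp0 fun m => fa tp0 fun n =>
      Tm.R tp0 ⬝ f.up ⬝ m.up ⬝ (n + 1) ≐ f.up ⬝ (Tm.R tp0 ⬝ f.up ⬝ m.up ⬝ n) }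

/-- The axioms of extensionality. -/
def extensionalityAxioms : Set Sentence :=
  { φ | ∃ ρ τ : Ty, φ = fa ρ fun x => fa ρ fun y => fa (ρ ⇾ τ) fun F =>
      eqAt ρ x.up y.up ➝ eqAt τ (F ⬝ x.up) (F ⬝ y.up) }

/-- Induction for quantifier-free formulas with arbitrary parameters. -/
def qfInduction : Set Sentence :=
  { φ | ∃ (Γ : Ctx) (A : Fm (tp0 :: Γ)), A.IsQF ∧
      φ = Fm.close (A.inst 0 ➝
        Fm.all (A ➝ A.subst (Subst.cons (.var .zero + 1) fun x => .var (.succ x))) ➝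
        Fm.all A) }

/-- The quantifier-free axiom of choice: for `A(x, y)` quantifier-free with arbitrary parameters,
`∀ x ∃ y A(x, y) → ∃ Y ∀ x A(x, Y x)`. In `A`, the variable `y` is index `0` and `x` is
index `1`. -/
def qfAC (σ τ : Ty) : Set Sentence :=
  { φ | ∃ (Γ : Ctx) (A : Fm (τ :: σ :: Γ)), A.IsQF ∧
      φ = Fm.close ((fa σ fun _ => ex τ fun _ => A) ➝
        ex (σ ⇾ τ) fun Y => fa σ fun x =>
          A.subst (Subst.cons (Y.up ⬝ x) (Subst.cons x fun z => .var (.succ (.succ z))))) }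

/-- The base theory of higher-order Reverse Mathematics. -/
def RCA0ω : Set Sentence :=
  basicAxioms ∪ combinatorAxioms ∪ recursorAxioms ∪ extensionalityAxioms ∪
    qfInduction ∪ qfAC tp1 tp0

/-! ## Arithmetical comprehension and the functional `∃²` -/

/-- Sets are given by characteristic functions with values in `{0, 1}`. -/
def isBinary {Γ : Ctx} (f : Tm Γ tp1) : Fm Γ := fa tp0 fun n => f.up ⬝ n ≼ 1

/-- Arithmetical comprehension: for every arithmetical formula `φ(n)` of second-order arithmetic,
with number and function parameters, the set `{n : φ(n)}` exists. -/
def ACA : Set Sentence :=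
  { ψ | ∃ (Γ : Ctx) (φ : Fm (tp0 :: Γ)), (∀ σ ∈ Γ, σ = tp0 ∨ σ = tp1) ∧ φ.IsArithmetical ∧
      ψ = Fm.close (ex tp1 fun X => isBinary X ⋏
        fa tp0 fun n => (X.up ⬝ n ≐ 1 ⭤ φ.ren (Ren.lift .succ))) }

/-- `(∃²)`: there is a functional of type `2`, bounded by `1`, deciding whether `f` has a zero. -/
def E2 : Sentence :=
  ex tp2 fun F => (fa tp1 fun f => F.up ⬝ f ≼ 1) ⋏
    fa tp1 fun f => ((ex tp0 fun n => f.up ⬝ n ≐ 0) ⭤ F.up ⬝ f ≐ 0)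

/-! ## Weak weak König's lemma -/

/-- The function `x ↦ x + x`, as the closed term `S (+) (S K K)`. -/
def dbl {Γ : Ctx} : Tm Γ tp1 :=
  Tm.S tp0 tp0 tp0 ⬝ Tm.add ⬝ (Tm.S tp0 tp1 tp0 ⬝ Tm.K tp0 tp1 ⬝ Tm.K tp0 tp0)

/-- The term `2 ^ t`, by iterating the doubling function. -/
def pow2 {Γ : Ctx} (t : Tm Γ tp0) : Tm Γ tp0 := Tm.R tp0 ⬝ dbl ⬝ 1 ⬝ t

/-- The term `2 * t`. -/
def twice {Γ : Ctx} (t : Tm Γ tp0) : Tm Γ tp0 := t + t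

/-- Finite binary strings are coded by positive numbers: the empty string has code `1`, and if
`c` codes `σ`, then `2c` and `2c + 1` code `σ` extended by `0` and by `1`. So the strings of
length `n` are the numbers in `[2 ^ n, 2 ^ (n + 1))`. `isTree T` says that `T` is (the
characteristic function of) a set of codes of strings, closed under initial segments. -/
def isTree {Γ : Ctx} (T : Tm Γ tp1) : Fm Γ :=
  isBinary T ⋏ T ⬝ 0 ≐ 0 ⋏
    fa tp0 fun c => 0 ≺ c ➝
      (T.up ⬝ twice c ≐ 1 ⋎ T.up ⬝ (twice c + 1) ≐ 1) ➝ T.up ⬝ c ≐ 1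

/-- `c n` is the code of the initial segment of length `n` of the binary sequence `f`. -/
def isInitSeg {Γ : Ctx} (f c : Tm Γ tp1) : Fm Γ :=
  c ⬝ 0 ≐ 1 ⋏ fa tp0 fun n => c.up ⬝ (n + 1) ≐ twice (c.up ⬝ n) + f.up ⬝ n

/-- The binary sequence `f` is an infinite path through `T`. -/
def isPath {Γ : Ctx} (T f : Tm Γ tp1) : Fm Γ :=
  isBinary f ⋏ ex tp1 fun c => isInitSeg f.up c ⋏ fa tp0 fun n => T.up ⬝ (c.up ⬝ n) ≐ 1

/-- `g n` is the sum of `s i` over `i < n`; for `s` with values in `{0, 1}`, this is the number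
of elements below `n` of the set given by `s`. -/
def isCount {Γ : Ctx} (s g : Tm Γ tp1) : Fm Γ :=
  g ⬝ 0 ≐ 0 ⋏ fa tp0 fun i => g.up ⬝ (i + 1) ≐ g.up ⬝ i + s.up ⬝ i

/-- Weak weak König's lemma: if a tree `T` of binary strings has no infinite path, then
`#{σ ∈ T : |σ| = n} / 2 ^ n` tends to `0`. Here the number of strings of length `n` in `T` is
`g (2 ^ (n + 1)) - g (2 ^ n)`, and the last line says that its product with `2 ^ k` is
less than `2 ^ n`. -/
def WWKL : Sentence :=
  fa tp1 fun T => isTree T ➝ ∼(ex tp1 fun f => isPath T.up f) ➝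
    ex tp1 fun g => isCount T.up g ⋏
      fa tp0 fun k => ex tp0 fun N => fa tp0 fun n => N.up ≼ n ➝
        pow2 k.up * (g.up ⬝ pow2 (n + 1)) ≺ pow2 k.up * (g.up ⬝ pow2 n) + pow2 n

/-! ## Rational and real numbers in the formal language -/

/-- A triple of terms of type `0`, standing for the rational `(pos - neg) / den`. -/
structure RatTm (Γ : Ctx) where
  /-- Positive part of the numerator. -/
  pos : Tm Γ tp0
  /-- Negative part of the numerator. -/
  neg : Tm Γ tp0
  /-- Denominator. -/
  den : Tm Γ tp0

/-- Weakening. -/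
def RatTm.up {Γ Δ : Ctx} [Ext Γ Δ] (p : RatTm Γ) : RatTm Δ := ⟨p.pos.up, p.neg.up, p.den.up⟩

instance {Γ : Ctx} : Add (RatTm Γ) :=
  ⟨fun p q => ⟨p.pos * q.den + q.pos * p.den, p.neg * q.den + q.neg * p.den, p.den * q.den⟩⟩

/-- `p < q`. -/
def RatTm.lt {Γ : Ctx} (p q : RatTm Γ) : Fm Γ :=
  p.pos * q.den + q.neg * p.den ≺ q.pos * p.den + p.neg * q.den

/-- `p ≤ q`. -/
def RatTm.le {Γ : Ctx} (p q : RatTm Γ) : Fm Γ :=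
  p.pos * q.den + q.neg * p.den ≼ q.pos * p.den + p.neg * q.den

/-- The rational `a / 2 ^ n`. -/
def dyadic {Γ : Ctx} (a n : Tm Γ tp0) : RatTm Γ := ⟨a, 0, pow2 n⟩

/-- `|p - q| < e`. -/
def RatTm.absLt {Γ : Ctx} (p q e : RatTm Γ) : Fm Γ := p.lt (q + e) ⋏ q.lt (p + e)

/-- `|p - q| ≤ e`. -/
def RatTm.absLe {Γ : Ctx} (p q e : RatTm Γ) : Fm Γ := p.le (q + e) ⋏ q.le (p + e)

/-- `c` is the value at `(a, b)` of the Cantor pairing function `(a + b)(a + b + 1) / 2 + a`. -/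
def isPair {Γ : Ctx} (c a b : Tm Γ tp0) : Fm Γ :=
  twice c ≐ (a + b) * (a + b + 1) + twice a

/-- The number `q` codes the rational `(u - v) / d`: it is the pair of `a` and `d - 1`, where `a`
is `2 u` if the rational is non-negative (and `v = 0`), and is `2 v - 1` if it is negative
(and `u = 0`). -/
def codesRat {Γ : Ctx} (q u v d : Tm Γ tp0) : Fm Γ :=
  ex tp0 fun a => ex tp0 fun b => isPair q.up a.up b ⋏ d.up ≐ b + 1 ⋏
    ((a.up ≐ twice u.up ⋏ v.up ≐ 0) ⋎ (a.up + 1 ≐ twice v.up ⋏ u.up ≐ 0))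

/-- `F` holds for the rational coded by the number `q`. -/
def decode {Γ : Ctx} (q : Tm Γ tp0)
    (F : RatTm (tp0 :: tp0 :: tp0 :: Γ) → Fm (tp0 :: tp0 :: tp0 :: Γ)) : Fm Γ :=
  fa tp0 fun u => fa tp0 fun v => fa tp0 fun d =>
    codesRat q.up u.up v.up d ➝ F ⟨u.up, v.up, d⟩

/-- `x` represents a real number: for all `n` and `i`, `|q_n - q_{n+i}| < 1 / 2 ^ n`, where `q_n`
is the rational coded by `x n`. -/
def isReal {Γ : Ctx} (x : Tm Γ tp1) : Fm Γ :=
  fa tp0 fun n => fa tp0 fun i =>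
    decode (x.up ⬝ n.up) fun p => decode (x.up ⬝ (n.up + i.up)) fun q =>
      p.up.absLt q (dyadic 1 n.up)

/-- Equality of real numbers: for all `n`, `|q_n - r_n| ≤ 2 / 2 ^ n`. -/
def eqReal {Γ : Ctx} (x y : Tm Γ tp1) : Fm Γ :=
  fa tp0 fun n => decode (x.up ⬝ n) fun p => decode (y.up ⬝ n.up) fun q =>
    p.up.absLe q (dyadic (1 + 1) n.up)

/-- The real number `x` is positive: for some `n`, `q_n > 1 / 2 ^ n`. -/
def isPos {Γ : Ctx} (x : Tm Γ tp1) : Fm Γ :=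
  ex tp0 fun n => decode (x.up ⬝ n) fun p => (dyadic 1 n.up).lt p

/-- The real number `x` lies in `[0, 1]`: for all `n`, `0 ≤ q_n + 1 / 2 ^ n` and
`q_n ≤ 1 + 1 / 2 ^ n`. -/
def inUnit {Γ : Ctx} (x : Tm Γ tp1) : Fm Γ :=
  fa tp0 fun n => decode (x.up ⬝ n) fun p =>
    (dyadic 0 0).le (p + dyadic 1 n.up) ⋏ p.le (dyadic 1 0 + dyadic 1 n.up)

/-- The rational `a` lies in the open interval `(y - z, y + z)`, for real numbers `y` and `z`
approximated by `q_n` and `r_n`: for some `n`, `|a - q_n| + 2 / 2 ^ n < r_n`. -/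
def inBall {Γ : Ctx} (a : RatTm Γ) (y z : Tm Γ tp1) : Fm Γ :=
  ex tp0 fun n => decode (y.up ⬝ n) fun p => decode (z.up ⬝ n.up) fun r =>
    (a.up + dyadic (1 + 1) n.up).lt (p.up + r) ⋏ (p.up + dyadic (1 + 1) n.up).lt (a.up + r)

/-- `Ψ` is a function from the real numbers to the positive real numbers, that is, a functional of
type `1 → 1` mapping representations of reals to representations of positive reals and respecting
equality of reals. -/
def isPosFun {Γ : Ctx} (Ψ : Tm Γ (tp1 ⇾ tp1)) : Fm Γ :=
  (fa tp1 fun x => isReal x ➝ isReal (Ψ.up ⬝ x) ⋏ isPos (Ψ.up ⬝ x)) ⋏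
    fa tp1 fun x => fa tp1 fun y => isReal x.up ➝ isReal y ➝ eqReal x.up y ➝
      eqReal (Ψ.up ⬝ x.up) (Ψ.up ⬝ y)

/-! ## The weak Heine-Borel theorem for uncountable covers -/

/-- The closed dyadic interval `[j / 2 ^ l, (j + 1) / 2 ^ l]` is contained in one of the open
intervals `(y i - Ψ (y i), y i + Ψ (y i))` with `i < n`. -/
def cellCovered {Γ : Ctx} (Ψ : Tm Γ (tp1 ⇾ tp1)) (n : Tm Γ tp0) (y : Tm Γ (tp0 ⇾ tp1))
    (j l : Tm Γ tp0) : Fm Γ :=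
  ex tp0 fun i => i ≺ n.up ⋏
    inBall (dyadic j.up l.up) (y.up ⬝ i) (Ψ.up ⬝ (y.up ⬝ i)) ⋏
    inBall (dyadic (j.up + 1) l.up) (y.up ⬝ i) (Ψ.up ⬝ (y.up ⬝ i))

/-- The union of the open intervals `(y i - Ψ (y i), y i + Ψ (y i))` with `i < n` has total length
at least `1 - 1 / 2 ^ k` inside `[0, 1]`. The length of this union is the supremum over `l` of
the total length of the dyadic subintervals of `[0, 1]` of length `1 / 2 ^ l` that are contained in
one of the given intervals (inner Jordan content). So the formula says: for every `m` there are a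
level `l` and a set `s` of such dyadic intervals of total length at least
`1 - 1 / 2 ^ k - 1 / 2 ^ m`; the number of elements of `s` is `g (2 ^ l)`. -/
def unionLengthGe {Γ : Ctx} (Ψ : Tm Γ (tp1 ⇾ tp1)) (n : Tm Γ tp0) (y : Tm Γ (tp0 ⇾ tp1))
    (k : Tm Γ tp0) : Fm Γ :=
  fa tp0 fun m => ex tp0 fun l => ex tp1 fun s => ex tp1 fun g =>
    isBinary s.up ⋏ isCount s.up g ⋏
    (fa tp0 fun j => j ≺ pow2 l.up ➝ s.up ⬝ j ≐ 1 ➝ cellCovered Ψ.up n.up y.up j l.up) ⋏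
    (dyadic 1 0).le (dyadic (g ⬝ pow2 l.up) l.up + dyadic 1 k.up + dyadic 1 m.up)

/-- `WHBU`: for every `Ψ` from the reals to the positive reals and every `k`, there are finitely
many points `y 0, …, y (n - 1)` of `[0, 1]` such that the corresponding intervals of the canonical
cover have total length (that is, their union has measure) at least `1 - 1 / 2 ^ k` in `[0, 1]`. -/
def WHBU : Sentence :=
  fa (tp1 ⇾ tp1) fun Ψ => isPosFun Ψ ➝ fa tp0 fun k =>
    ex tp0 fun n => ex (tp0 ⇾ tp1) fun y =>
      (fa tp0 fun i => i ≺ n.up ➝ isReal (y.up ⬝ i) ⋏ inUnit (y.up ⬝ i)) ⋏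
      unionLengthGe Ψ.up n.up y k.up

end HORM

open HORM

namespace HORM

/-! ## Renaming and substitution -/

/-! The provability claims are reduced to claims about models. A Henkin construction shows that the
calculus is complete for structures in which functionals are determined by their values
(`Proves.of_models`), so both equivalences need only be checked in an arbitrary extensional model
`M` of the base theory (`Proves.of_mods`). Numbers, induction and choice are those of `M`, possibly
nonstandard. `Def` tracks which external functions and predicates are represented in `M`, so that
induction, bounded search and choice apply to them. Inequalities are computed in the ordered field
of fractions of the numbers of `M`.

Three implications carry the theorem.

If `∃²` exists, numerical quantifiers preserve definability, so `M` satisfies arithmetical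
comprehension (`models_ACA`). Soundness and the two hypotheses on `X` then give `X` and WWKL.

If WWKL holds and `∃²` does not exist, WHBU follows (`WHBUIn_of_not_E2`). By Grilliot's trick, a
sufficiently discontinuous functional would yield `∃²`. Hence, along every branch of Cantor space,
the value of `Ψ` at the left end point of some dyadic cell exceeds the length of that cell. The
strings for which no such initial segment has been found yet form a tree without paths. By WWKL they
have small measure at some finite level, and the other cells of that level are covered by finitely
many intervals with rational centres.

WHBU implies WWKL (`WWKLIn_of_WHBUIn`). For a tree without paths, let `Ψ x` be, roughly, the largest
`ρ` such that for some level `n` with `ρ ≤ 2 ^ (-n)` the cells of the strings of length `n` in the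
tree keep distance `ρ` from `x`. This function is Lipschitz, and it is positive because a real to
which the tree stays close at all levels would produce a path. A cell inside one of its intervals
contains no strings of the tree from some level on, so a covering of measure almost `1` makes the
tree thin.

The first equivalence combines the three implications. For the second, `∃²` gives `X`, while `X`
gives WWKL and hence `∃²` or WHBU. -/

theorem Tm.ren_eq_subst {Γ Δ : Ctx} (r : Ren Γ Δ) {σ : Ty} (t : Tm Γ σ) :
    t.ren r = t.subst (fun x => .var (r x)) := by
  induction t <;> simp_all [Tm.ren, Tm.subst]

theorem Tm.subst_subst {Γ Δ Θ : Ctx} (s : Subst Γ Δ) (s' : Subst Δ Θ) {σ : Ty} (t : Tm Γ σ) :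
    (t.subst s).subst s' = t.subst (fun x => (s x).subst s') := by
  induction t <;> simp_all [Tm.subst]

theorem Tm.subst_var {Γ : Ctx} {σ : Ty} (t : Tm Γ σ) : t.subst (fun x => .var x) = t := by
  induction t <;> simp_all [Tm.subst]

theorem Subst.lift_var {Γ Δ : Ctx} (r : Ren Γ Δ) {τ : Ty} :
    @Subst.lift Γ Δ (fun x => .var (r x)) τ = fun {_} x => .var (Ren.lift r x) := by
  funext σ x
  cases x <;> rfl

theorem Subst.lift_id {Γ : Ctx} {τ : Ty} :
    @Subst.lift Γ Γ (fun x => .var x) τ = fun {_} x => .var x := by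
  funext σ x
  cases x <;> rfl

theorem Subst.lift_comp {Γ Δ Θ : Ctx} (s : Subst Γ Δ) (s' : Subst Δ Θ) {τ : Ty} :
    (fun {_} x => (@Subst.lift Γ Δ s τ _ x).subst (Subst.lift s')) =
      @Subst.lift Γ Θ (fun x => (s x).subst s') τ := by
  funext σ x
  cases x with
  | zero => rfl
  | succ x =>
    simp only [Subst.lift, Tm.ren_eq_subst, Tm.subst_subst]
    congr 1
    funext σ y
    simp [Tm.subst, Subst.lift, Tm.ren_eq_subst]

theorem Fm.ren_eq_subst {Γ Δ : Ctx} (r : Ren Γ Δ) (φ : Fm Γ) :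
    φ.ren r = φ.subst (fun x => .var (r x)) := by
  induction φ generalizing Δ with
  | eq | lt => simp [Fm.ren, Fm.subst, Tm.ren_eq_subst]
  | fal => rfl
  | imp φ ψ h1 h2 => simp [Fm.ren, Fm.subst, h1, h2]
  | all φ h => simp only [Fm.ren, Fm.subst, h, Subst.lift_var]

theorem Fm.subst_subst {Γ Δ Θ : Ctx} (s : Subst Γ Δ) (s' : Subst Δ Θ) (φ : Fm Γ) :
    (φ.subst s).subst s' = φ.subst (fun x => (s x).subst s') := by
  induction φ generalizing Δ Θ with
  | eq | lt => simp [Fm.subst, Tm.subst_subst]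
  | fal => rfl
  | imp φ ψ h1 h2 => simp [Fm.subst, h1, h2]
  | all φ h => simp only [Fm.subst, h, Subst.lift_comp]

theorem Fm.subst_var {Γ : Ctx} (φ : Fm Γ) : φ.subst (fun x => .var x) = φ := by
  induction φ with
  | eq | lt => simp [Fm.subst, Tm.subst_var]
  | fal => rfl
  | imp φ ψ h1 h2 => simp [Fm.subst, h1, h2]
  | all φ h => simp only [Fm.subst, Subst.lift_id, h]

theorem Tm.ren_ren {Γ Δ Θ : Ctx} (r : Ren Γ Δ) (s : Ren Δ Θ) {σ : Ty} (t : Tm Γ σ) :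
    (t.ren r).ren s = t.ren (fun x => s (r x)) := by
  simp [Tm.ren_eq_subst, Tm.subst_subst, Tm.subst]

theorem Fm.ren_ren {Γ Δ Θ : Ctx} (r : Ren Γ Δ) (s : Ren Δ Θ) (φ : Fm Γ) :
    (φ.ren r).ren s = φ.ren (fun x => s (r x)) := by
  simp [Fm.ren_eq_subst, Fm.subst_subst, Tm.subst]

theorem Fm.ren_subst {Γ Δ Θ : Ctx} (s : Subst Γ Δ) (r : Ren Δ Θ) (φ : Fm Γ) :
    (φ.subst s).ren r = φ.subst (fun x => (s x).ren r) := by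
  simp [Fm.ren_eq_subst, Fm.subst_subst, Tm.ren_eq_subst]

theorem Fm.subst_ren {Γ Δ Θ : Ctx} (r : Ren Γ Δ) (s : Subst Δ Θ) (φ : Fm Γ) :
    (φ.ren r).subst s = φ.subst (fun x => s (r x)) := by
  simp [Fm.ren_eq_subst, Fm.subst_subst, Tm.subst]

theorem Fm.ren_id {Γ : Ctx} (φ : Fm Γ) : φ.ren (fun x => x) = φ := by
  rw [Fm.ren_eq_subst, Fm.subst_var]

theorem Tm.ren_id {Γ : Ctx} {σ : Ty} (t : Tm Γ σ) : t.ren (fun x => x) = t := by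
  rw [Tm.ren_eq_subst, Tm.subst_var]

theorem Fm.inst_ren {Γ Δ : Ctx} {σ : Ty} (φ : Fm (σ :: Γ)) (t : Tm Γ σ) (r : Ren Γ Δ) :
    (φ.inst t).ren r = (φ.ren (Ren.lift r)).inst (t.ren r) := by
  simp only [Fm.inst, Fm.ren_subst, Fm.subst_ren]
  congr 1
  funext τ x
  cases x <;> rfl

theorem Fm.inst_succ {Γ : Ctx} {σ : Ty} (φ : Fm Γ) (t : Tm Γ σ) :
    (φ.ren .succ).inst t = φ := by
  simp only [Fm.inst, Fm.subst_ren, Subst.cons]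
  exact φ.subst_var

theorem Fm.ren_succ_lift {Γ Δ : Ctx} {σ : Ty} (φ : Fm Γ) (r : Ren Γ Δ) :
    (φ.ren .succ).ren (@Ren.lift Γ Δ r σ) = (φ.ren r).ren .succ := by
  simp only [Fm.ren_ren, Ren.lift]

/-- Substituting the variable just added undoes the weakening past it. This identifies the
assumption added at a Henkin stage with an instance of the weakened item. -/
theorem Fm.lift_inst_zero {Γ Δ : Ctx} {σ : Ty} (φ : Fm (σ :: Γ)) (r : Ren Γ Δ) :
    (φ.ren (Ren.lift fun x => .succ (r x))).inst (.var .zero) = φ.ren (Ren.lift r) := by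
  simp only [Fm.inst, Fm.subst_ren]
  rw [Fm.ren_eq_subst]
  congr 1
  funext τ x
  cases x <;> rfl

theorem Fm.ren_nil {Γ : Ctx} (r : Ren [] Γ) : @r = @Ren.nil Γ := by
  funext σ x
  cases x

theorem eqAt_subst {Γ Δ : Ctx} (s : Subst Γ Δ) {τ : Ty} (a b : Tm Γ τ) :
    (eqAt τ a b).subst s = eqAt τ (a.subst s) (b.subst s) := by
  induction τ generalizing Γ Δ with
  | nat => rfl
  | arr σ τ _ h =>
    have hup (a : Tm Γ (σ ⇾ τ)) : (a.ren Var.succ).subst (@Subst.lift Γ Δ s σ) =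
        (a.subst s).ren Var.succ := by
      simp only [Tm.ren_eq_subst, Tm.subst_subst, Tm.subst, Subst.lift]
    exact congrArg Fm.all ((h _ _ _).trans (congrArg₂ (eqAt τ)
      (congrArg (· ⬝ Tm.var Var.zero) (hup a)) (congrArg (· ⬝ Tm.var Var.zero) (hup b))))

theorem eqAt_ren {Γ Δ : Ctx} (r : Ren Γ Δ) {τ : Ty} (a b : Tm Γ τ) :
    (eqAt τ a b).ren r = eqAt τ (a.ren r) (b.ren r) := by
  simp only [Fm.ren_eq_subst, eqAt_subst, Tm.ren_eq_subst]

/-! ## Structural rules -/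

/-- A single induction on derivations yields weakening of the context and of the assumptions. The
renaming and the new assumptions stay quantified in the conclusion, because `allI` passes to a
lifted renaming. -/
theorem Prv.ren {T : Set Sentence} {Γ : Ctx} {Δ : List (Fm Γ)} {φ : Fm Γ} (h : Prv T Γ Δ φ) :
    ∀ {Γ' : Ctx} (r : Ren Γ Γ') (Δ' : List (Fm Γ')), (∀ ψ ∈ Δ, ψ.ren r ∈ Δ') →
      Prv T Γ' Δ' (φ.ren r) := by
  induction h with
  | ax h =>
    intro Γ' r Δ' _
    rw [Fm.ren_ren, Fm.ren_nil fun {_} x => r (Ren.nil x)]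
    exact .ax h
  | hyp h => exact fun r Δ' hΔ => .hyp (hΔ _ h)
  | impI _ ih =>
    refine fun r Δ' hΔ => .impI (ih r _ ?_)
    intro ψ hψ
    rcases List.mem_cons.1 hψ with rfl | hψ
    · exact List.mem_cons_self
    · exact List.mem_cons_of_mem _ (hΔ _ hψ)
  | impE _ _ ih1 ih2 => exact fun r Δ' hΔ => .impE (ih1 r Δ' hΔ) (ih2 r Δ' hΔ)
  | raa _ ih =>
    refine fun r Δ' hΔ => .raa (ih r _ ?_)
    intro ψ hψ
    rcases List.mem_cons.1 hψ with rfl | hψ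
    · exact List.mem_cons_self
    · exact List.mem_cons_of_mem _ (hΔ _ hψ)
  | allI _ ih =>
    refine fun r Δ' hΔ => .allI (ih (Ren.lift r) _ ?_)
    intro ψ hψ
    obtain ⟨χ, hχ, rfl⟩ := List.mem_map.1 hψ
    rw [Fm.ren_succ_lift]
    exact List.mem_map_of_mem (hΔ _ hχ)
  | allE t _ ih =>
    intro Γ' r Δ' hΔ
    rw [Fm.inst_ren]
    exact .allE _ (ih r Δ' hΔ)
  | eqRefl t => exact fun r Δ' _ => .eqRefl _
  | eqSubst φ _ _ ih1 ih2 =>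
    intro Γ' r Δ' hΔ
    have h2 := ih2 r Δ' hΔ
    rw [Fm.inst_ren] at h2 ⊢
    exact .eqSubst _ (ih1 r Δ' hΔ) h2

theorem Prv.weaken {T : Set Sentence} {Γ : Ctx} {Δ Δ' : List (Fm Γ)} {φ : Fm Γ}
    (h : Prv T Γ Δ φ) (hΔ : ∀ ψ ∈ Δ, ψ ∈ Δ') : Prv T Γ Δ' φ := by
  have := h.ren (fun x => x) Δ' (fun ψ hψ => by rw [Fm.ren_id]; exact hΔ ψ hψ)
  rwa [Fm.ren_id] at this

theorem Prv.exfalso {T : Set Sentence} {Γ : Ctx} {Δ : List (Fm Γ)} {φ : Fm Γ}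
    (h : Prv T Γ Δ .fal) : Prv T Γ Δ φ :=
  .raa (h.weaken fun _ => List.mem_cons_of_mem _)

theorem Prv.cutAll {T : Set Sentence} {Γ : Ctx} {Δ : List (Fm Γ)} (L : List (Fm Γ)) {φ : Fm Γ}
    (h : Prv T Γ L φ) (hL : ∀ ψ ∈ L, Prv T Γ Δ ψ) : Prv T Γ Δ φ := by
  induction L generalizing φ with
  | nil => exact h.weaken (by simp)
  | cons ψ L ih =>
    exact .impE (ih (.impI h) fun χ hχ => hL χ (List.mem_cons_of_mem _ hχ))
      (hL ψ List.mem_cons_self)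

theorem Prv.eqSymm {T : Set Sentence} {Γ : Ctx} {Δ : List (Fm Γ)} {s t : Tm Γ tp0}
    (h : Prv T Γ Δ (s ≐ t)) : Prv T Γ Δ (t ≐ s) := by
  have := Prv.eqSubst (T := T) (Δ := Δ) (s := s) (t := t)
    (.eq (.var .zero) (s.ren .succ)) h (by
      simp only [Fm.inst, Fm.subst, Tm.subst, Subst.cons, Tm.ren_eq_subst, Tm.subst_subst,
        Tm.subst_var]
      exact .eqRefl s)
  simpa only [Fm.inst, Fm.subst, Tm.subst, Subst.cons, Tm.ren_eq_subst, Tm.subst_subst,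
    Tm.subst_var] using this

/-- Two uses of `eqSubst`, one for each argument. `R` stands for `≐` or `≺`. -/
theorem Prv.eqReplace {T : Set Sentence} {Γ : Ctx} {Δ : List (Fm Γ)} {s s' t t' : Tm Γ tp0}
    (R : ∀ {Γ : Ctx}, Tm Γ tp0 → Tm Γ tp0 → Fm Γ)
    (hR : ∀ {Γ Δ : Ctx} (s : Subst Γ Δ) (a b : Tm Γ tp0),
      (R a b).subst s = R (a.subst s) (b.subst s))
    (hs : Prv T Γ Δ (s ≐ s')) (ht : Prv T Γ Δ (t ≐ t')) (h : Prv T Γ Δ (R s t)) :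
    Prv T Γ Δ (R s' t') := by
  have h1 := Prv.eqSubst (T := T) (Δ := Δ) (R (.var .zero) (t.ren .succ)) hs (by
    simpa only [Fm.inst, hR, Tm.subst, Subst.cons, Tm.ren_eq_subst, Tm.subst_subst,
      Tm.subst_var] using h)
  have h2 := Prv.eqSubst (T := T) (Δ := Δ) (R (s'.ren .succ) (.var .zero)) ht (by
    simpa only [Fm.inst, hR, Tm.subst, Subst.cons, Tm.ren_eq_subst, Tm.subst_subst,
      Tm.subst_var] using h1)
  simpa only [Fm.inst, hR, Tm.subst, Subst.cons, Tm.ren_eq_subst, Tm.subst_subst,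
    Tm.subst_var] using h2

theorem Prv.eqTrans {T : Set Sentence} {Γ : Ctx} {Δ : List (Fm Γ)} {s t u : Tm Γ tp0}
    (h1 : Prv T Γ Δ (s ≐ t)) (h2 : Prv T Γ Δ (t ≐ u)) : Prv T Γ Δ (s ≐ u) :=
  Prv.eqReplace Fm.eq (fun _ _ _ => rfl) (.eqRefl s) h2 h1

theorem Prv.eqAt_app {T : Set Sentence} {Γ : Ctx} {Δ : List (Fm Γ)} {σ τ : Ty}
    {f g : Tm Γ (σ ⇾ τ)} (h : Prv T Γ Δ (eqAt (σ ⇾ τ) f g)) (t : Tm Γ σ) :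
    Prv T Γ Δ (eqAt τ (f ⬝ t) (g ⬝ t)) := by
  have := Prv.allE t h
  simp only [Fm.inst, eqAt_subst, Tm.subst, Tm.up, Tm.ren_eq_subst, Tm.subst_subst,
    Subst.cons] at this
  erw [Tm.subst_var, Tm.subst_var] at this
  exact this

theorem Prv.eqAt_ext {T : Set Sentence} {Γ : Ctx} {Δ : List (Fm Γ)} {σ τ : Ty}
    {f g : Tm Γ (σ ⇾ τ)}
    (h : Prv T (σ :: Γ) (Δ.map (Fm.ren .succ))
      (eqAt τ (f.ren .succ ⬝ .var .zero) (g.ren .succ ⬝ .var .zero))) :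
    Prv T Γ Δ (eqAt (σ ⇾ τ) f g) := .allI h

theorem Prv.up {T : Set Sentence} {Γ : Ctx} {Δ : List (Fm Γ)} {σ : Ty} {φ : Fm Γ}
    (h : Prv T Γ Δ φ) : Prv T (σ :: Γ) (Δ.map (Fm.ren .succ)) (φ.ren .succ) :=
  h.ren _ _ fun _ hψ => List.mem_map_of_mem hψ

theorem Prv.eqAt_refl {T : Set Sentence} {Γ : Ctx} {Δ : List (Fm Γ)} {σ : Ty} (t : Tm Γ σ) :
    Prv T Γ Δ (eqAt σ t t) := by
  induction σ generalizing Γ with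
  | nat => exact .eqRefl t
  | arr σ τ _ h => exact .eqAt_ext (h _)

theorem Prv.eqAt_symm {T : Set Sentence} {Γ : Ctx} {Δ : List (Fm Γ)} {σ : Ty} {s t : Tm Γ σ}
    (h : Prv T Γ Δ (eqAt σ s t)) : Prv T Γ Δ (eqAt σ t s) := by
  induction σ generalizing Γ with
  | nat => exact .eqSymm h
  | arr σ τ _ ih =>
    refine .eqAt_ext (ih ?_)
    have := h.up (σ := σ)
    rw [eqAt_ren] at this
    exact this.eqAt_app _

theorem Prv.eqAt_trans {T : Set Sentence} {Γ : Ctx} {Δ : List (Fm Γ)} {σ : Ty} {s t u : Tm Γ σ}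
    (h : Prv T Γ Δ (eqAt σ s t)) (h' : Prv T Γ Δ (eqAt σ t u)) : Prv T Γ Δ (eqAt σ s u) := by
  induction σ generalizing Γ with
  | nat => exact .eqTrans h h'
  | arr σ τ _ ih =>
    have h1 := h.up (σ := σ)
    have h2 := h'.up (σ := σ)
    rw [eqAt_ren] at h1 h2
    exact .eqAt_ext (ih (h1.eqAt_app _) (h2.eqAt_app _))

theorem Prv.axNil {T : Set Sentence} {Γ : Ctx} {Δ : List (Fm Γ)} {φ : Sentence} (h : φ ∈ T) :
    Prv T Γ Δ (φ.subst fun {_} x => .var (Ren.nil x)) := by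
  rw [← Fm.ren_eq_subst]
  exact .ax h

/-- An instance of the extensionality axiom. It is what makes application well defined on terms
modulo provable equality. -/
theorem Prv.eqAt_congr {T : Set Sentence} (hT : extensionalityAxioms ⊆ T) {Γ : Ctx}
    {Δ : List (Fm Γ)} {σ τ : Ty} (f : Tm Γ (σ ⇾ τ)) {s t : Tm Γ σ}
    (h : Prv T Γ Δ (eqAt σ s t)) : Prv T Γ Δ (eqAt τ (f ⬝ s) (f ⬝ t)) := by
  have h0 := Prv.axNil (Γ := Γ) (Δ := Δ) (hT ⟨σ, τ, rfl⟩)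
  have h1 := Prv.allE f (Prv.allE t (Prv.allE s h0))
  simp only [Fm.inst, Fm.subst, eqAt_subst, Tm.subst, Tm.up, Tm.ren,
    Subst.lift, Subst.cons, Ext.ren, Tm.ren_eq_subst, Tm.subst_subst, Tm.subst_var] at h1
  exact .impE h1 h

end HORM

namespace HORM

/-! ## Countability of the syntax -/

/-- A numerical code of a type. -/
def Ty.enc : Ty → ℕ
  | .nat => 0
  | .arr σ τ => Nat.pair σ.enc τ.enc + 1

theorem Ty.enc_injective : Function.Injective Ty.enc := by
  intro σ
  induction σ with
  | nat => intro τ h; cases τ <;> simp_all [Ty.enc]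
  | arr σ τ h1 h2 =>
    intro ρ h
    cases ρ with
    | nat => simp [Ty.enc] at h
    | arr σ' τ' =>
      simp only [Ty.enc, Nat.add_right_cancel_iff, Nat.pair_eq_pair] at h
      rw [h1 h.1, h2 h.2]

instance : Countable Ty := Ty.enc_injective.countable

/-- The position of a variable in its context. -/
def Var.enc : {Γ : Ctx} → {σ : Ty} → Var Γ σ → ℕ
  | _, _, .zero => 0
  | _, _, .succ x => x.enc + 1

theorem Var.enc_inj {Γ : Ctx} {σ τ : Ty} (x : Var Γ σ) (y : Var Γ τ) (h : x.enc = y.enc) :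
    σ = τ ∧ HEq x y := by
  induction x with
  | zero =>
    cases y with
    | zero => exact ⟨rfl, .rfl⟩
    | succ y => simp [Var.enc] at h
  | succ x ih =>
    cases y with
    | zero => simp [Var.enc] at h
    | succ y =>
      obtain ⟨rfl, h⟩ := ih y (by simpa [Var.enc] using h)
      cases h
      exact ⟨rfl, .rfl⟩

/-- A numerical code of a term. -/
def Tm.enc : {Γ : Ctx} → {σ : Ty} → Tm Γ σ → ℕ
  | _, _, .var x => Nat.pair 0 x.enc
  | _, _, .zero => Nat.pair 1 0
  | _, _, .one => Nat.pair 2 0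
  | _, _, .add => Nat.pair 3 0
  | _, _, .mul => Nat.pair 4 0
  | _, _, .K σ τ => Nat.pair 5 (Nat.pair σ.enc τ.enc)
  | _, _, .S ρ σ τ => Nat.pair 6 (Nat.pair ρ.enc (Nat.pair σ.enc τ.enc))
  | _, _, .R σ => Nat.pair 7 σ.enc
  | _, _, .app f t => Nat.pair 8 (Nat.pair f.enc t.enc)

/-- The type of the argument is not visible in the type of an application, so the code must
determine the type as well. Hence the comparison of terms of different types and the heterogeneous
equality. -/
theorem Tm.enc_inj {Γ : Ctx} {σ τ : Ty} (s : Tm Γ σ) (t : Tm Γ τ) (h : s.enc = t.enc) :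
    σ = τ ∧ HEq s t := by
  induction s generalizing τ with
  | var x =>
    cases t <;> simp only [Tm.enc, Nat.pair_eq_pair] at h <;> try (exfalso; omega)
    obtain ⟨rfl, h⟩ := Var.enc_inj _ _ h.2
    cases h
    exact ⟨rfl, .rfl⟩
  | app f t ihf iht =>
    cases t <;> simp only [Tm.enc, Nat.pair_eq_pair] at h <;> try (exfalso; omega)
    obtain ⟨h1, h2⟩ := ihf _ h.2.1
    obtain ⟨rfl, rfl⟩ := Ty.arr.inj h1
    obtain ⟨-, h3⟩ := iht _ h.2.2
    cases h2
    cases h3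
    exact ⟨rfl, .rfl⟩
  | K | S | R =>
    cases t <;> simp only [Tm.enc, Nat.pair_eq_pair, Ty.enc_injective.eq_iff] at h <;>
      try (exfalso; omega)
    simp only [true_and] at h
    obtain ⟨rfl, rfl, rfl⟩ := h
    exact ⟨rfl, .rfl⟩
  | zero | one | add | mul =>
    cases t <;> simp [Tm.enc, Nat.pair_eq_pair] at h ⊢

/-- A numerical code of a formula. -/
def Fm.enc : {Γ : Ctx} → Fm Γ → ℕ
  | _, .eq s t => Nat.pair 0 (Nat.pair s.enc t.enc)
  | _, .lt s t => Nat.pair 1 (Nat.pair s.enc t.enc)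
  | _, .fal => Nat.pair 2 0
  | _, .imp φ ψ => Nat.pair 3 (Nat.pair φ.enc ψ.enc)
  | _, .all (σ := σ) φ => Nat.pair 4 (Nat.pair σ.enc φ.enc)

theorem Fm.enc_injective {Γ : Ctx} : Function.Injective (@Fm.enc Γ) := by
  intro φ
  induction φ with
  | eq s t | lt s t =>
    intro ψ h
    cases ψ <;> simp only [Fm.enc, Nat.pair_eq_pair] at h <;> try (exfalso; omega)
    cases (Tm.enc_inj _ _ h.2.1).2
    cases (Tm.enc_inj _ _ h.2.2).2
    rfl
  | fal =>
    intro ψ h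
    cases ψ <;> simp only [Fm.enc, Nat.pair_eq_pair] at h <;> try (exfalso; omega)
    rfl
  | imp φ φ' h1 h2 =>
    intro ψ h
    cases ψ <;> simp only [Fm.enc, Nat.pair_eq_pair] at h <;> try (exfalso; omega)
    rw [h1 h.2.1, h2 h.2.2]
  | all φ ih =>
    intro ψ h
    cases ψ <;> simp only [Fm.enc, Nat.pair_eq_pair, Ty.enc_injective.eq_iff] at h <;>
      try (exfalso; omega)
    obtain ⟨-, rfl, h⟩ := h
    rw [ih h]

/-- Needed for enumerating all possible quantified formulas in the Henkin construction. -/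
instance {Γ : Ctx} : Countable (Fm Γ) := Fm.enc_injective.countable

/-! ## Extensional applicative structures -/

/-- Structures for the language of higher-order arithmetic in which equality at type `0` is
the identity. -/
structure Str where
  D : Ty → Type
  app : {σ τ : Ty} → D (σ ⇾ τ) → D σ → D τ
  zero : D tp0
  one : D tp0
  add : D (tp0 ⇾ tp0 ⇾ tp0)
  mul : D (tp0 ⇾ tp0 ⇾ tp0)
  K : (σ τ : Ty) → D (σ ⇾ τ ⇾ σ)
  S : (ρ σ τ : Ty) → D ((ρ ⇾ σ ⇾ τ) ⇾ (ρ ⇾ σ) ⇾ ρ ⇾ τ)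
  R : (σ : Ty) → D ((σ ⇾ σ) ⇾ σ ⇾ tp0 ⇾ σ)
  lt : D tp0 → D tp0 → Prop

/-- Assignments of values to the variables of a context. -/
def Str.Env (M : Str) : Ctx → Type
  | [] => Unit
  | σ :: Γ => M.Env Γ × M.D σ

/-- The empty assignment. -/
def Str.nilEnv (M : Str) : M.Env [] := ()

/-- Extend an assignment by a value for the most recent variable. -/
def Str.Env.push {M : Str} {Γ : Ctx} {σ : Ty} (e : M.Env Γ) (d : M.D σ) : M.Env (σ :: Γ) := (e, d)

/-- The value of a variable. -/
def Var.get {M : Str} : {Γ : Ctx} → {σ : Ty} → Var Γ σ → M.Env Γ → M.D σ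
  | _, _, .zero, e => e.2
  | _, _, .succ x, e => x.get e.1

/-- The value of a term. -/
def Tm.eval (M : Str) {Γ : Ctx} (e : M.Env Γ) : {σ : Ty} → Tm Γ σ → M.D σ
  | _, .var x => x.get e
  | _, .zero => M.zero
  | _, .one => M.one
  | _, .add => M.add
  | _, .mul => M.mul
  | _, .K σ τ => M.K σ τ
  | _, .S ρ σ τ => M.S ρ σ τ
  | _, .R σ => M.R σ
  | _, .app f t => M.app (f.eval M e) (t.eval M e)

/-- Satisfaction. -/
def Fm.Sat (M : Str) : {Γ : Ctx} → M.Env Γ → Fm Γ → Prop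
  | _, e, .eq s t => s.eval M e = t.eval M e
  | _, e, .lt s t => M.lt (s.eval M e) (t.eval M e)
  | _, _, .fal => False
  | _, e, .imp φ ψ => φ.Sat M e → ψ.Sat M e
  | _, e, .all (σ := σ) φ => ∀ d : M.D σ, φ.Sat M (e.push d)

/-- Functionals with the same values are equal. -/
def Str.Extensional (M : Str) : Prop :=
  ∀ {σ τ : Ty} (f g : M.D (σ ⇾ τ)), (∀ x, M.app f x = M.app g x) → f = g

/-- `M` is a model of the theory `T`. -/
def Str.Models (M : Str) (T : Set Sentence) : Prop := ∀ φ ∈ T, φ.Sat M M.nilEnv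

variable {M : Str}

theorem Tm.eval_subst {Γ Δ : Ctx} (s : Subst Γ Δ) (e : M.Env Δ) (e' : M.Env Γ)
    (h : ∀ {σ} (x : Var Γ σ), (s x).eval M e = x.get e') {σ : Ty} (t : Tm Γ σ) :
    (t.subst s).eval M e = t.eval M e' := by
  induction t <;> simp_all [Tm.subst, Tm.eval]

theorem Tm.eval_ren {Γ Δ : Ctx} (r : Ren Γ Δ) (e : M.Env Δ) (e' : M.Env Γ)
    (h : ∀ {σ} (x : Var Γ σ), (r x).get e = x.get e') {σ : Ty} (t : Tm Γ σ) :
    (t.ren r).eval M e = t.eval M e' := by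
  rw [Tm.ren_eq_subst]
  exact t.eval_subst _ e e' h

theorem Tm.eval_succ {Γ : Ctx} {σ τ : Ty} (e : M.Env (τ :: Γ)) (t : Tm Γ σ) :
    (t.ren .succ).eval M e = t.eval M e.1 :=
  t.eval_ren Var.succ e e.1 fun _ => rfl

theorem Fm.sat_subst {Γ Δ : Ctx} (s : Subst Γ Δ) (e : M.Env Δ) (e' : M.Env Γ)
    (h : ∀ {σ} (x : Var Γ σ), (s x).eval M e = x.get e') (φ : Fm Γ) :
    (φ.subst s).Sat M e ↔ φ.Sat M e' := by
  induction φ generalizing Δ with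
  | eq a b | lt a b => simp only [Fm.subst, Fm.Sat, Tm.eval_subst s e e' h]
  | fal => rfl
  | imp φ ψ h1 h2 => simp only [Fm.subst, Fm.Sat, h1 s e e' h, h2 s e e' h]
  | all φ ih =>
    refine forall_congr' fun d => ih (Subst.lift s) _ _ ?_
    intro σ x
    cases x with
    | zero => rfl
    | succ x => exact (Tm.eval_succ _ _).trans (h x)

theorem Fm.sat_ren {Γ Δ : Ctx} (r : Ren Γ Δ) (e : M.Env Δ) (e' : M.Env Γ)
    (h : ∀ {σ} (x : Var Γ σ), (r x).get e = x.get e') (φ : Fm Γ) :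
    (φ.ren r).Sat M e ↔ φ.Sat M e' := by
  rw [Fm.ren_eq_subst]
  exact φ.sat_subst _ e e' h

theorem Fm.sat_inst {Γ : Ctx} {σ : Ty} (φ : Fm (σ :: Γ)) (t : Tm Γ σ) (e : M.Env Γ) :
    (φ.inst t).Sat M e ↔ φ.Sat M (e.push (t.eval M e)) :=
  φ.sat_subst _ _ _ fun x => by cases x <;> rfl

theorem Prv.sound {T : Set Sentence} (hM : M.Models T) {Γ : Ctx} {Δ : List (Fm Γ)} {φ : Fm Γ}
    (h : Prv T Γ Δ φ) (e : M.Env Γ) (hΔ : ∀ ψ ∈ Δ, ψ.Sat M e) : φ.Sat M e := by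
  induction h with
  | ax h => exact (Fm.sat_ren _ _ M.nilEnv (fun x => by cases x) _).2 (hM _ h)
  | hyp h => exact hΔ _ h
  | impI _ ih => exact fun h => ih e (List.forall_mem_cons.2 ⟨h, hΔ⟩)
  | impE _ _ ih1 ih2 => exact ih1 e hΔ (ih2 e hΔ)
  | raa _ ih =>
    by_contra hn
    exact ih e (List.forall_mem_cons.2 ⟨hn, hΔ⟩)
  | allI _ ih =>
    refine fun d => ih _ fun ψ hψ => ?_
    obtain ⟨χ, hχ, rfl⟩ := List.mem_map.1 hψ
    exact (Fm.sat_ren Var.succ (e.push d) e (fun _ => rfl) _).2 (hΔ _ hχ)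
  | allE t _ ih => exact (Fm.sat_inst _ _ _).2 (ih e hΔ _)
  | eqRefl t => rfl
  | eqSubst φ _ _ ih1 ih2 =>
    have h1 : Tm.eval M e _ = Tm.eval M e _ := ih1 e hΔ
    have h2 := ih2 e hΔ
    rw [Fm.sat_inst] at h2 ⊢
    rwa [← h1]

theorem Proves.sound {T : Set Sentence} {φ : Sentence} (h : Proves T φ) (hM : M.Models T) :
    φ.Sat M M.nilEnv :=
  Prv.sound hM h M.nilEnv (by simp)

end HORM

namespace HORM

/-! ## The completeness theorem -/

/-- `Suf Γ Δ` says that `Δ` extends `Γ` by further variables in front. -/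
inductive Suf (Γ : Ctx) : Ctx → Type
  | refl : Suf Γ Γ
  | step {Δ : Ctx} (σ : Ty) : Suf Γ Δ → Suf Γ (σ :: Δ)

/-- The induced weakening of variables. -/
def Suf.ren {Γ : Ctx} : {Δ : Ctx} → Suf Γ Δ → Ren Γ Δ
  | _, .refl => fun x => x
  | _, .step _ w => fun x => .succ (w.ren x)

theorem Suf.length_le {Γ Δ : Ctx} (w : Suf Γ Δ) : Γ.length ≤ Δ.length := by
  induction w with
  | refl => rfl
  | step σ w ih => exact ih.trans (Nat.le_succ _)

/-- Comparing lengths excludes that one extension stops where the other goes on. Weakenings between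
stages are obtained by choice, and this makes all such choices agree. -/
instance {Γ Δ : Ctx} : Subsingleton (Suf Γ Δ) := by
  constructor
  intro w
  induction w with
  | refl =>
    intro w'
    cases w' with
    | refl => rfl
    | step σ w' => exact absurd w'.length_le (by simp)
  | step σ w ih =>
    intro w'
    cases w' with
    | refl => exact absurd w.length_le (by simp)
    | step σ w' => rw [ih w']

/-- Composition of context extensions. -/
def Suf.trans {Γ Δ : Ctx} (w : Suf Γ Δ) : {Θ : Ctx} → Suf Δ Θ → Suf Γ Θ
  | _, .refl => w
  | _, .step σ w' => .step σ (w.trans w')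

theorem Suf.ren_trans {Γ Δ Θ : Ctx} (w : Suf Γ Δ) (w' : Suf Δ Θ) {σ : Ty} (x : Var Γ σ) :
    (w.trans w').ren x = w'.ren (w.ren x) := by
  induction w' with
  | refl => rfl
  | step σ w' ih => exact congrArg Var.succ ih

/-- A context with a list of assumptions. -/
structure Stage where
  ctx : Ctx
  hyps : List (Fm ctx)

/-- A formula with a distinguished most recent variable. -/
abbrev Item : Type := Σ (Γ : Ctx) (σ : Ty), Fm (σ :: Γ)

instance : Nonempty Item := ⟨⟨[], tp0, .fal⟩⟩

/-- An enumeration of the items in which each item occurs infinitely often. -/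
noncomputable def item (k : ℕ) : Item :=
  ((exists_surjective_nat Item).choose) (Nat.unpair k).2

/-- `item` reads only the second component of its index, so the first component is free to push the
index beyond `n`. -/
theorem exists_item (i : Item) (n : ℕ) : ∃ k, n ≤ k ∧ item k = i := by
  obtain ⟨m, hm⟩ := (exists_surjective_nat Item).choose_spec i
  exact ⟨Nat.pair n m, Nat.left_le_pair n m, by simp [item, hm]⟩

section Henkin

variable (T : Set Sentence)

open Classical in
/-- Add a fresh variable, and assume that it is a counterexample to the given item if the
universal closure of the item is not derivable. -/
noncomputable def Stage.next (S : Stage) : Item → Stage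
  | ⟨Γ, σ, ψ⟩ =>
    ⟨σ :: S.ctx,
      if h : ∃ w : Suf Γ S.ctx, ¬ Prv T S.ctx S.hyps (.all (ψ.ren (Ren.lift w.ren)))
      then ∼(ψ.ren (Ren.lift h.choose.ren)) :: S.hyps.map (Fm.ren .succ)
      else S.hyps.map (Fm.ren .succ)⟩

/-- The Henkin sequence of stages. -/
noncomputable def stage (S : Stage) : ℕ → Stage
  | 0 => S
  | k + 1 => (stage S k).next T (item k)

variable {T}

/-- If the new assumption were contradictory, `raa` and `allI` would derive the universal closure
that was supposed to be underivable. -/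
theorem Stage.next_consistent (S : Stage) (hS : ¬ Prv T S.ctx S.hyps .fal) (i : Item) :
    ¬ Prv T (S.next T i).ctx (S.next T i).hyps .fal := by
  obtain ⟨Γ, σ, ψ⟩ := i
  intro h
  have key : ∀ φ : Fm (σ :: S.ctx), Prv T (σ :: S.ctx) (∼φ :: S.hyps.map (Fm.ren .succ)) .fal →
      Prv T S.ctx S.hyps (.all φ) := fun φ h => .allI (.raa h)
  by_cases hw : ∃ w : Suf Γ S.ctx, ¬ Prv T S.ctx S.hyps (.all (ψ.ren (Ren.lift w.ren)))
  · simp only [Stage.next, dif_pos hw] at h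
    exact hw.choose_spec (key _ h)
  · simp only [Stage.next, dif_neg hw] at h
    -- Here only a variable was added. It is eliminated by a closed term, which exists at every
    -- type.
    have := key .fal (h.weaken fun _ => List.mem_cons_of_mem _)
    exact hS (this.allE (instTm σ))
where
  instTm : (σ : Ty) → Tm S.ctx σ
  | .nat => .zero
  | .arr σ τ => Tm.K τ σ ⬝ instTm τ

variable (S : Stage)

theorem stage_consistent (hS : ¬ Prv T S.ctx S.hyps .fal) (k : ℕ) :
    ¬ Prv T (stage T S k).ctx (stage T S k).hyps .fal := by
  induction k with
  | zero => exact hS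
  | succ k ih => exact Stage.next_consistent _ ih _

theorem stage_step (k : ℕ) : ∃ w : Suf (stage T S k).ctx (stage T S (k + 1)).ctx,
    ∀ φ ∈ (stage T S k).hyps, φ.ren w.ren ∈ (stage T S (k + 1)).hyps := by
  rw [stage]
  obtain ⟨Γ, σ, ψ⟩ := item k
  refine ⟨.step σ .refl, fun φ hφ => ?_⟩
  have : φ.ren .succ ∈ (stage T S k).hyps.map (Fm.ren (.succ (σ := σ))) :=
    List.mem_map_of_mem hφ
  simp only [Stage.next]
  split
  · exact List.mem_cons_of_mem _ this
  · exact this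

theorem stage_le {k j : ℕ} (h : k ≤ j) : ∃ w : Suf (stage T S k).ctx (stage T S j).ctx,
    ∀ φ ∈ (stage T S k).hyps, φ.ren w.ren ∈ (stage T S j).hyps := by
  induction h with
  | refl => exact ⟨.refl, fun φ hφ => by simpa only [Suf.ren, Fm.ren_id] using hφ⟩
  | @step j _ ih =>
    obtain ⟨w, hw⟩ := ih
    obtain ⟨w', hw'⟩ := stage_step (T := T) S j
    refine ⟨w.trans w', fun φ hφ => ?_⟩
    have := hw' _ (hw _ hφ)
    rwa [Fm.ren_ren, ← funext fun σ => funext fun x => Suf.ren_trans w w' x] at this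

/-- The inclusion of an earlier into a later context. -/
noncomputable def wk {k j : ℕ} (h : k ≤ j) : Suf (stage T S k).ctx (stage T S j).ctx :=
  (stage_le S h).choose

theorem mem_wk {k j : ℕ} (h : k ≤ j) {φ : Fm (stage T S k).ctx} (hφ : φ ∈ (stage T S k).hyps) :
    φ.ren (wk S h).ren ∈ (stage T S j).hyps :=
  (stage_le S h).choose_spec φ hφ

theorem wk_wk {k j i : ℕ} (h : k ≤ j) (h' : j ≤ i) {σ : Ty} (x : Var (stage T S k).ctx σ) :
    (wk S h').ren ((wk S h).ren x) = (wk S (h.trans h')).ren x := by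
  rw [← Suf.ren_trans, Subsingleton.elim (Suf.trans _ _)]

theorem Fm.wk_wk {k j i : ℕ} (h : k ≤ j) (h' : j ≤ i) (φ : Fm (stage T S k).ctx) :
    (φ.ren (wk S h).ren).ren (wk S h').ren = φ.ren (wk S (h.trans h')).ren := by
  rw [Fm.ren_ren]
  congr 1
  funext σ x
  exact HORM.wk_wk S h h' x

theorem Tm.wk_wk {k j i : ℕ} (h : k ≤ j) (h' : j ≤ i) {σ : Ty} (t : Tm (stage T S k).ctx σ) :
    (t.ren (wk S h).ren).ren (wk S h').ren = t.ren (wk S (h.trans h')).ren := by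
  rw [Tm.ren_ren]
  congr 1
  funext σ x
  exact HORM.wk_wk S h h' x

theorem wk_self (k : ℕ) : @wk T S k k le_rfl = .refl := Subsingleton.elim _ _

/-- Derivability at some later stage. -/
def Tr (k : ℕ) (φ : Fm (stage T S k).ctx) : Prop :=
  ∃ (j : ℕ) (h : k ≤ j), Prv T (stage T S j).ctx (stage T S j).hyps (φ.ren (wk S h).ren)

variable {S}

theorem Prv.later {k j : ℕ} (h : k ≤ j) {φ : Fm (stage T S k).ctx}
    (hφ : Prv T (stage T S k).ctx (stage T S k).hyps φ) :
    Prv T (stage T S j).ctx (stage T S j).hyps (φ.ren (wk S h).ren) :=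
  hφ.ren _ _ fun _ => mem_wk S h

theorem Tr.of_prv {k : ℕ} {φ : Fm (stage T S k).ctx}
    (h : Prv T (stage T S k).ctx (stage T S k).hyps φ) : Tr S k φ :=
  ⟨k, le_rfl, h.later le_rfl⟩

theorem tr_wk {k j : ℕ} (h : k ≤ j) {φ : Fm (stage T S k).ctx} :
    Tr S j (φ.ren (wk S h).ren) ↔ Tr S k φ := by
  constructor
  · rintro ⟨i, hi, hφ⟩
    rw [Fm.wk_wk] at hφ
    exact ⟨i, h.trans hi, hφ⟩
  · rintro ⟨i, hi, hφ⟩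
    refine ⟨max i j, le_max_right _ _, ?_⟩
    have := hφ.later (le_max_left i j)
    rwa [Fm.wk_wk] at this ⊢

theorem Tr.exists_common {k : ℕ} (L : List (Fm (stage T S k).ctx)) (hL : ∀ ψ ∈ L, Tr S k ψ) :
    ∃ (j : ℕ) (h : k ≤ j), ∀ ψ ∈ L,
      Prv T (stage T S j).ctx (stage T S j).hyps (ψ.ren (wk S h).ren) := by
  induction L with
  | nil => exact ⟨k, le_rfl, by simp⟩
  | cons ψ L ih =>
    obtain ⟨j, h, hj⟩ := ih fun χ hχ => hL χ (List.mem_cons_of_mem _ hχ)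
    obtain ⟨i, h', hi⟩ := hL ψ List.mem_cons_self
    refine ⟨max j i, h.trans (le_max_left _ _), fun χ hχ => ?_⟩
    rcases List.mem_cons.1 hχ with rfl | hχ
    · have := hi.later (le_max_right j i)
      rwa [Fm.wk_wk] at this
    · have := (hj χ hχ).later (le_max_left j i)
      rwa [Fm.wk_wk] at this

/-- Finitely many formulas that are each derivable at some later stage are all derivable at a common
one, where a cut finishes the argument. -/
theorem Tr.closed {k : ℕ} (L : List (Fm (stage T S k).ctx)) {φ : Fm (stage T S k).ctx}
    (h : Prv T (stage T S k).ctx L φ) (hL : ∀ ψ ∈ L, Tr S k ψ) : Tr S k φ := by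
  obtain ⟨j, hj, hj'⟩ := Tr.exists_common L hL
  refine ⟨j, hj, .cutAll (L.map (Fm.ren (wk S hj).ren))
    (h.ren _ _ fun _ hψ => List.mem_map_of_mem hψ) fun ψ hψ => ?_⟩
  obtain ⟨χ, hχ, rfl⟩ := List.mem_map.1 hψ
  exact hj' χ hχ

theorem Tr.mp {k : ℕ} {φ ψ : Fm (stage T S k).ctx} (h : Tr S k (φ ➝ ψ)) (h' : Tr S k φ) :
    Tr S k ψ :=
  Tr.closed [φ ➝ ψ, φ] (.impE (φ := φ) (.hyp (by simp)) (.hyp (by simp))) (by simp [h, h'])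

theorem not_tr_fal (hS : ¬ Prv T S.ctx S.hyps .fal) (k : ℕ) : ¬ Tr (T := T) S k .fal :=
  fun ⟨j, _, h⟩ => stage_consistent S hS j h

/-- The Henkin property. The item is treated at some stage `j ≥ k`; either its closure is derivable
there, or the variable added next is assumed to be a counterexample. -/
theorem tr_all_or {k : ℕ} {σ : Ty} (ψ : Fm (σ :: (stage T S k).ctx)) :
    Tr S k (.all ψ) ∨ ∃ (j : ℕ) (h : k ≤ j) (t : Tm (stage T S j).ctx σ),
      Tr S j ∼((ψ.ren (Ren.lift (wk S h).ren)).inst t) := by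
  obtain ⟨j, hj, hi⟩ := exists_item ⟨_, σ, ψ⟩ k
  by_cases h : Prv T (stage T S j).ctx (stage T S j).hyps (.all (ψ.ren (Ren.lift (wk S hj).ren)))
  · exact .inl ⟨j, hj, h⟩
  · right
    have hex : ∃ w : Suf (stage T S k).ctx (stage T S j).ctx,
      ¬ Prv T (stage T S j).ctx (stage T S j).hyps (.all (ψ.ren (Ren.lift w.ren))) := ⟨_, h⟩
    have hst : stage T S (j + 1) = ⟨σ :: (stage T S j).ctx,
        ∼(ψ.ren (Ren.lift (wk S hj).ren)) :: (stage T S j).hyps.map (Fm.ren .succ)⟩ := by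
      rw [stage, hi]
      simp only [Stage.next, dif_pos hex]
      rw [Subsingleton.elim hex.choose]
    have : ∃ (w : Suf (stage T S k).ctx (stage T S (j + 1)).ctx)
        (t : Tm (stage T S (j + 1)).ctx σ),
        Prv T (stage T S (j + 1)).ctx (stage T S (j + 1)).hyps
          ∼((ψ.ren (Ren.lift w.ren)).inst t) := by
      rw [hst]
      refine ⟨.step σ (wk S hj), .var .zero, .hyp ?_⟩
      simp only [Suf.ren, Fm.lift_inst_zero]
      exact List.mem_cons_self
    obtain ⟨w, t, hp⟩ := this
    refine ⟨j + 1, hj.trans j.le_succ, t, .of_prv ?_⟩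
    rwa [Subsingleton.elim w (wk S (hj.trans j.le_succ))] at hp

/-- Maximality needs no separate construction: it is the Henkin property for a vacuous quantifier
over type `0`. -/
theorem tr_or_neg {k : ℕ} (φ : Fm (stage T S k).ctx) : Tr S k φ ∨ Tr S k ∼φ := by
  rcases tr_all_or (σ := tp0) (φ.ren .succ) with h | ⟨j, hj, t, h⟩
  · left
    refine Tr.closed [.all (φ.ren .succ)] ?_ (by simpa using h)
    have := Prv.allE (T := T) .zero (.hyp (List.mem_singleton.2 rfl) :
      Prv T _ [Fm.all (σ := tp0) (φ.ren .succ)] _)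
    rwa [Fm.inst_succ] at this
  · right
    rw [Fm.ren_succ_lift, Fm.inst_succ] at h
    exact (tr_wk hj (φ := ∼φ)).1 h

theorem tr_imp {k : ℕ} {φ ψ : Fm (stage T S k).ctx} :
    Tr S k (φ ➝ ψ) ↔ (Tr S k φ → Tr S k ψ) := by
  refine ⟨Tr.mp, fun h => ?_⟩
  rcases tr_or_neg φ with h1 | h1
  · exact Tr.closed [ψ] (.impI (.hyp (by simp))) (by simpa using h h1)
  · exact Tr.closed [∼φ] (.impI (.exfalso (.impE (.hyp (List.mem_cons_of_mem _
      (List.mem_singleton.2 rfl))) (.hyp (by simp))))) (by simpa using h1)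

theorem tr_all (hS : ¬ Prv T S.ctx S.hyps .fal) {k : ℕ} {σ : Ty}
    {φ : Fm (σ :: (stage T S k).ctx)} :
    Tr S k (.all φ) ↔ ∀ (j : ℕ) (h : k ≤ j) (t : Tm (stage T S j).ctx σ),
      Tr S j ((φ.ren (Ren.lift (wk S h).ren)).inst t) := by
  constructor
  · intro h j hj t
    have h1 := (tr_wk hj).2 h
    exact Tr.closed [_] (.allE t (.hyp (List.mem_singleton.2 rfl)))
      (List.forall_mem_singleton.2 h1)
  · intro h
    rcases tr_all_or φ with h1 | ⟨j, hj, t, h1⟩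
    · exact h1
    · exact absurd (h1.mp (h j hj t)) (not_tr_fal hS j)

end Henkin

end HORM

/-! ### The term model of the limit theory. -/

namespace HORM

section Henkin

variable {T : Set Sentence} {S : Stage}

/-- Provable equality of terms of the limit language. -/
def TermEq (σ : Ty) (a b : Σ k, Tm (stage T S k).ctx σ) : Prop :=
  ∃ (j : ℕ) (h : a.1 ≤ j) (h' : b.1 ≤ j),
    Tr S j (eqAt σ (a.2.ren (wk S h).ren) (b.2.ren (wk S h').ren))

theorem termEq_iff {σ : Ty} {a b : Σ k, Tm (stage T S k).ctx σ} (i : ℕ) (ha : a.1 ≤ i)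
    (hb : b.1 ≤ i) :
    TermEq σ a b ↔ Tr S i (eqAt σ (a.2.ren (wk S ha).ren) (b.2.ren (wk S hb).ren)) := by
  refine ⟨fun ⟨j, h, h', hj⟩ => ?_, fun h => ⟨i, ha, hb, h⟩⟩
  rw [← tr_wk (le_max_right i j), eqAt_ren, Tm.wk_wk, Tm.wk_wk] at hj
  rwa [← tr_wk (le_max_left i j), eqAt_ren, Tm.wk_wk, Tm.wk_wk]

theorem termEq_equivalence (σ : Ty) : Equivalence (TermEq (T := T) (S := S) σ) where
  refl a := ⟨a.1, le_rfl, le_rfl, .of_prv (.eqAt_refl _)⟩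
  symm := fun ⟨j, h, h', hj⟩ =>
    ⟨j, h', h, Tr.closed [_] (.eqAt_symm (.hyp (List.mem_singleton.2 rfl)))
      (List.forall_mem_singleton.2 hj)⟩
  trans := by
    intro a b c hab hbc
    have ha : a.1 ≤ max a.1 (max b.1 c.1) := by simp
    have hb : b.1 ≤ max a.1 (max b.1 c.1) := by simp
    have hc : c.1 ≤ max a.1 (max b.1 c.1) := by simp
    rw [termEq_iff _ ha hb] at hab
    rw [termEq_iff _ hb hc] at hbc
    rw [termEq_iff _ ha hc]
    exact Tr.closed [_, _] (.eqAt_trans (.hyp List.mem_cons_self)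
      (.hyp (List.mem_cons_of_mem _ (List.mem_singleton.2 rfl)))) (by
        rintro ψ hψ
        rcases List.mem_cons.1 hψ with rfl | hψ
        · exact hab
        · rw [List.mem_singleton.1 hψ]; exact hbc)

variable (T S) in
/-- The terms of the limit language up to provable equality. -/
def termSetoid (σ : Ty) : Setoid (Σ k, Tm (stage T S k).ctx σ) := ⟨TermEq σ, termEq_equivalence σ⟩

variable (T S) in
/-- The class of a term. -/
def cls {σ : Ty} {k : ℕ} (t : Tm (stage T S k).ctx σ) : Quotient (termSetoid T S σ) :=
  Quotient.mk _ ⟨k, t⟩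

theorem cls_wk {σ : Ty} {k j : ℕ} (h : k ≤ j) (t : Tm (stage T S k).ctx σ) :
    cls T S (t.ren (wk S h).ren) = cls T S t :=
  Quotient.sound ⟨j, le_rfl, h, by
    rw [wk_self]
    simpa only [Suf.ren, Tm.ren_id] using Tr.of_prv (.eqAt_refl _)⟩

theorem cls_eq {σ : Ty} {k : ℕ} {s t : Tm (stage T S k).ctx σ} :
    cls T S s = cls T S t ↔ Tr S k (eqAt σ s t) := by
  have : cls T S s = cls T S t ↔ TermEq (T := T) (S := S) σ ⟨k, s⟩ ⟨k, t⟩ := Quotient.eq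
  rw [this, termEq_iff k le_rfl le_rfl, wk_self]
  simp only [Suf.ren, Tm.ren_id]

theorem exists_cls {σ : Ty} (d : Quotient (termSetoid T S σ)) (k : ℕ) :
    ∃ (j : ℕ) (_ : k ≤ j) (t : Tm (stage T S j).ctx σ), cls T S t = d := by
  induction d using Quotient.inductionOn with
  | h a => exact ⟨max k a.1, le_max_left _ _, _, cls_wk (le_max_right k a.1) a.2⟩

theorem tr_congr_app (hT : extensionalityAxioms ⊆ T) {k : ℕ} {σ τ : Ty}
    {f g : Tm (stage T S k).ctx (σ ⇾ τ)} {s t : Tm (stage T S k).ctx σ}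
    (hf : Tr S k (eqAt _ f g)) (hs : Tr S k (eqAt _ s t)) : Tr S k (eqAt τ (f ⬝ s) (g ⬝ t)) :=
  Tr.closed [eqAt _ f g, eqAt _ s t]
    (.eqAt_trans (.eqAt_app (.hyp List.mem_cons_self) s)
      (.eqAt_congr hT g (.hyp (List.mem_cons_of_mem _ (List.mem_singleton.2 rfl))))) (by
    rintro ψ hψ
    rcases List.mem_cons.1 hψ with rfl | hψ
    · exact hf
    · rw [List.mem_singleton.1 hψ]; exact hs)

/-- Application of classes of terms. -/
noncomputable def appCls (hT : extensionalityAxioms ⊆ T) {σ τ : Ty} :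
    Quotient (termSetoid T S (σ ⇾ τ)) → Quotient (termSetoid T S σ) →
      Quotient (termSetoid T S τ) :=
  Quotient.map₂ (fun f t => ⟨max f.1 t.1,
      f.2.ren (wk S (le_max_left f.1 t.1)).ren ⬝ t.2.ren (wk S (le_max_right f.1 t.1)).ren⟩) (by
    intro f g hf s t hs
    have hf' : TermEq _ f g := hf
    have hs' : TermEq _ s t := hs
    let n := max (max f.1 s.1) (max g.1 t.1)
    have h1 : f.1 ≤ n := by simp [n]
    have h2 : g.1 ≤ n := by simp [n]
    have h3 : s.1 ≤ n := by simp [n]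
    have h4 : t.1 ≤ n := by simp [n]
    rw [termEq_iff n h1 h2] at hf'
    rw [termEq_iff n h3 h4] at hs'
    refine ⟨n, le_max_left _ _, le_max_right _ _, ?_⟩
    simp only [Tm.ren, Tm.wk_wk]
    exact tr_congr_app hT hf' hs')

theorem appCls_cls (hT : extensionalityAxioms ⊆ T) {k : ℕ} {σ τ : Ty}
    (f : Tm (stage T S k).ctx (σ ⇾ τ)) (t : Tm (stage T S k).ctx σ) :
    appCls hT (cls T S f) (cls T S t) = cls T S (f ⬝ t) :=
  cls_wk (le_max_left k k) (f ⬝ t)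

/-- The relation `<` on classes of terms. -/
def ltCls (a b : Quotient (termSetoid T S tp0)) : Prop :=
  ∃ (k : ℕ) (s t : Tm (stage T S k).ctx tp0), cls T S s = a ∧ cls T S t = b ∧ Tr S k (s ≺ t)

theorem ltCls_cls {k : ℕ} (s t : Tm (stage T S k).ctx tp0) :
    ltCls (cls T S s) (cls T S t) ↔ Tr S k (s ≺ t) := by
  refine ⟨?_, fun h => ⟨k, s, t, rfl, rfl, h⟩⟩
  rintro ⟨j, s', t', h1, h2, h⟩
  rw [← cls_wk (le_max_left k j), ← cls_wk (le_max_right k j), cls_eq] at h1 h2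
  rw [← tr_wk (le_max_right k j)] at h
  rw [← tr_wk (le_max_left k j)]
  refine Tr.closed [_, _, (s' ≺ t').ren (wk S (le_max_right k j)).ren] (Prv.eqReplace Fm.lt (fun _ _ _ => rfl) (.hyp List.mem_cons_self)
    (.hyp (List.mem_cons_of_mem _ List.mem_cons_self))
    (.hyp (List.mem_cons_of_mem _ (List.mem_cons_of_mem _ (List.mem_singleton.2 rfl))))) ?_
  rintro ψ hψ
  rcases List.mem_cons.1 hψ with rfl | hψ
  · exact h1
  rcases List.mem_cons.1 hψ with rfl | hψ
  · exact h2
  · rw [List.mem_singleton.1 hψ]; exact h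

variable (S) in
/-- The term model of the limit theory. -/
noncomputable def termModel (hT : extensionalityAxioms ⊆ T) : Str where
  D σ := Quotient (termSetoid T S σ)
  app := appCls hT
  zero := cls T S (k := 0) .zero
  one := cls T S (k := 0) .one
  add := cls T S (k := 0) .add
  mul := cls T S (k := 0) .mul
  K σ τ := cls T S (k := 0) (.K σ τ)
  S ρ σ τ := cls T S (k := 0) (.S ρ σ τ)
  R σ := cls T S (k := 0) (.R σ)
  lt := ltCls

/-- The assignment of classes of terms given by a substitution. -/
noncomputable def clsEnv (hT : extensionalityAxioms ⊆ T) {k : ℕ} : {Γ : Ctx} →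
    Subst Γ (stage T S k).ctx → (termModel S hT).Env Γ
  | [], _ => ()
  | _ :: _, s => (clsEnv hT (fun x => s (.succ x)), cls T S (s .zero))

theorem get_clsEnv (hT : extensionalityAxioms ⊆ T) {k : ℕ} {Γ : Ctx}
    (s : Subst Γ (stage T S k).ctx) {σ : Ty} (x : Var Γ σ) :
    x.get (clsEnv hT s) = cls T S (s x) := by
  induction x with
  | zero => rfl
  | succ x ih => exact ih _

theorem eval_clsEnv (hT : extensionalityAxioms ⊆ T) {k : ℕ} {Γ : Ctx}
    (s : Subst Γ (stage T S k).ctx) {σ : Ty} (t : Tm Γ σ) :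
    t.eval (termModel S hT) (clsEnv hT s) = cls T S (t.subst s) := by
  induction t with
  | var x => exact get_clsEnv hT s x
  | app f t hf ht =>
    rw [Tm.eval, hf, ht]
    exact appCls_cls hT _ _
  | zero => exact (cls_wk k.zero_le .zero).symm
  | one => exact (cls_wk k.zero_le .one).symm
  | add => exact (cls_wk k.zero_le .add).symm
  | mul => exact (cls_wk k.zero_le .mul).symm
  | K => exact (cls_wk k.zero_le (.K _ _)).symm
  | S => exact (cls_wk k.zero_le (.S _ _ _)).symm
  | R => exact (cls_wk k.zero_le (.R _)).symm

theorem clsEnv_wk (hT : extensionalityAxioms ⊆ T) {k j : ℕ} (h : k ≤ j) {Γ : Ctx}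
    (s : Subst Γ (stage T S k).ctx) :
    clsEnv hT (fun x => (s x).ren (wk S h).ren) = clsEnv hT s := by
  induction Γ with
  | nil => rfl
  | cons σ Γ ih => exact Prod.ext (ih _) (cls_wk h _)

/-- The truth lemma. It is stated for substitutions into any stage, because in the quantifier case
the value of the bound variable is the class of a term that may live only at a later stage. -/
theorem sat_termModel (hT : extensionalityAxioms ⊆ T) (hS : ¬ Prv T S.ctx S.hyps .fal) {Γ : Ctx}
    (φ : Fm Γ) {k : ℕ} (s : Subst Γ (stage T S k).ctx) :
    φ.Sat (termModel S hT) (clsEnv hT s) ↔ Tr S k (φ.subst s) := by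
  induction φ generalizing k with
  | eq a b => rw [Fm.Sat, eval_clsEnv, eval_clsEnv]; exact cls_eq
  | lt a b => rw [Fm.Sat, eval_clsEnv, eval_clsEnv]; exact ltCls_cls _ _
  | fal => exact ⟨False.elim, not_tr_fal hS k⟩
  | imp φ ψ h1 h2 => rw [Fm.Sat, h1, h2]; exact tr_imp.symm
  | @all Γ σ φ ih =>
    have key : ∀ (j : ℕ) (h : k ≤ j) (t : Tm (stage T S j).ctx σ),
        φ.Sat (termModel S hT) ((clsEnv hT s).push (cls T S t)) ↔
          Tr S j (((φ.subst (Subst.lift s)).ren (Ren.lift (wk S h).ren)).inst t) := by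
      intro j h t
      have h1 : (clsEnv hT s).push (cls T S t) =
          clsEnv hT (Subst.cons t fun x => (s x).ren (wk S h).ren) :=
        Prod.ext (clsEnv_wk hT h s).symm rfl
      rw [h1, ih]
      simp only [Fm.inst, Fm.ren_subst, Fm.subst_subst]
      refine iff_of_eq (congrArg _ (congrArg (fun s : Subst _ _ => φ.subst s) ?_))
      funext τ x
      cases x with
      | zero => rfl
      | succ x =>
        simp only [Subst.cons, Subst.lift, Tm.ren_eq_subst, Tm.subst_subst, Tm.subst,
          Ren.lift]
    rw [Fm.Sat, Fm.subst, tr_all hS]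
    constructor
    · exact fun h j hj t => (key j hj t).1 (h _)
    · intro h d
      obtain ⟨j, hj, t, rfl⟩ := exists_cls d k
      exact (key j hj t).2 (h j hj t)

/-- Equality at a function type is a universally quantified formula, and by `tr_all` such a formula
holds as soon as its instances by terms of later stages do. -/
theorem termModel_extensional (hT : extensionalityAxioms ⊆ T) (hS : ¬ Prv T S.ctx S.hyps .fal) :
    (termModel S hT).Extensional := by
  intro σ τ f g hfg
  obtain ⟨i, -, f, rfl⟩ := exists_cls f 0
  obtain ⟨k, hk, g, rfl⟩ := exists_cls g i
  rw [← cls_wk hk] at hfg ⊢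
  refine cls_eq.2 ((tr_all hS).2 fun j hj t => ?_)
  have h := hfg (cls T S t)
  rw [← cls_wk hj g, ← cls_wk hj] at h
  have h' : cls T S _ = cls T S _ := (appCls_cls hT _ _).symm.trans (h.trans (appCls_cls hT _ _))
  rw [cls_eq] at h'
  simp only [Fm.inst, eqAt_ren, eqAt_subst, Tm.ren, Tm.subst, Tm.up, Tm.ren_eq_subst,
    Tm.subst_subst, Subst.cons, Ren.lift, Ext.ren] at h' ⊢
  exact h'

end Henkin

/-- Completeness of the calculus for extensional structures. -/
theorem Proves.of_models {T : Set Sentence} (hT : extensionalityAxioms ⊆ T) {φ : Sentence}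
    (h : ∀ M : Str, M.Extensional → M.Models T → φ.Sat M M.nilEnv) : Proves T φ := by
  by_contra hn
  -- The construction starts from the negation of an unprovable sentence, which is consistent by
  -- `raa`.
  let S : Stage := ⟨[], [∼φ]⟩
  have hS : ¬ Prv T S.ctx S.hyps .fal := fun h => hn (.raa h)
  have key (ψ : Sentence) : ψ.Sat (termModel S hT) (termModel S hT).nilEnv ↔
      Tr (T := T) S 0 ψ := by
    have := sat_termModel hT hS ψ (k := 0) (fun x => .var x)
    exact this.trans (iff_of_eq (congrArg (Tr (T := T) (S := S) 0) (Fm.subst_var ψ)))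
  have h1 := h (termModel S hT) (termModel_extensional hT hS) fun ψ hψ => (key ψ).2 (.of_prv ?_)
  · have h2 : Tr (T := T) S 0 ∼φ := .of_prv (.hyp List.mem_cons_self)
    exact not_tr_fal hS 0 (h2.mp ((key φ).1 h1))
  · have := Prv.ax (T := T) (Γ := []) (Δ := [∼φ]) hψ
    rw [← Fm.ren_nil fun x => x, Fm.ren_id] at this
    exact this

end HORM

namespace HORM

/-! ## Evaluation of defined connectives -/

section Eval

variable {M : Str}

instance : Zero (M.D tp0) := ⟨M.zero⟩
instance : One (M.D tp0) := ⟨M.one⟩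
instance : Add (M.D tp0) := ⟨fun a b => M.app (M.app M.add a) b⟩
instance : Mul (M.D tp0) := ⟨fun a b => M.app (M.app M.mul a) b⟩
instance : LT (M.D tp0) := ⟨M.lt⟩

variable {Γ Δ : Ctx} (e : M.Env Γ)

@[simp] theorem Tm.eval_app {σ τ : Ty} (f : Tm Γ (σ ⇾ τ)) (t : Tm Γ σ) :
    (f ⬝ t).eval M e = M.app (f.eval M e) (t.eval M e) := rfl

@[simp] theorem Tm.eval_zero : (0 : Tm Γ tp0).eval M e = 0 := rfl

@[simp] theorem Tm.eval_one : (1 : Tm Γ tp0).eval M e = 1 := rfl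

@[simp] theorem Tm.eval_add (s t : Tm Γ tp0) : (s + t).eval M e = s.eval M e + t.eval M e := rfl

@[simp] theorem Tm.eval_mul (s t : Tm Γ tp0) : (s * t).eval M e = s.eval M e * t.eval M e := rfl

@[simp] theorem Tm.eval_twice (t : Tm Γ tp0) :
    (twice t).eval M e = t.eval M e + t.eval M e := rfl

@[simp] theorem Tm.eval_K (σ τ : Ty) : (Tm.K σ τ).eval M e = M.K σ τ := rfl

@[simp] theorem Tm.eval_S (ρ σ τ : Ty) : (Tm.S ρ σ τ).eval M e = M.S ρ σ τ := rfl

@[simp] theorem Tm.eval_var_zero {σ : Ty} (d : M.D σ) :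
    (Tm.var .zero).eval M (e.push d) = d := rfl

@[simp] theorem Tm.eval_var_succ {σ τ : Ty} (d : M.D σ) (x : Var Γ τ) :
    (Tm.var (.succ x)).eval M (e.push d) = (Tm.var x).eval M e := rfl

@[simp] theorem Tm.up_refl {σ : Ty} (t : Tm Γ σ) : t.up (Δ := Γ) = t := t.ren_id

@[simp] theorem Tm.eval_up [Ext Δ Γ] {σ τ : Ty} (t : Tm Δ σ) (d : M.D τ) :
    (t.up (Δ := τ :: Γ)).eval M (e.push d) = (t.up (Δ := Γ)).eval M e := by
  refine Eq.trans ?_ (Tm.eval_succ (e.push d) (t.ren Ext.ren))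
  rw [Tm.ren_ren]
  rfl

@[simp] theorem sat_fa {σ : Ty} (F : Tm (σ :: Γ) σ → Fm (σ :: Γ)) :
    (fa σ F).Sat M e ↔ ∀ d : M.D σ, (F (.var .zero)).Sat M (e.push d) := Iff.rfl

@[simp] theorem sat_all {σ : Ty} (φ : Fm (σ :: Γ)) :
    (Fm.all φ).Sat M e ↔ ∀ d : M.D σ, φ.Sat M (e.push d) := Iff.rfl

@[simp] theorem sat_imp (φ ψ : Fm Γ) : (φ ➝ ψ).Sat M e ↔ (φ.Sat M e → ψ.Sat M e) := Iff.rfl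

@[simp] theorem sat_neg (φ : Fm Γ) : (∼φ).Sat M e ↔ ¬ φ.Sat M e := Iff.rfl

@[simp] theorem sat_ex {σ : Ty} (F : Tm (σ :: Γ) σ → Fm (σ :: Γ)) :
    (ex σ F).Sat M e ↔ ∃ d : M.D σ, (F (.var .zero)).Sat M (e.push d) := by
  simp [ex]

@[simp] theorem sat_conj (φ ψ : Fm Γ) : (φ ⋏ ψ).Sat M e ↔ φ.Sat M e ∧ ψ.Sat M e := by
  simp [Fm.conj]

@[simp] theorem sat_disj (φ ψ : Fm Γ) : (φ ⋎ ψ).Sat M e ↔ φ.Sat M e ∨ ψ.Sat M e := by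
  simp [Fm.disj, or_iff_not_imp_left]

@[simp] theorem sat_iff (φ ψ : Fm Γ) : (φ ⭤ ψ).Sat M e ↔ (φ.Sat M e ↔ ψ.Sat M e) := by
  simp [Fm.iff, iff_iff_implies_and_implies]

@[simp] theorem sat_eq (s t : Tm Γ tp0) : (s ≐ t).Sat M e ↔ s.eval M e = t.eval M e := Iff.rfl

@[simp] theorem sat_lt (s t : Tm Γ tp0) : (s ≺ t).Sat M e ↔ s.eval M e < t.eval M e := Iff.rfl

/-- Extensionality turns the pointwise equality of the language into identity, so that the
combinator axioms become equations in the model. -/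
theorem sat_eqAt (hM : M.Extensional) {σ : Ty} (s t : Tm Γ σ) :
    (eqAt σ s t).Sat M e ↔ s.eval M e = t.eval M e := by
  induction σ generalizing Γ with
  | nat => rfl
  | arr σ τ _ ih =>
    simp only [eqAt, sat_fa, ih, Tm.eval_app, Tm.eval_up, Tm.up_refl, Tm.eval_var_zero]
    exact ⟨hM _ _, fun h _ => by rw [h]⟩

theorem sat_close (φ : Fm Γ) : φ.close.Sat M M.nilEnv ↔ ∀ e : M.Env Γ, φ.Sat M e := by
  induction Γ with
  | nil => exact ⟨fun h _ => h, fun h => h _⟩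
  | cons σ Γ ih => exact (ih _).trans ⟨fun h e => h e.1 e.2, fun h e d => h (e.push d)⟩

end Eval

/-! ## Models of the base theory -/

/-- An extensional model of the base theory. -/
structure Mod extends Str where
  ext : toStr.Extensional
  ax : toStr.Models RCA0ω

/-- The numbers of a model. -/
abbrev Mod.N (M : Mod) : Type := M.D tp0

theorem Proves.of_mods {φ : Sentence} (h : ∀ M : Mod, φ.Sat M.toStr M.nilEnv) :
    Proves RCA0ω φ :=
  .of_models (fun _ h => .inl (.inl (.inr h))) fun M h1 h2 => h ⟨M, h1, h2⟩

namespace Mod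

variable {M : Mod}

theorem basic {φ : Sentence} (h : φ ∈ basicAxioms) : φ.Sat M.toStr M.nilEnv :=
  M.ax _ (.inl (.inl (.inl (.inl (.inl h)))))

protected theorem add_assoc (a b c : M.N) : a + b + c = a + (b + c) := by
  have := basic (M := M) (.inl rfl)
  simp at this
  exact this a b c

protected theorem add_comm (a b : M.N) : a + b = b + a := by
  have := basic (M := M) (.inr (.inl rfl))
  simp at this
  exact this a b

protected theorem add_zero (a : M.N) : a + 0 = a := by
  have := basic (M := M) (.inr (.inr (.inl rfl)))
  simp at this
  exact this a

protected theorem mul_assoc (a b c : M.N) : a * b * c = a * (b * c) := by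
  have := basic (M := M) (.inr (.inr (.inr (.inl rfl))))
  simp at this
  exact this a b c

protected theorem mul_comm (a b : M.N) : a * b = b * a := by
  have := basic (M := M) (.inr (.inr (.inr (.inr (.inl rfl)))))
  simp at this
  exact this a b

protected theorem mul_one (a : M.N) : a * 1 = a := by
  have := basic (M := M) (.inr (.inr (.inr (.inr (.inr (.inl rfl))))))
  simp at this
  exact this a

protected theorem mul_zero (a : M.N) : a * 0 = 0 := by
  have := basic (M := M) (.inr (.inr (.inr (.inr (.inr (.inr (.inl rfl)))))))
  simp at this
  exact this a

protected theorem mul_add (a b c : M.N) : a * (b + c) = a * b + a * c := by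
  have := basic (M := M) (.inr (.inr (.inr (.inr (.inr (.inr (.inr (.inl rfl))))))))
  simp at this
  exact this a b c

protected theorem lt_irrefl (a : M.N) : ¬ a < a := by
  have := basic (M := M) (.inr (.inr (.inr (.inr (.inr (.inr (.inr (.inr (.inl rfl)))))))))
  simp at this
  exact this a

protected theorem lt_trans {a b c : M.N} (h : a < b) (h' : b < c) : a < c := by
  have := basic (M := M) (.inr (.inr (.inr (.inr (.inr (.inr (.inr (.inr (.inr (.inl rfl))))))))))
  simp at this
  exact this a b c h h'

theorem lt_tri (a b : M.N) : a < b ∨ a = b ∨ b < a := by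
  have := basic (M := M) (.inr (.inr (.inr (.inr (.inr (.inr (.inr (.inr (.inr (.inr
    (.inl rfl)))))))))))
  simp at this
  exact this a b

theorem add_lt {a b : M.N} (h : a < b) (c : M.N) : a + c < b + c := by
  have := basic (M := M) (.inr (.inr (.inr (.inr (.inr (.inr (.inr (.inr (.inr (.inr (.inr
    (.inl rfl))))))))))))
  simp at this
  exact this a b c h

theorem mul_lt {a b c : M.N} (h : a < b) (hc : 0 < c) : a * c < b * c := by
  have := basic (M := M) (.inr (.inr (.inr (.inr (.inr (.inr (.inr (.inr (.inr (.inr (.inr (.inr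
    (.inl rfl)))))))))))))
  simp at this
  exact this a b c h hc

theorem zero_lt_or (a : M.N) : 0 < a ∨ 0 = a := by
  have := basic (M := M) (.inr (.inr (.inr (.inr (.inr (.inr (.inr (.inr (.inr (.inr (.inr (.inr
    (.inr (.inl rfl))))))))))))))
  simp [Fm.le] at this
  exact this a

theorem zero_lt_one' : (0 : M.N) < 1 := by
  have := basic (M := M) (.inr (.inr (.inr (.inr (.inr (.inr (.inr (.inr (.inr (.inr (.inr (.inr
    (.inr (.inr (.inl rfl)))))))))))))))
  simpa using this

theorem succ_lt_or {a b : M.N} (h : a < b) : a + 1 < b ∨ a + 1 = b := by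
  have := basic (M := M) (.inr (.inr (.inr (.inr (.inr (.inr (.inr (.inr (.inr (.inr (.inr (.inr
    (.inr (.inr (.inr rfl)))))))))))))))
  simp [Fm.le] at this
  exact this a b h

instance : CommSemiring M.N where
  add_assoc := Mod.add_assoc
  zero_add a := by rw [Mod.add_comm, Mod.add_zero]
  add_zero := Mod.add_zero
  add_comm := Mod.add_comm
  left_distrib := Mod.mul_add
  right_distrib a b c := by rw [Mod.mul_comm, Mod.mul_add, Mod.mul_comm c, Mod.mul_comm c]
  zero_mul a := by rw [Mod.mul_comm, Mod.mul_zero]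
  mul_zero := Mod.mul_zero
  mul_assoc := Mod.mul_assoc
  one_mul a := by rw [Mod.mul_comm, Mod.mul_one]
  mul_one := Mod.mul_one
  mul_comm := Mod.mul_comm
  nsmul := nsmulRec

open Classical in
noncomputable instance : LinearOrder M.N where
  le a b := a < b ∨ a = b
  lt a b := a < b
  le_refl a := .inr rfl
  le_trans a b c := by
    rintro (h | rfl) (h' | rfl)
    · exact .inl (Mod.lt_trans h h')
    · exact .inl h
    · exact .inl h'
    · exact .inr rfl
  lt_iff_le_not_ge a b := by
    constructor
    · intro h
      refine ⟨.inl h, ?_⟩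
      rintro (h' | rfl)
      · exact Mod.lt_irrefl _ (Mod.lt_trans h h')
      · exact Mod.lt_irrefl _ h
    · rintro ⟨h | rfl, h'⟩
      · exact h
      · exact absurd (.inr rfl) h'
  le_antisymm a b := by
    rintro (h | rfl) (h' | h')
    · exact absurd (Mod.lt_trans h h') (Mod.lt_irrefl _)
    · exact h'.symm
    · rfl
    · rfl
  le_total a b := by
    rcases lt_tri a b with h | h | h
    · exact .inl (.inl h)
    · exact .inl (.inr h)
    · exact .inr (.inl h)
  toDecidableLE := Classical.decRel _
  toDecidableEq := Classical.decEq _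
  toDecidableLT := Classical.decRel _

theorem le_iff (a b : M.N) : a ≤ b ↔ a < b ∨ a = b := Iff.rfl

@[simp] theorem sat_le {Γ : Ctx} (e : M.Env Γ) (s t : Tm Γ tp0) :
    (s ≼ t).Sat M.toStr e ↔ s.eval M.toStr e ≤ t.eval M.toStr e := by
  rw [Fm.le, sat_disj, le_iff]
  rfl

instance : IsStrictOrderedRing M.N where
  add_le_add_left a b h c := by
    rcases h with h | rfl
    · exact .inl (add_lt h c)
    · exact le_rfl
  le_of_add_le_add_left a b c h := by
    by_contra hn
    rw [add_comm a, add_comm a] at h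
    exact absurd (add_lt (not_le.1 hn) a) (not_lt.2 h)
  zero_le_one := .inl zero_lt_one'
  exists_pair_ne := ⟨0, 1, zero_lt_one'.ne⟩
  mul_lt_mul_of_pos_left a ha b c h := by
    rw [mul_comm a, mul_comm a]
    exact mul_lt h ha
  mul_lt_mul_of_pos_right a ha b c h := mul_lt h ha

protected theorem zero_le (a : M.N) : 0 ≤ a := zero_lt_or a

theorem succ_le {a b : M.N} : a + 1 ≤ b ↔ a < b :=
  ⟨fun h => (lt_add_of_pos_right a zero_lt_one').trans_le h, succ_lt_or⟩

theorem lt_succ {a b : M.N} : a < b + 1 ↔ a ≤ b := by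
  rw [← not_le, succ_le, not_lt]

end Mod

end HORM

/-! ### Combinators, iteration and definability inside a model. -/

namespace HORM

namespace Mod

variable {M : Mod}

theorem K_app {σ τ : Ty} (x : M.D σ) (y : M.D τ) : M.app (M.app (M.K σ τ) x) y = x := by
  have := M.ax _ (.inl (.inl (.inl (.inl (.inr (.inl ⟨σ, τ, rfl⟩))))))
  simp only [sat_fa, sat_eqAt _ M.ext, Tm.eval_app, Tm.eval_K, Tm.eval_up, Tm.up_refl,
    Tm.eval_var_zero] at this
  exact this x y

theorem S_app {ρ σ τ : Ty} (x : M.D (ρ ⇾ σ ⇾ τ)) (y : M.D (ρ ⇾ σ)) (z : M.D ρ) :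
    M.app (M.app (M.app (M.S ρ σ τ) x) y) z = M.app (M.app x z) (M.app y z) := by
  have := M.ax _ (.inl (.inl (.inl (.inl (.inr (.inr ⟨ρ, σ, τ, rfl⟩))))))
  simp only [sat_fa, sat_eqAt _ M.ext, Tm.eval_app, Tm.eval_S, Tm.eval_up, Tm.up_refl,
    Tm.eval_var_zero] at this
  exact this x y z

/-- Iteration of a function. -/
def iter (f : M.D tp1) (m n : M.N) : M.N := M.app (M.app (M.app (M.R tp0) f) m) n

theorem iter_zero (f : M.D tp1) (m : M.N) : iter f m 0 = m := by
  have := M.ax _ (.inl (.inl (.inl (.inr (.inl rfl)))))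
  simp at this
  exact this f m

theorem iter_succ (f : M.D tp1) (m n : M.N) : iter f m (n + 1) = M.app f (iter f m n) := by
  have := M.ax _ (.inl (.inl (.inl (.inr (.inr rfl)))))
  simp at this
  exact this f m n

theorem sat_qfInduction {Γ : Ctx} {A : Fm (tp0 :: Γ)} (hA : A.IsQF) (e : M.Env Γ)
    (h0 : A.Sat M.toStr (e.push (0 : M.N)))
    (hs : ∀ n : M.N, A.Sat M.toStr (e.push n) → A.Sat M.toStr (e.push (n + 1))) (n : M.N) :
    A.Sat M.toStr (e.push n) := by
  have := M.ax _ (.inl (.inr ⟨Γ, A, hA, rfl⟩))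
  rw [sat_close] at this
  refine this e ((Fm.sat_inst _ _ _).2 h0) (fun n hn => ?_) n
  refine (Fm.sat_subst _ _ (e.push (n + 1)) (fun x => ?_) _).2 (hs n hn)
  cases x <;> rfl

theorem sat_qfAC {Γ : Ctx} {A : Fm (tp0 :: tp1 :: Γ)} (hA : A.IsQF) (e : M.Env Γ)
    (h : ∀ x : M.D tp1, ∃ y : M.N, A.Sat M.toStr ((e.push x).push y)) :
    ∃ Y : M.D tp2, ∀ x, A.Sat M.toStr ((e.push x).push (M.app Y x)) := by
  have := M.ax _ (.inr ⟨Γ, A, hA, rfl⟩)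
  rw [sat_close] at this
  have h1 := this e
  simp only [sat_imp, sat_fa, sat_ex] at h1
  obtain ⟨Y, hY⟩ := h1 h
  refine ⟨Y, fun x => (Fm.sat_subst _ _ _ (fun z => ?_) _).1 (hY x)⟩
  cases z with
  | zero => simp [Var.get]; rfl
  | succ z => cases z <;> rfl

/-! ## Definable functions -/

/-- A context of variables: a type with a class of definable functions into the model. -/
class Cx (M : Mod) (I : Type) where
  D : ∀ {τ : Ty}, Set (I → M.D τ)
  const : ∀ {τ : Ty} (a : M.D τ), (fun _ => a) ∈ D
  app : ∀ {σ τ : Ty} {f : I → M.D (σ ⇾ τ)} {g : I → M.D σ}, f ∈ D → g ∈ D →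
    (fun i => M.app (f i) (g i)) ∈ D

/-- Combinatory completeness in one variable: `K` represents constants, and `S` represents
application. -/
instance : Cx M (M.D σ) where
  D {τ} := {f | ∃ e : M.D (σ ⇾ τ), ∀ x, f x = M.app e x}
  const a := ⟨M.app (M.K _ _) a, fun x => (K_app a x).symm⟩
  app := by
    rintro ρ τ f g ⟨a, ha⟩ ⟨b, hb⟩
    exact ⟨M.app (M.app (M.S _ _ _) a) b, fun x => by rw [S_app, ← ha, ← hb]⟩

/-- Definability in several variables is curried: the last variable is abstracted into a functional
that depends definably on the others. `Def.lam` rests on this choice. -/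
instance {I : Type} [Cx M I] {σ : Ty} : Cx M (I × M.D σ) where
  D {τ} := {f | ∃ g : I → M.D (σ ⇾ τ), g ∈ Cx.D ∧ ∀ p, f p = M.app (g p.1) p.2}
  const a := ⟨_, Cx.const (M.app (M.K _ _) a), fun p => (K_app a _).symm⟩
  app := by
    rintro ρ τ f g ⟨a, ha, ha'⟩ ⟨b, hb, hb'⟩
    exact ⟨_, Cx.app (Cx.app (Cx.const (M.S _ _ _)) ha) hb, fun p => by rw [S_app, ← ha', ← hb']⟩

/-- Every map from propositions into the model counts as definable. Hence `Def M P` for a predicate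
`P` says that each function of its truth value is definable, that is, `P` has a characteristic
function in the model. -/
instance : Cx M Prop where
  D := Set.univ
  const _ := trivial
  app _ _ := trivial

/-- Definable maps between contexts. -/
@[fun_prop]
def Def (M : Mod) {I J : Type} [Cx M I] [Cx M J] (f : I → J) : Prop :=
  ∀ (τ : Ty) (h : J → M.D τ), h ∈ Cx.D → (fun i => h (f i)) ∈ Cx.D

section Def

variable {I J L : Type} [Cx M I] [Cx M J] [Cx M L] {ρ σ τ : Ty}

@[fun_prop]
theorem Def.id : Def M (fun i : I => i) := fun _ _ h => h

@[fun_prop]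
theorem Def.const (a : J) : Def M (fun _ : I => a) := fun _ h _ => Cx.const (h a)

@[fun_prop]
theorem Def.comp {f : J → L} {g : I → J} (hf : Def M f) (hg : Def M g) : Def M (fun i => f (g i)) :=
  fun τ h hh => hg τ _ (hf τ h hh)

theorem mem_D_id : (fun x : M.D σ => x) ∈ Cx.D (M := M) (I := M.D σ) :=
  ⟨M.app (M.app (M.S σ (σ ⇾ σ) σ) (M.K _ _)) (M.K _ _), fun x => by rw [S_app, K_app]⟩

theorem def_iff {f : I → M.D τ} : Def M f ↔ f ∈ Cx.D :=
  ⟨fun h => h _ _ mem_D_id, fun h τ k ⟨e, he⟩ => by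
    rw [funext fun i => he (f i)]
    exact Cx.app (Cx.const e) h⟩

@[fun_prop]
theorem Def.fst {f : I → J × M.D σ} (hf : Def M f) : Def M (fun i => (f i).1) :=
  fun τ h hh => hf τ (fun p => h p.1)
    ⟨_, Cx.app (Cx.const (M.K τ σ)) hh, fun _ => (K_app _ _).symm⟩

@[fun_prop]
theorem Def.snd {f : I → J × M.D σ} (hf : Def M f) : Def M (fun i => (f i).2) :=
  fun τ h ⟨e, he⟩ => hf τ (fun q => h q.2) ⟨_, Cx.const e, fun q => he q.2⟩

@[fun_prop]
theorem Def.prodMk {f : I → J} {g : I → M.D σ} (hf : Def M f) (hg : Def M g) :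
    Def M (fun i => (f i, g i)) := by
  rintro τ h ⟨k, hk, hk'⟩
  rw [funext fun i => hk' (f i, g i)]
  exact Cx.app (hf _ k hk) (def_iff.1 hg)

@[fun_prop]
theorem Def.app {f : I → M.D (σ ⇾ τ)} {g : I → M.D σ} (hf : Def M f) (hg : Def M g) :
    Def M (fun i => M.app (f i) (g i)) :=
  def_iff.2 (Cx.app (def_iff.1 hf) (def_iff.1 hg))

/-- A default object of each type. -/
def dflt (M : Mod) : (τ : Ty) → M.D τ
  | .nat => M.zero
  | .arr _ τ => M.app (M.K _ _) (M.dflt τ)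

open Classical in
/-- Abstraction. -/
noncomputable def lam (f : M.D σ → M.D τ) : M.D (σ ⇾ τ) :=
  if h : ∃ e, ∀ x, f x = M.app e x then h.choose else M.dflt _

theorem lam_app {f : M.D σ → M.D τ} (hf : Def M f) (x : M.D σ) : M.app (lam f) x = f x := by
  have h : ∃ e, ∀ x, f x = M.app e x := def_iff.1 hf
  rw [lam, dif_pos h]
  exact (h.choose_spec x).symm

/-- `lam` chooses a representative for each parameter separately. By extensionality the
representative is unique, so it coincides with the one that depends definably on the parameter. -/
theorem Def.lam {f : I → M.D σ → M.D τ} (hf : Def M (fun p : I × M.D σ => f p.1 p.2)) :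
    Def M (fun i => lam (f i)) := by
  obtain ⟨g, hg, hg'⟩ := def_iff.1 hf
  convert def_iff.2 hg using 2 with i
  have h : Def M (f i) := def_iff.2 ⟨g i, fun x => hg' (i, x)⟩
  exact M.ext _ _ fun x => (lam_app h x).trans (hg' (i, x))

theorem Def.slice {f : I → M.D σ → J} (hf : Def M (fun p : I × M.D σ => f p.1 p.2)) (i : I) :
    Def M (f i) := by
  intro τ h hh
  obtain ⟨g, -, hg'⟩ := hf τ h hh
  exact ⟨g i, fun x => hg' (i, x)⟩

@[fun_prop]
theorem Def.iter {f : I → M.D tp1} {g h : I → M.N} (hf : Def M f) (hg : Def M g) (hh : Def M h) :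
    Def M (fun i => iter (f i) (g i) (h i)) := by
  unfold Mod.iter
  fun_prop

@[fun_prop]
theorem Def.add {f g : I → M.N} (hf : Def M f) (hg : Def M g) : Def M (fun i => f i + g i) := by
  change Def M fun i => M.app (M.app M.add (f i)) (g i)
  fun_prop

@[fun_prop]
theorem Def.mul {f g : I → M.N} (hf : Def M f) (hg : Def M g) : Def M (fun i => f i * g i) := by
  change Def M fun i => M.app (M.app M.mul (f i)) (g i)
  fun_prop

/-- Definition by cases on whether a number is zero. -/
noncomputable def cond : (τ : Ty) → M.N → M.D τ → M.D τ → M.D τ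
  | .nat, c, a, b => iter (M.app (M.K tp0 tp0) b) a c
  | .arr _ τ, c, a, b => lam fun x => cond τ c (M.app a x) (M.app b x)

/-- If `c` were neither zero nor a successor, induction on the quantifier-free formula `c ≠ n` would
prove `c ≠ c`. -/
theorem exists_pred {c : M.N} (hc : c ≠ 0) : ∃ d, c = d + 1 := by
  by_contra hn
  push Not at hn
  have := sat_qfInduction (M := M) (Γ := [tp0]) (A := ∼(.var (.succ .zero) ≐ .var .zero))
    ⟨trivial, trivial⟩ (M.nilEnv.push c)
  simp at this
  obtain ⟨n, -, h⟩ := this hc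
  exact hn n h

theorem Def.cond_aux (τ : Ty) {J : Type} [Cx M J] {f : J → M.N} {g h : J → M.D τ} (hf : Def M f)
    (hg : Def M g) (hh : Def M h) : Def M (fun i => cond τ (f i) (g i) (h i)) := by
  induction τ generalizing J with
  | nat => unfold cond; fun_prop
  | arr σ τ _ ih => exact Def.lam (ih (by fun_prop) (by fun_prop) (by fun_prop))

theorem cond_zero (a b : M.D τ) : cond τ 0 a b = a := by
  induction τ with
  | nat => exact iter_zero _ _
  | arr σ τ _ ih =>
    refine M.ext _ _ fun x => ?_
    rw [cond, lam_app (Def.cond_aux τ (by fun_prop) (by fun_prop) (by fun_prop)), ih]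

theorem cond_succ (c : M.N) (a b : M.D τ) : cond τ (c + 1) a b = b := by
  induction τ with
  | nat => exact (iter_succ _ _ _).trans (K_app _ _)
  | arr σ τ _ ih =>
    refine M.ext _ _ fun x => ?_
    rw [cond, lam_app (Def.cond_aux τ (by fun_prop) (by fun_prop) (by fun_prop)), ih]

theorem cond_ne {c : M.N} (hc : c ≠ 0) (a b : M.D τ) : cond τ c a b = b := by
  obtain ⟨d, rfl⟩ := exists_pred hc
  exact cond_succ d a b

/-- Any function of the truth value of `P i` is a definition by cases on whether `f i` is zero. -/
theorem Def.of_zero {P : I → Prop} {f : I → M.N} (hf : Def M f) (h : ∀ i, f i = 0 ↔ P i) :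
    Def M P := by
  intro τ k _
  have : (fun i => k (P i)) = fun i => cond τ (f i) (k True) (k False) := by
    funext i
    by_cases hi : P i
    · rw [(h i).2 hi, cond_zero, eq_true hi]
    · rw [cond_ne (fun h0 => hi ((h i).1 h0)), eq_false hi]
  rw [this]
  exact def_iff.1 (Def.cond_aux τ hf (.const _) (.const _))

theorem Def.of_prop {P : I → Prop} (hP : Def M P) (k : Prop → M.D τ) : Def M (fun i => k (P i)) :=
  def_iff.2 (hP τ k trivial)

@[fun_prop]
theorem Def.ite {P : I → Prop} [∀ i, Decidable (P i)] {f g : I → M.D τ} (hP : Def M P) (hf : Def M f) (hg : Def M g) :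
    Def M (fun i => if P i then f i else g i) := by
  classical
  have h : Def M (fun i => if P i then (0 : M.N) else 1) := by
    convert hP.of_prop (M := M) (τ := tp0) fun p => if p then 0 else 1
  convert Def.cond_aux τ h hf hg using 2 with i
  split
  · rw [cond_zero]
  · rw [cond_ne one_ne_zero]

/-- The value `0` for true and `1` for false propositions. -/
noncomputable def chi (p : Prop) : M.N := by classical exact if p then 0 else 1

theorem chi_eq_zero {p : Prop} : (chi p : M.N) = 0 ↔ p := by
  unfold chi
  split <;> simp_all

theorem def_chi {P : I → Prop} : Def M (fun i => (chi (P i) : M.N)) ↔ Def M P :=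
  ⟨fun h => h.of_zero fun _ => chi_eq_zero, fun h => h.of_prop chi⟩

theorem Def.prop₂ {P Q : I → Prop} (hP : Def M P) (hQ : Def M Q) (k : Prop → Prop → Prop) :
    Def M (fun i => k (P i) (Q i)) := by
  classical
  have : Def M fun i => if P i then (if Q i then (chi (k True True) : M.N) else chi (k True False))
      else (if Q i then (chi (k False True) : M.N) else chi (k False False)) := by
    fun_prop
  refine this.of_zero fun i => ?_
  by_cases h1 : P i <;> by_cases h2 : Q i <;> simp [h1, h2, chi_eq_zero]

@[fun_prop]
theorem Def.and {P Q : I → Prop} (hP : Def M P) (hQ : Def M Q) : Def M (fun i => P i ∧ Q i) :=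
  hP.prop₂ hQ And

@[fun_prop]
theorem Def.or {P Q : I → Prop} (hP : Def M P) (hQ : Def M Q) : Def M (fun i => P i ∨ Q i) :=
  hP.prop₂ hQ Or

@[fun_prop]
theorem Def.not {P : I → Prop} (hP : Def M P) : Def M (fun i => ¬ P i) :=
  hP.prop₂ hP fun p _ => ¬ p

theorem Def.imp {P Q : I → Prop} (hP : Def M P) (hQ : Def M Q) : Def M (fun i => P i → Q i) :=
  hP.prop₂ hQ fun p q => p → q

end Def

end Mod

end HORM

namespace HORM

namespace Mod

variable {M : Mod} {I : Type} [Cx M I]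

/-- The order is a relation symbol, so its characteristic functional is taken from quantifier-free
choice. The two numbers to be compared are packed into one argument of type `1`, as its values at
`0` and `1`. -/
theorem exists_lt_functional (M : Mod) :
    ∃ Y : M.D tp2, ∀ x, M.app Y x = 0 ↔ M.app x (0 : M.N) < M.app x (1 : M.N) := by
  have := sat_qfAC (M := M) (Γ := [])
    (A := (Tm.var (.succ .zero) ⬝ (0 : Tm [tp0, tp1] tp0) ≺ .var (.succ .zero) ⬝ 1) ⭤
      (.var .zero ≐ 0)) (by simp [Fm.iff, Fm.conj, Fm.neg, Fm.IsQF]) M.nilEnv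
  simp at this
  obtain ⟨Y, hY⟩ := this fun x => by
    by_cases h : M.app x (0 : M.N) < M.app x (1 : M.N)
    · exact ⟨0, by simp [h]⟩
    · exact ⟨(1 : M.N), by simp [h]⟩
  exact ⟨Y, fun x => (hY x).symm⟩

@[fun_prop]
theorem Def.lt {f g : I → M.N} (hf : Def M f) (hg : Def M g) : Def M (fun i => f i < g i) := by
  obtain ⟨Y, hY⟩ := exists_lt_functional M
  have hc : Def M fun p : I × M.N => cond tp0 p.2 (f p.1) (g p.1) :=
    Def.cond_aux _ (by fun_prop) (by fun_prop) (by fun_prop)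
  refine (Def.app (.const Y) (Def.lam (f := fun i n => cond tp0 n (f i) (g i)) hc)).of_zero
    fun i => ?_
  have hi : Def M fun n : M.N => cond tp0 n (f i) (g i) := hc.slice (f := fun i n => cond tp0 n (f i) (g i)) i
  rw [hY, lam_app hi, lam_app hi, cond_zero, cond_ne one_ne_zero]

@[fun_prop]
theorem Def.le {f g : I → M.N} (hf : Def M f) (hg : Def M g) : Def M (fun i => f i ≤ g i) := by
  simp only [← not_lt]
  fun_prop

@[fun_prop]
theorem Def.eq {f g : I → M.N} (hf : Def M f) (hg : Def M g) : Def M (fun i => f i = g i) := by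
  simp only [le_antisymm_iff]
  fun_prop

/-- A definable predicate has the form `f n = 0` for an element `f` of the model. Since parameters
are allowed, this one quantifier-free formula suffices; the same device is used for `choice`. -/
theorem induction {P : M.N → Prop} (hP : Def M P) (h0 : P 0) (hs : ∀ n, P n → P (n + 1))
    (n : M.N) : P n := by
  have hc : Def M fun n => (chi (P n) : M.N) := def_chi.2 hP
  have := sat_qfInduction (M := M) (Γ := [tp1])
    (A := Tm.var (.succ .zero) ⬝ .var .zero ≐ 0) trivial
    (M.nilEnv.push (lam fun n => chi (P n)))
  simp only [sat_eq, Tm.eval_app, Tm.eval_var_succ, Tm.eval_var_zero, Tm.eval_zero, lam_app hc,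
    chi_eq_zero] at this
  exact this h0 hs n

theorem choice {P : M.D tp1 → M.N → Prop} (hP : Def M fun p : M.D tp1 × M.N => P p.1 p.2)
    (h : ∀ x, ∃ y, P x y) : ∃ Y : M.D tp2, ∀ x, P x (M.app Y x) := by
  have hc : Def M fun p : M.D tp1 × M.N => (chi (P p.1 p.2) : M.N) := def_chi.2 hP
  have hl : Def M fun x => lam fun y => (chi (P x y) : M.N) := Def.lam hc
  have hi (x : M.D tp1) : Def M fun y => (chi (P x y) : M.N) := hc.slice (f := fun x y => chi (P x y)) x
  have := sat_qfAC (M := M) (Γ := [tp1 ⇾ tp1])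
    (A := Tm.var (.succ (.succ .zero)) ⬝ .var (.succ .zero) ⬝ .var .zero ≐ 0) trivial
    (M.nilEnv.push (lam fun x => lam fun n => chi (P x n)))
  simp only [sat_eq, Tm.eval_app, Tm.eval_var_succ, Tm.eval_var_zero, Tm.eval_zero, lam_app hl,
    lam_app (hi _), chi_eq_zero] at this
  exact this h

/-- Numbers are read off from, and embedded as, constant functions of type `1`. -/
theorem choice_nat {P : M.N → M.N → Prop} (hP : Def M fun p : M.N × M.N => P p.1 p.2)
    (h : ∀ x, ∃ y, P x y) : ∃ Y : M.D tp1, ∀ x, P x (M.app Y x) := by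
  obtain ⟨Y, hY⟩ := choice (M := M) (P := fun x y => P (M.app x (0 : M.N)) y)
    (hP.comp (g := fun p : M.D tp1 × M.N => (M.app p.1 (0 : M.N), p.2)) (by fun_prop))
    fun x => h _
  have hK : Def M fun n : M.N => M.app Y (M.app (M.K tp0 tp0) n) := by fun_prop
  refine ⟨lam fun n => M.app Y (M.app (M.K tp0 tp0) n), fun n => ?_⟩
  rw [lam_app hK]
  simpa only [K_app] using hY (M.app (M.K tp0 tp0) n)

/-! ## Bounded search -/

/-- The least zero of `f` below `n`, or else `n`. -/
noncomputable def bmu (f : M.D tp1) (n : M.N) : M.N := by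
  classical exact iter (lam fun m => if M.app f m = 0 then m else m + 1) 0 n

@[fun_prop]
theorem Def.bmu {f : I → M.D tp1} {g : I → M.N} (hf : Def M f) (hg : Def M g) :
    Def M (fun i => bmu (f i) (g i)) := by
  classical
  refine Def.iter (Def.lam (f := fun i m => if M.app (f i) m = 0 then m else m + 1) ?_)
    (.const _) hg
  fun_prop

theorem bmu_zero (f : M.D tp1) : bmu f 0 = 0 := iter_zero _ _

theorem bmu_succ (f : M.D tp1) (n : M.N) :
    bmu f (n + 1) = if M.app f (bmu f n) = 0 then bmu f n else bmu f n + 1 := by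
  classical
  exact (iter_succ _ _ _).trans ((lam_app (by fun_prop) _).trans (by congr))

theorem bmu_spec (f : M.D tp1) (n : M.N) : M.app f (bmu f n) = 0 ∨ bmu f n = n := by
  refine induction (P := fun n => M.app f (bmu f n) = 0 ∨ bmu f n = n) (by fun_prop)
    (.inr (bmu_zero f)) (fun n hn => ?_) n
  rw [bmu_succ]
  split
  · exact .inl ‹_›
  · exact .inr (by rw [hn.resolve_left ‹_›])

theorem bmu_min (f : M.D tp1) (m n : M.N) (h : m < bmu f n) : M.app f m ≠ 0 := by
  refine fun h' => induction (P := fun n => ¬ (m < bmu f n ∧ M.app f m = 0)) (by fun_prop)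
    ?_ ?_ n ⟨h, h'⟩
  · rw [bmu_zero]
    exact fun h => not_lt.2 (Mod.zero_le m) h.1
  · rintro n hn ⟨h1, h2⟩
    rw [bmu_succ] at h1
    split at h1
    · exact hn ⟨h1, h2⟩
    · rcases (lt_succ.1 h1).lt_or_eq with h3 | rfl
      · exact hn ⟨h3, h2⟩
      · contradiction

theorem bmu_lt_iff (f : M.D tp1) (n : M.N) : bmu f n < n ↔ ∃ y, y < n ∧ M.app f y = 0 := by
  constructor
  · exact fun h => ⟨_, h, (bmu_spec f n).resolve_right h.ne⟩
  · rintro ⟨y, hy, h⟩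
    exact (not_lt.1 fun h' => bmu_min f y n h' h).trans_lt hy

theorem exists_lt_iff {P : M.N → Prop} (hP : Def M P) (n : M.N) :
    (∃ y, y < n ∧ P y) ↔ bmu (lam fun y => chi (P y)) n < n := by
  simp only [bmu_lt_iff, lam_app (def_chi.2 hP), chi_eq_zero]

/-- Bounded search decides the quantifier uniformly in the parameters. Induction thereby extends to
formulas with bounded quantifiers. -/
theorem Def.exists_lt {P : I → M.N → Prop} {b : I → M.N}
    (hP : Def M fun p : I × M.N => P p.1 p.2) (hb : Def M b) :
    Def M fun i => ∃ y, y < b i ∧ P i y := by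
  have h : Def M fun i => Mod.bmu (Mod.lam fun y => chi (P i y)) (b i) < b i :=
    ((Def.lam (f := fun i y => chi (P i y)) (def_chi.2 hP)).bmu hb).lt hb
  convert h using 2 with i
  rw [exists_lt_iff (hP.slice i)]

theorem Def.forall_lt {P : I → M.N → Prop} {b : I → M.N}
    (hP : Def M fun p : I × M.N => P p.1 p.2) (hb : Def M b) :
    Def M fun i => ∀ y, y < b i → P i y := by
  have := (Def.exists_lt (P := fun i y => ¬ P i y) hP.not hb).not
  convert this using 2 with i
  push Not
  rfl

theorem exists_least {P : M.N → Prop} (hP : Def M P) {n : M.N} (hn : P n) :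
    ∃ m, m ≤ n ∧ P m ∧ ∀ k, k < m → ¬ P k := by
  have h := (exists_lt_iff hP (n + 1)).1 ⟨n, lt_succ.2 le_rfl, hn⟩
  have hs := (bmu_spec (lam fun y => chi (P y)) (n + 1)).resolve_right h.ne
  rw [lam_app (def_chi.2 hP), chi_eq_zero] at hs
  refine ⟨_, lt_succ.1 h, hs, fun k hk => ?_⟩
  have := bmu_min _ _ _ hk
  rwa [lam_app (def_chi.2 hP), Ne, chi_eq_zero] at this

/-- Bounded choice with a definable choice function: the least witness is found by search. The
search runs strictly below its bound, hence `b i + 1`. -/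
theorem exists_def {P : I → M.N → Prop} {b : I → M.N}
    (hP : Def M fun p : I × M.N => P p.1 p.2) (hb : Def M b)
    (h : ∀ i, ∃ y, y ≤ b i ∧ P i y) : ∃ f : I → M.N, Def M f ∧ ∀ i, P i (f i) := by
  refine ⟨fun i => bmu (lam fun y => chi (P i y)) (b i + 1),
    (Def.lam (def_chi.2 hP)).bmu (by fun_prop), fun i => ?_⟩
  have hd := def_chi.2 (hP.slice i)
  obtain ⟨y, hy, hy'⟩ := h i
  have hlt := (exists_lt_iff (hP.slice i) (b i + 1)).1 ⟨y, lt_succ.2 hy, hy'⟩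
  have := (bmu_spec (lam fun y => chi (P i y)) (b i + 1)).resolve_right hlt.ne
  rwa [lam_app hd, chi_eq_zero] at this

/-! ## Arithmetic -/

/-- Subtraction is not among the axioms. Without a difference, `a + c < b` would be inherited from
`c` to `c + 1`, and it fails at `c = b`. -/
theorem exists_add_of_le' {a b : M.N} (h : a ≤ b) : ∃ c, b = a + c := by
  by_contra hn
  push Not at hn
  have key (c : M.N) : a + c < b := by
    refine induction (P := fun c => a + c < b) (by fun_prop) ?_ (fun c hc => ?_) c
    · rw [add_zero]
      exact lt_of_le_of_ne h fun e => hn 0 (by rw [add_zero, e])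
    · refine lt_of_le_of_ne ?_ fun e => hn (c + 1) e.symm
      rw [← add_assoc]
      exact succ_le.2 hc
  exact absurd (key b) (not_lt.2 (le_add_of_nonneg_left (Mod.zero_le a)))

instance : CanonicallyOrderedAdd M.N where
  exists_add_of_le := exists_add_of_le'
  le_self_add _ b := le_add_of_nonneg_right (Mod.zero_le b)
  le_add_self _ b := le_add_of_nonneg_left (Mod.zero_le b)

end Mod

/-! ## The field of fractions of the numbers of a model -/

section Field

variable (M : Mod)

/-- The integers of a model. -/
def Mod.Z : Type := TensorProduct ℕ ℤ M.N

noncomputable instance : CommRing M.Z := inferInstanceAs (CommRing (TensorProduct ℕ ℤ M.N))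

/-- The inclusion of the numbers in the integers. -/
noncomputable def Mod.toZ : M.N →+* M.Z :=
  (Algebra.TensorProduct.includeRight : M.N →ₐ[ℕ] TensorProduct ℕ ℤ M.N).toRingHom

/-- The numbers are cancellative, so they embed into their Grothendieck group; the map `m ⊗ n ↦ m •
f n` shows that this embedding factors through `toZ`. -/
theorem Mod.toZ_injective : Function.Injective M.toZ := by
  let f : M.N →+ Algebra.GrothendieckAddGroup M.N := Algebra.GrothendieckAddGroup.of
  let g : M.Z →+ Algebra.GrothendieckAddGroup M.N :=
    TensorProduct.liftAddHom (zmultiplesHom (M.N →+ _) f) fun r m n => by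
      change (r • m) • f n = m • f (r • n)
      rw [map_nsmul, smul_assoc, smul_comm]
  have hg (a : M.N) : g (M.toZ a) = f a := one_zsmul (f a)
  intro a b h
  have : f a = f b := by rw [← hg, ← hg, h]
  exact Algebra.GrothendieckAddGroup.of_injective this

end Field

end HORM

/-! ### Integers and rationals of a model, and their order. -/

namespace HORM

section Field

variable (M : Mod)

variable {M} in
-- Every integer is a difference of numbers, and the smaller of two numbers can be subtracted from
-- the larger within the model.
theorem Mod.Z_eq (z : M.Z) : ∃ a, z = M.toZ a ∨ z = -M.toZ a := by
  have h : ∃ a b, z = M.toZ a - M.toZ b := by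
    induction z using TensorProduct.induction_on with
    | zero => exact ⟨0, 0, by rw [sub_self]; rfl⟩
    | tmul n a =>
      rcases le_total 0 n with hn | hn
      · lift n to ℕ using hn
        refine ⟨n • a, 0, ?_⟩
        rw [map_zero, sub_zero, map_nsmul]
        change _ = n • (1 : ℤ) ⊗ₜ[ℕ] a
        rw [TensorProduct.smul_tmul', nsmul_one]
      · obtain ⟨m, rfl⟩ : ∃ m : ℕ, n = -m := ⟨n.natAbs, by omega⟩
        refine ⟨0, m • a, ?_⟩
        rw [map_zero, zero_sub, map_nsmul]
        change _ = -(m • (1 : ℤ) ⊗ₜ[ℕ] a)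
        rw [TensorProduct.smul_tmul', nsmul_one]
        exact TensorProduct.neg_tmul _ _
    | add x y hx hy =>
      obtain ⟨a, b, rfl⟩ := hx
      obtain ⟨c, d, rfl⟩ := hy
      exact ⟨a + c, b + d, by simp only [map_add]; exact sub_add_sub_comm _ _ _ _⟩
  obtain ⟨a, b, rfl⟩ := h
  rcases le_total a b with h | h
  · obtain ⟨c, rfl⟩ := exists_add_of_le h
    exact ⟨c, .inr (by rw [map_add]; abel)⟩
  · obtain ⟨c, rfl⟩ := exists_add_of_le h
    exact ⟨c, .inl (by rw [map_add]; abel)⟩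

instance : Nontrivial M.Z := M.toZ_injective.nontrivial

instance : NoZeroDivisors M.Z where
  eq_zero_or_eq_zero_of_mul_eq_zero {x y} h := by
    have hz {a : M.N} : M.toZ a = 0 ↔ a = 0 := map_eq_zero_iff _ M.toZ_injective
    obtain ⟨a, rfl | rfl⟩ := Mod.Z_eq x <;> obtain ⟨b, rfl | rfl⟩ := Mod.Z_eq y <;>
      simpa only [neg_mul, mul_neg, neg_neg, neg_eq_zero, ← map_mul, hz, mul_eq_zero] using h

instance : IsDomain M.Z := NoZeroDivisors.to_isDomain _

/-- The rationals of a model. -/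
def Mod.F : Type := FractionRing M.Z

noncomputable instance : Field M.F := inferInstanceAs (Field (FractionRing M.Z))

/-- The inclusion of the numbers in the rationals. -/
noncomputable def Mod.toF : M.N →+* M.F := (algebraMap M.Z (FractionRing M.Z)).comp M.toZ

variable {M}

theorem Mod.toF_injective : Function.Injective M.toF :=
  (IsFractionRing.injective M.Z (FractionRing M.Z)).comp M.toZ_injective

theorem Mod.toF_ne_zero {a : M.N} : M.toF a ≠ 0 ↔ a ≠ 0 := (map_ne_zero_iff _ Mod.toF_injective)

theorem Mod.F_eq (x : M.F) : ∃ a b : M.N, b ≠ 0 ∧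
    (x * M.toF b = M.toF a ∨ -x * M.toF b = M.toF a) := by
  obtain ⟨z, w, hw, rfl⟩ := IsFractionRing.div_surjective (A := M.Z) (K := FractionRing M.Z) x
  have hw0 : algebraMap M.Z (FractionRing M.Z) w ≠ 0 :=
    IsFractionRing.to_map_ne_zero_of_mem_nonZeroDivisors hw
  obtain ⟨a, ha⟩ := Mod.Z_eq z
  obtain ⟨b, hb⟩ := Mod.Z_eq w
  have hz : algebraMap M.Z (FractionRing M.Z) z = M.toF a ∨
      algebraMap M.Z (FractionRing M.Z) z = -M.toF a := by
    rcases ha with rfl | rfl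
    · exact .inl rfl
    · exact .inr (map_neg _ _)
  have hw : algebraMap M.Z (FractionRing M.Z) w = M.toF b ∨
      algebraMap M.Z (FractionRing M.Z) w = -M.toF b := by
    rcases hb with rfl | rfl
    · exact .inl rfl
    · exact .inr (map_neg _ _)
  generalize algebraMap M.Z (FractionRing M.Z) z = u at *
  generalize algebraMap M.Z (FractionRing M.Z) w = v at *
  change M.F at u v
  change v ≠ 0 at hw0
  have hb : M.toF b ≠ 0 := by rcases hw with h | h <;> (intro h'; simp [h'] at h; exact hw0 h)
  refine ⟨a, b, Mod.toF_ne_zero.1 hb, ?_⟩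
  change (u / v) * _ = _ ∨ -(u / v) * _ = _
  rcases hz with rfl | rfl <;> rcases hw with rfl | rfl <;> field_simp <;> simp

/-- The cone of non-negative rationals. -/
def Mod.cone (M : Mod) : RingCone M.F where
  carrier := {x | ∃ a b : M.N, b ≠ 0 ∧ x * M.toF b = M.toF a}
  zero_mem' := ⟨0, 1, one_ne_zero, by simp⟩
  one_mem' := ⟨1, 1, one_ne_zero, by simp⟩
  add_mem' := by
    rintro x y ⟨a, b, hb, h⟩ ⟨c, d, hd, h'⟩
    refine ⟨a * d + c * b, b * d, mul_ne_zero hb hd, ?_⟩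
    simp only [map_mul, map_add, ← h, ← h']
    ring
  mul_mem' := by
    rintro x y ⟨a, b, hb, h⟩ ⟨c, d, hd, h'⟩
    refine ⟨a * c, b * d, mul_ne_zero hb hd, ?_⟩
    simp only [map_mul, ← h, ← h']
    ring
  eq_zero_of_mem_of_neg_mem' := by
    rintro x ⟨a, b, hb, h⟩ ⟨c, d, hd, h'⟩
    have h0 : M.toF (a * d + c * b) = 0 := by
      simp only [map_mul, map_add, ← h, ← h']
      ring
    rw [map_eq_zero_iff _ Mod.toF_injective, add_eq_zero, mul_eq_zero, or_iff_left hd] at h0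
    rw [h0.1, map_zero, mul_eq_zero, or_iff_left (Mod.toF_ne_zero.2 hb)] at h
    exact h

instance : HasMemOrNegMem M.cone where
  mem_or_neg_mem x := by
    obtain ⟨a, b, hb, h | h⟩ := Mod.F_eq x
    · exact .inl ⟨a, b, hb, h⟩
    · exact .inr ⟨a, b, hb, h⟩

open Classical in
/-- The linear order of the rationals. -/
noncomputable def Mod.orderF (M : Mod) : LinearOrder M.F := LinearOrder.mkOfAddGroupCone M.cone

noncomputable instance : LinearOrder M.F := M.orderF

instance : IsOrderedRing M.F := IsOrderedRing.mkOfCone M.cone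

instance : IsStrictOrderedRing M.F := IsOrderedRing.toIsStrictOrderedRing _

namespace Mod

theorem toF_nonneg (a : M.N) : 0 ≤ M.toF a := by
  change M.toF a - 0 ∈ M.cone
  exact ⟨a, 1, one_ne_zero, by simp⟩

theorem toF_mono : StrictMono M.toF := by
  intro a b h
  refine lt_of_le_of_ne ?_ (toF_injective.ne h.ne)
  obtain ⟨c, rfl⟩ := exists_add_of_le h.le
  rw [map_add]
  exact le_add_of_nonneg_right (toF_nonneg c)

@[simp] theorem toF_lt {a b : M.N} : M.toF a < M.toF b ↔ a < b := toF_mono.lt_iff_lt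

@[simp] theorem toF_le {a b : M.N} : M.toF a ≤ M.toF b ↔ a ≤ b := toF_mono.le_iff_le

@[simp] theorem toF_inj {a b : M.N} : M.toF a = M.toF b ↔ a = b := toF_injective.eq_iff

/-- Carries the discreteness of the numbers into the field, where linear arithmetic cannot see it.
-/
theorem toF_succ_le {a b : M.N} (h : M.toF a < M.toF b) : M.toF a + 1 ≤ M.toF b := by
  rw [toF_lt, ← succ_le, ← toF_le] at h
  simpa using h

end Mod

end Field

end HORM

namespace HORM

namespace Mod

variable {M : Mod} {I : Type} [Cx M I]

/-! ## Pairing and primitive recursion -/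

/-- The graph of Cantor pairing. -/
def IsPair (c a b : M.N) : Prop := c + c = (a + b) * (a + b + 1) + (a + a)

theorem IsPair.le {c a b : M.N} (h : IsPair c a b) : a ≤ c ∧ b ≤ c := by
  have h' := congrArg M.toF h
  simp only [map_add, map_mul, map_one] at h'
  have ha := toF_nonneg a
  have hb := toF_nonneg b
  rw [← toF_le, ← toF_le]
  constructor
  · nlinarith [mul_nonneg (add_nonneg ha hb) (add_nonneg (add_nonneg ha hb) zero_le_one)]
  · rcases eq_zero_or_pos b with rfl | hb0
    · rw [map_zero]; exact toF_nonneg c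
    · rw [← toF_lt, map_zero] at hb0
      have := toF_succ_le (M := M) (a := 0) (b := b) (by simpa using hb0)
      rw [map_zero] at this
      nlinarith [mul_nonneg ha hb, mul_nonneg ha ha]

/-- Passing from the diagonal `s = a + b` to a later one raises `s * (s + 1)` by at least `2 * s +
2`, which exceeds `2 * a`. So the diagonal is determined, and then the position on it. -/
theorem IsPair.unique {c a b a' b' : M.N} (h : IsPair c a b) (h' : IsPair c a' b') :
    a = a' ∧ b = b' := by
  have key : ∀ {a b a' b' : M.N}, IsPair c a b → IsPair c a' b' → ¬ a + b < a' + b' := by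
    intro a b a' b' h h' hlt
    have h1 := congrArg M.toF h
    have h2 := congrArg M.toF h'
    rw [← toF_lt] at hlt
    have h3 := toF_succ_le hlt
    simp only [map_add, map_mul, map_one] at h1 h2 h3
    have := toF_nonneg a
    have := toF_nonneg b
    have := toF_nonneg a'
    nlinarith
  have hs : a + b = a' + b' := le_antisymm (not_lt.1 (key h' h)) (not_lt.1 (key h h'))
  rw [IsPair, hs] at h
  rw [IsPair, h] at h'
  have h1 := congrArg M.toF h'
  have h2 := congrArg M.toF hs
  simp only [map_add, map_mul, map_one] at h1 h2
  constructor
  · rw [← toF_inj]; linarith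
  · rw [← toF_inj]; linarith

@[fun_prop]
theorem Def.isPair {f g h : I → M.N} (hf : Def M f) (hg : Def M g) (hh : Def M h) :
    Def M fun i => IsPair (f i) (g i) (h i) := by
  unfold IsPair
  fun_prop

/-- Cantor's walk: the successor of `(a, b + 1)` is `(a + 1, b)`, and that of `(a, 0)` is `(0, a +
1)`. Both components are bounded by the code, which makes the induction a bounded one. -/
theorem exists_unpair (c : M.N) : ∃ a b, IsPair c a b := by
  suffices h : ∃ a, a < c + 1 ∧ ∃ b, b < c + 1 ∧ IsPair c a b by
    obtain ⟨a, -, b, -, h⟩ := h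
    exact ⟨a, b, h⟩
  refine induction (P := fun c : M.N => ∃ a, a < c + 1 ∧ ∃ b, b < c + 1 ∧ IsPair c a b)
    (Def.exists_lt (Def.exists_lt (by fun_prop) (by fun_prop)) (by fun_prop)) ?_ ?_ c
  · exact ⟨0, by simp, 0, by simp, by simp [IsPair]⟩
  · rintro c ⟨a, -, b, -, h⟩
    suffices h : ∃ a b, IsPair (c + 1) a b by
      obtain ⟨a, b, h⟩ := h
      exact ⟨a, lt_succ.2 h.le.1, b, lt_succ.2 h.le.2, h⟩
    rw [IsPair] at h
    by_cases hb : b = 0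
    · refine ⟨0, a + 1, ?_⟩
      subst hb
      rw [IsPair]
      linear_combination h
    · obtain ⟨b, rfl⟩ := exists_pred hb
      refine ⟨a + 1, b, ?_⟩
      rw [IsPair]
      linear_combination h

theorem even_or_odd (n : M.N) : ∃ m, n = m + m ∨ n = m + m + 1 := by
  suffices h : ∃ m, m < n + 1 ∧ (n = m + m ∨ n = m + m + 1) from ⟨h.choose, h.choose_spec.2⟩
  refine induction (P := fun n : M.N => ∃ m, m < n + 1 ∧ (n = m + m ∨ n = m + m + 1))
    (Def.exists_lt (by fun_prop) (by fun_prop)) ⟨0, by simp⟩ ?_ n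
  rintro n ⟨m, hm, rfl | rfl⟩
  · exact ⟨m, hm.trans (lt_add_of_pos_right _ one_pos), .inr rfl⟩
  · exact ⟨m + 1, lt_succ.2 ((le_self_add (b := m + 1)).trans_eq (by ring)), .inl (by ring)⟩

theorem add_self_inj {a b : M.N} (h : a + a = b + b) : a = b := by
  have := congrArg M.toF h
  simp only [map_add] at this
  rw [← toF_inj]
  linarith

theorem add_self_ne {a b : M.N} (h : a + a = b + b + 1) : False := by
  rcases lt_or_ge b a with h1 | h1
  · have := congrArg M.toF h
    rw [← toF_lt] at h1
    have h2 := toF_succ_le h1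
    simp only [map_add, map_one] at this
    linarith
  · have := congrArg M.toF h
    rw [← toF_le] at h1
    simp only [map_add, map_one] at this
    linarith

theorem exists_pair (a b : M.N) : ∃ c, IsPair c a b := by
  obtain ⟨m, h⟩ := even_or_odd (a + b)
  rcases h with h | h
  · refine ⟨m * (a + b + 1) + a, ?_⟩
    rw [IsPair]
    linear_combination (a + b + 1) * -h
  · refine ⟨(a + b) * (m + 1) + a, ?_⟩
    rw [IsPair]
    linear_combination (a + b) * -h

end Mod

end HORM

namespace HORM

namespace Mod

variable {M : Mod} {I : Type} [Cx M I]

/-- The recursor only iterates a map that does not know the stage. Iterating on pairs of the stage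
and the current value supplies it. -/
theorem exists_prec (a : M.N) {h : M.N → M.N → M.N} (hh : Def M fun p : M.N × M.N => h p.1 p.2) :
    ∃ f : M.D tp1, M.app f (0 : M.N) = a ∧ ∀ n : M.N, M.app f (n + 1) = h n (M.app f n) := by
  obtain ⟨pr, hpr, hpr'⟩ := exists_def (M := M) (I := M.N × M.N)
    (P := fun p c => IsPair c p.1 p.2)
    (b := fun p => (p.1 + p.2) * (p.1 + p.2 + 1) + (p.1 + p.1)) (by fun_prop) (by fun_prop)
    (fun p => by
      obtain ⟨c, hc⟩ := exists_pair p.1 p.2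
      exact ⟨c, by rw [← hc]; exact le_self_add, hc⟩)
  obtain ⟨l, hl, hl'⟩ := exists_def (M := M) (I := M.N)
    (P := fun c a => ∃ b, b < c + 1 ∧ IsPair c a b) (b := fun c => c)
    (Def.exists_lt (by fun_prop) (by fun_prop)) (by fun_prop) (fun c => by
      obtain ⟨a, b, hab⟩ := exists_unpair c
      exact ⟨a, hab.le.1, b, lt_succ.2 hab.le.2, hab⟩)
  obtain ⟨r, hr, hr'⟩ := exists_def (M := M) (I := M.N)
    (P := fun c b => ∃ a, a < c + 1 ∧ IsPair c a b) (b := fun c => c)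
    (Def.exists_lt (by fun_prop) (by fun_prop)) (by fun_prop) (fun c => by
      obtain ⟨a, b, hab⟩ := exists_unpair c
      exact ⟨b, hab.le.2, a, lt_succ.2 hab.le.1, hab⟩)
  have hlp (a b : M.N) : l (pr (a, b)) = a := by
    obtain ⟨b', -, hb⟩ := hl' (pr (a, b))
    exact (hb.unique (hpr' (a, b))).1
  have hrp (a b : M.N) : r (pr (a, b)) = b := by
    obtain ⟨b', -, hb⟩ := hr' (pr (a, b))
    exact (hb.unique (hpr' (a, b))).2
  have hs : Def M fun c : M.N => pr (l c + 1, h (l c) (r c)) :=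
    hpr.comp ((by fun_prop : Def M fun c => l c + 1).prodMk
      (hh.comp (g := fun c : M.N => (l c, r c)) (by fun_prop)))
  have hf : Def M fun n : M.N => r (iter (lam fun c => pr (l c + 1, h (l c) (r c))) (pr (0, a)) n) :=
    by fun_prop
  have hi (n : M.N) : l (iter (lam fun c => pr (l c + 1, h (l c) (r c))) (pr (0, a)) n) = n := by
    refine induction (P := fun n => l (iter _ _ n) = n) (by fun_prop) ?_ (fun n hn => ?_) n
    · rw [iter_zero, hlp]
    · rw [iter_succ, lam_app hs, hlp, hn]
  refine ⟨lam _, (lam_app hf _).trans ?_, fun n => (lam_app hf _).trans ?_⟩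
  · rw [iter_zero, hrp]
  · rw [iter_succ, lam_app hs, hrp, hi, lam_app hf]

/-! ## Powers of two -/

/-- The doubling function. -/
def dblM (M : Mod) : M.D tp1 :=
  M.app (M.app (M.S tp0 tp0 tp0) M.add) (M.app (M.app (M.S tp0 tp1 tp0) (M.K tp0 tp1)) (M.K tp0 tp0))

theorem dblM_app (n : M.N) : M.app M.dblM n = n + n := by
  rw [dblM, S_app, S_app, K_app]
  rfl

/-- Powers of two. -/
def two (n : M.N) : M.N := iter M.dblM 1 n

@[simp] theorem eval_pow2 {Γ : Ctx} (e : M.Env Γ) (t : Tm Γ tp0) :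
    (pow2 t).eval M.toStr e = two (t.eval M.toStr e) := rfl

@[fun_prop]
theorem Def.two {f : I → M.N} (hf : Def M f) : Def M fun i => two (f i) := by
  unfold Mod.two
  fun_prop

@[simp] theorem two_zero : two (0 : M.N) = 1 := iter_zero _ _

theorem two_succ (n : M.N) : two (n + 1) = two n + two n := (iter_succ _ _ _).trans (dblM_app _)

theorem two_pos (n : M.N) : 0 < two n := by
  refine induction (P := fun n => 0 < two n) (by fun_prop) (by simp) (fun n hn => ?_) n
  rw [two_succ]
  exact add_pos hn hn

theorem two_ne (n : M.N) : two n ≠ 0 := (two_pos n).ne'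

theorem two_add (m n : M.N) : two (m + n) = two m * two n := by
  refine induction (P := fun n => two (m + n) = two m * two n) (by fun_prop) (by simp)
    (fun n hn => ?_) n
  rw [← add_assoc, two_succ, two_succ, hn]
  ring

theorem lt_two (n : M.N) : n < two n := by
  refine induction (P := fun n => n < two n) (by fun_prop) (by simp) (fun n hn => ?_) n
  rw [two_succ, ← succ_le]
  exact add_le_add (succ_le.2 hn) (succ_le.2 ((Mod.zero_le n).trans_lt hn) |> fun h => by
    simpa using h)

theorem two_mono {m n : M.N} (h : m ≤ n) : two m ≤ two n := by
  obtain ⟨k, rfl⟩ := exists_add_of_le h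
  rw [two_add]
  exact le_mul_of_one_le_right (Mod.zero_le _) (by simpa using succ_le.2 (two_pos k))

/-- The rational `1 / 2 ^ n`. -/
noncomputable def eps (n : M.N) : M.F := 1 / M.toF (two n)

theorem toF_two_pos (n : M.N) : 0 < M.toF (two n) := by
  simpa using toF_lt.2 (two_pos n)

theorem eps_pos (n : M.N) : 0 < eps n := one_div_pos.2 (toF_two_pos n)

@[simp] theorem eps_zero : eps (0 : M.N) = 1 := by simp [eps]

theorem eps_add (m n : M.N) : eps (m + n) = eps m * eps n := by
  rw [eps, two_add, map_mul, eps, eps, one_div_mul_one_div]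

theorem eps_one : eps (1 : M.N) = 1 / 2 := by
  have := two_succ (0 : M.N)
  rw [zero_add, two_zero] at this
  rw [eps, this, map_add, map_one, one_add_one_eq_two]

theorem eps_succ (n : M.N) : eps (n + 1) = eps n / 2 := by rw [eps_add, eps_one]; ring

theorem eps_anti {m n : M.N} (h : m ≤ n) : eps n ≤ eps m :=
  one_div_le_one_div_of_le (toF_two_pos m) (toF_le.2 (two_mono h))

theorem eps_le_one (n : M.N) : eps n ≤ 1 := by
  rw [← eps_zero]
  exact eps_anti (Mod.zero_le n)

theorem eps_mul_two (n : M.N) : eps n * M.toF (two n) = 1 :=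
  one_div_mul_cancel (toF_two_pos n).ne'

/-- The field is Archimedean relative to the numbers of the model: a positive fraction with
denominator `b` is at least `1 / b`, which exceeds `2 ^ (-b)`. -/
theorem exists_eps_lt {x : M.F} (hx : 0 < x) : ∃ n, eps n < x := by
  obtain ⟨a, b, hb, h | h⟩ := F_eq x
  · have hb0 : 0 < M.toF b := lt_of_le_of_ne (toF_nonneg b) (toF_ne_zero.2 hb).symm
    have ha : M.toF 0 < M.toF a := by rw [← h, map_zero]; exact mul_pos hx hb0
    have ha1 := toF_succ_le ha
    rw [map_zero, zero_add] at ha1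
    refine ⟨b, ?_⟩
    rw [eps, div_lt_iff₀ (toF_two_pos b)]
    have := toF_lt.2 (lt_two b)
    nlinarith
  · have hb0 : 0 < M.toF b := lt_of_le_of_ne (toF_nonneg b) (toF_ne_zero.2 hb).symm
    nlinarith [toF_nonneg a, mul_pos hx hb0]

/-! ## Counting -/

/-- The values of `g` are the partial sums of `s`. -/
def IsCount (s g : M.D tp1) : Prop :=
  M.app g (0 : M.N) = 0 ∧ ∀ i : M.N, M.app g (i + 1) = M.app g i + M.app s i

theorem exists_count (s : M.D tp1) : ∃ g, IsCount s g :=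
  exists_prec 0 (h := fun i c => c + M.app s i) (by fun_prop)

end Mod

end HORM

namespace HORM

namespace Mod

variable {M : Mod} {I : Type} [Cx M I]

/-! ## Codes of rational numbers -/

/-- The number `q` codes the rational `(u - v) / d`. -/
def CodesRat (q u v d : M.N) : Prop :=
  ∃ a b, IsPair q a b ∧ d = b + 1 ∧ ((a = u + u ∧ v = 0) ∨ (a + 1 = v + v ∧ u = 0))

theorem exists_codesRat (q : M.N) : ∃ u v d, CodesRat q u v d := by
  obtain ⟨a, b, h⟩ := exists_unpair q
  obtain ⟨m, rfl | rfl⟩ := even_or_odd a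
  · exact ⟨m, 0, b + 1, _, b, h, rfl, .inl ⟨rfl, rfl⟩⟩
  · exact ⟨0, m + 1, b + 1, _, b, h, rfl, .inr ⟨by ring, rfl⟩⟩

theorem CodesRat.unique {q u v d u' v' d' : M.N} (h : CodesRat q u v d)
    (h' : CodesRat q u' v' d') : u = u' ∧ v = v' ∧ d = d' := by
  obtain ⟨a, b, h1, h2, h3⟩ := h
  obtain ⟨a', b', h1', h2', h3'⟩ := h'
  obtain ⟨rfl, rfl⟩ := h1.unique h1'
  rcases h3 with ⟨h3, h4⟩ | ⟨h3, h4⟩ <;> rcases h3' with ⟨h3', h4'⟩ | ⟨h3', h4'⟩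
  · exact ⟨add_self_inj (h3.symm.trans h3'), h4.trans h4'.symm, h2.trans h2'.symm⟩
  · exact (add_self_ne (a := v') (b := u) (by rw [← h3', h3])).elim
  · exact (add_self_ne (a := v) (b := u') (by rw [← h3, h3'])).elim
  · exact ⟨h4.trans h4'.symm, add_self_inj (h3.symm.trans h3'), h2.trans h2'.symm⟩

theorem CodesRat.le {q u v d : M.N} (h : CodesRat q u v d) :
    u ≤ q + 1 ∧ v ≤ q + 1 ∧ d ≤ q + 1 := by
  obtain ⟨a, b, h1, h2, h3⟩ := h
  have hab := h1.le
  refine ⟨?_, ?_, h2.le.trans (by gcongr; exact hab.2)⟩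
  · rcases h3 with ⟨h3, -⟩ | ⟨-, rfl⟩
    · exact (le_self_add.trans h3.ge).trans (hab.1.trans le_self_add)
    · exact Mod.zero_le _
  · rcases h3 with ⟨-, rfl⟩ | ⟨h3, -⟩
    · exact Mod.zero_le _
    · exact (le_self_add.trans h3.ge).trans (by gcongr; exact hab.1)

theorem Def.codesRat {f g h k : I → M.N} (hf : Def M f) (hg : Def M g) (hh : Def M h)
    (hk : Def M k) : Def M fun i => CodesRat (f i) (g i) (h i) (k i) := by
  have : Def M fun i => ∃ a, a < f i + 1 ∧ ∃ b, b < f i + 1 ∧ (IsPair (f i) a b ∧ k i = b + 1 ∧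
      ((a = g i + g i ∧ h i = 0) ∨ (a + 1 = h i + h i ∧ g i = 0))) :=
    Def.exists_lt (Def.exists_lt (by fun_prop) (by fun_prop)) (by fun_prop)
  convert this using 2 with i
  refine ⟨?_, ?_⟩
  · rintro ⟨a, b, h⟩
    exact ⟨a, lt_succ.2 h.1.le.1, b, lt_succ.2 h.1.le.2, h⟩
  · rintro ⟨a, -, b, -, h⟩
    exact ⟨a, b, h⟩

/-- The positive part of the numerator of the rational coded by `q`. -/
noncomputable def ratPos (q : M.N) : M.N := (exists_codesRat q).choose

/-- The negative part of the numerator of the rational coded by `q`. -/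
noncomputable def ratNeg (q : M.N) : M.N := (exists_codesRat q).choose_spec.choose

/-- The denominator of the rational coded by `q`. -/
noncomputable def ratDen (q : M.N) : M.N := (exists_codesRat q).choose_spec.choose_spec.choose

theorem codesRat_self (q : M.N) : CodesRat q (ratPos q) (ratNeg q) (ratDen q) :=
  (exists_codesRat q).choose_spec.choose_spec.choose_spec

theorem codesRat_iff {q u v d : M.N} :
    CodesRat q u v d ↔ u = ratPos q ∧ v = ratNeg q ∧ d = ratDen q :=
  ⟨fun h => h.unique (codesRat_self q), by
    rintro ⟨rfl, rfl, rfl⟩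
    exact codesRat_self q⟩

@[simp] theorem ratDen_ne (q : M.N) : ratDen q ≠ 0 := by
  obtain ⟨a, b, -, h, -⟩ := codesRat_self q
  rw [h]
  exact (add_pos_of_nonneg_of_pos (Mod.zero_le b) one_pos).ne'

/-- The components of a coded rational are bounded by the code plus one, so decoding is a bounded
search. -/
theorem exists_def_rat (M : Mod) : ∃ f g h : M.N → M.N, Def M f ∧ Def M g ∧ Def M h ∧
    ∀ q, f q = ratPos q ∧ g q = ratNeg q ∧ h q = ratDen q := by
  obtain ⟨f, hf, hf'⟩ := exists_def (M := M) (I := M.N) (b := fun q => q + 1)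
    (P := fun q u => ∃ v, v < q + 1 + 1 ∧ ∃ d, d < q + 1 + 1 ∧ CodesRat q u v d)
    (Def.exists_lt (Def.exists_lt (Def.codesRat (by fun_prop) (by fun_prop) (by fun_prop)
      (by fun_prop)) (by fun_prop)) (by fun_prop)) (by fun_prop) (fun q => by
      have h := codesRat_self q
      exact ⟨_, h.le.1, _, lt_succ.2 h.le.2.1, _, lt_succ.2 h.le.2.2, h⟩)
  obtain ⟨g, hg, hg'⟩ := exists_def (M := M) (I := M.N) (b := fun q => q + 1)
    (P := fun q v => ∃ u, u < q + 1 + 1 ∧ ∃ d, d < q + 1 + 1 ∧ CodesRat q u v d)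
    (Def.exists_lt (Def.exists_lt (Def.codesRat (by fun_prop) (by fun_prop) (by fun_prop)
      (by fun_prop)) (by fun_prop)) (by fun_prop)) (by fun_prop) (fun q => by
      have h := codesRat_self q
      exact ⟨_, h.le.2.1, _, lt_succ.2 h.le.1, _, lt_succ.2 h.le.2.2, h⟩)
  obtain ⟨k, hk, hk'⟩ := exists_def (M := M) (I := M.N) (b := fun q => q + 1)
    (P := fun q d => ∃ u, u < q + 1 + 1 ∧ ∃ v, v < q + 1 + 1 ∧ CodesRat q u v d)
    (Def.exists_lt (Def.exists_lt (Def.codesRat (by fun_prop) (by fun_prop) (by fun_prop)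
      (by fun_prop)) (by fun_prop)) (by fun_prop)) (by fun_prop) (fun q => by
      have h := codesRat_self q
      exact ⟨_, h.le.2.2, _, lt_succ.2 h.le.1, _, lt_succ.2 h.le.2.1, h⟩)
  refine ⟨f, g, k, hf, hg, hk, fun q => ⟨?_, ?_, ?_⟩⟩
  · obtain ⟨_, -, _, -, h⟩ := hf' q
    exact (codesRat_iff.1 h).1
  · obtain ⟨_, -, _, -, h⟩ := hg' q
    exact (codesRat_iff.1 h).2.1
  · obtain ⟨_, -, _, -, h⟩ := hk' q
    exact (codesRat_iff.1 h).2.2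

/-- The rational with the given positive and negative parts of the numerator and denominator. -/
noncomputable def rat (u v d : M.N) : M.F := (M.toF u - M.toF v) / M.toF d

/-- The rational coded by `q`. -/
noncomputable def val (q : M.N) : M.F := rat (ratPos q) (ratNeg q) (ratDen q)

theorem toF_pos {d : M.N} (hd : d ≠ 0) : 0 < M.toF d :=
  lt_of_le_of_ne (toF_nonneg d) (toF_ne_zero.2 hd).symm

theorem rat_lt {u v d u' v' d' : M.N} (hd : d ≠ 0) (hd' : d' ≠ 0) :
    rat u v d < rat u' v' d' ↔ u * d' + v' * d < u' * d + v * d' := by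
  rw [rat, rat, div_lt_div_iff₀ (toF_pos hd) (toF_pos hd'), ← toF_lt]
  simp only [map_add, map_mul]
  constructor <;> intro h <;> linarith

theorem rat_le {u v d u' v' d' : M.N} (hd : d ≠ 0) (hd' : d' ≠ 0) :
    rat u v d ≤ rat u' v' d' ↔ u * d' + v' * d ≤ u' * d + v * d' := by
  rw [rat, rat, div_le_div_iff₀ (toF_pos hd) (toF_pos hd'), ← toF_le]
  simp only [map_add, map_mul]
  constructor <;> intro h <;> linarith

theorem rat_add {u v d u' v' d' : M.N} (hd : d ≠ 0) (hd' : d' ≠ 0) :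
    rat u v d + rat u' v' d' = rat (u * d' + u' * d) (v * d' + v' * d) (d * d') := by
  have h1 := (toF_pos hd).ne'
  have h2 := (toF_pos hd').ne'
  simp only [rat, map_add, map_mul]
  field_simp
  ring

theorem rat_mul {u v d u' v' d' : M.N} :
    rat u v d * rat u' v' d' = rat (u * u' + v * v') (u * v' + v * u') (d * d') := by
  simp only [rat, map_add, map_mul, div_mul_div_comm]
  congr 1
  ring

theorem neg_rat {u v d : M.N} : -rat u v d = rat v u d := by
  rw [rat, rat, ← neg_div, neg_sub]

/-! ## Definable rational-valued functions -/

/-- Definable functions with rational values. -/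
@[fun_prop]
def DefF {I : Type} [Cx M I] (f : I → M.F) : Prop :=
  ∃ u v d : I → M.N, Def M u ∧ Def M v ∧ Def M d ∧ ∀ i, d i ≠ 0 ∧ f i = rat (u i) (v i) (d i)

theorem DefF.add {f g : I → M.F} (hf : DefF f) (hg : DefF g) : DefF fun i => f i + g i := by
  obtain ⟨u, v, d, hu, hv, hd, h⟩ := hf
  obtain ⟨u', v', d', hu', hv', hd', h'⟩ := hg
  exact ⟨fun i => u i * d' i + u' i * d i, fun i => v i * d' i + v' i * d i, fun i => d i * d' i,
    by fun_prop, by fun_prop, by fun_prop, fun i => ⟨mul_ne_zero (h i).1 (h' i).1, by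
      simp only [(h i).2, (h' i).2, rat_add (h i).1 (h' i).1]⟩⟩

theorem DefF.mul {f g : I → M.F} (hf : DefF f) (hg : DefF g) : DefF fun i => f i * g i := by
  obtain ⟨u, v, d, hu, hv, hd, h⟩ := hf
  obtain ⟨u', v', d', hu', hv', hd', h'⟩ := hg
  exact ⟨fun i => u i * u' i + v i * v' i, fun i => u i * v' i + v i * u' i, fun i => d i * d' i,
    by fun_prop, by fun_prop, by fun_prop, fun i => ⟨mul_ne_zero (h i).1 (h' i).1, by
      simp only [(h i).2, (h' i).2, rat_mul]⟩⟩

theorem DefF.neg {f : I → M.F} (hf : DefF f) : DefF fun i => -f i := by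
  obtain ⟨u, v, d, hu, hv, hd, h⟩ := hf
  exact ⟨_, _, _, hv, hu, hd, fun i => ⟨(h i).1, by simp only [(h i).2, neg_rat]⟩⟩

theorem DefF.sub {f g : I → M.F} (hf : DefF f) (hg : DefF g) : DefF fun i => f i - g i := by
  simp only [sub_eq_add_neg]
  exact hf.add hg.neg

theorem DefF.toF {f : I → M.N} (hf : Def M f) : DefF fun i => M.toF (f i) :=
  ⟨f, fun _ => 0, fun _ => 1, hf, .const _, .const _, fun i => ⟨one_ne_zero, by simp [rat]⟩⟩

theorem DefF.eps {f : I → M.N} (hf : Def M f) : DefF fun i => eps (f i) :=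
  ⟨fun _ => 1, fun _ => 0, fun i => two (f i), .const _, .const _, by fun_prop,
    fun i => ⟨two_ne _, by simp [rat, Mod.eps]⟩⟩

theorem DefF.val {f : I → M.N} (hf : Def M f) : DefF fun i => val (f i) := by
  obtain ⟨u, v, d, hu, hv, hd, h⟩ := exists_def_rat M
  refine ⟨fun i => u (f i), fun i => v (f i), fun i => d (f i), by fun_prop, by fun_prop,
    by fun_prop, fun i => ?_⟩
  obtain ⟨h1, h2, h3⟩ := h (f i)
  simp only [h1, h2, h3]
  exact ⟨ratDen_ne _, rfl⟩

theorem DefF.const (x : M.F) : DefF fun _ : I => x := by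
  obtain ⟨a, b, hb, h | h⟩ := F_eq x
  · refine ⟨fun _ => a, fun _ => 0, fun _ => b, .const _, .const _, .const _, fun _ => ⟨hb, ?_⟩⟩
    rw [rat, map_zero, sub_zero, ← h, mul_div_cancel_right₀ _ (toF_ne_zero.2 hb)]
  · refine ⟨fun _ => 0, fun _ => a, fun _ => b, .const _, .const _, .const _, fun _ => ⟨hb, ?_⟩⟩
    rw [rat, map_zero, zero_sub, ← h, neg_mul, neg_neg,
      mul_div_cancel_right₀ _ (toF_ne_zero.2 hb)]

theorem DefF.lt {f g : I → M.F} (hf : DefF f) (hg : DefF g) : Def M fun i => f i < g i := by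
  obtain ⟨u, v, d, hu, hv, hd, h⟩ := hf
  obtain ⟨u', v', d', hu', hv', hd', h'⟩ := hg
  simp only [fun i => (h i).2, fun i => (h' i).2, fun i => rat_lt (h i).1 (h' i).1]
  fun_prop

theorem DefF.le {f g : I → M.F} (hf : DefF f) (hg : DefF g) : Def M fun i => f i ≤ g i := by
  simp only [← not_lt]
  exact (hg.lt hf).not

theorem exists_dy (M : Mod) : ∃ f : M.N × M.N → M.N, Def M f ∧
    ∀ a n, val (f (a, n)) = M.toF a * eps n := by
  obtain ⟨f, hf, hf'⟩ := exists_def (M := M) (I := M.N × M.N)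
    (b := fun p => (p.1 + p.1 + two p.2) * (p.1 + p.1 + two p.2 + 1) + (p.1 + p.1 + (p.1 + p.1)))
    (P := fun p q => CodesRat q p.1 0 (two p.2))
    (Def.codesRat (by fun_prop) (by fun_prop) (by fun_prop) (by fun_prop)) (by fun_prop)
    (fun p => by
      obtain ⟨b, hb⟩ := exists_pred (two_ne p.2)
      obtain ⟨q, hq⟩ := exists_pair (p.1 + p.1) b
      refine ⟨q, ?_, _, b, hq, hb, .inl ⟨rfl, rfl⟩⟩
      have h1 : q ≤ q + q := le_self_add
      have h2 : b ≤ two p.2 := by rw [hb]; exact le_self_add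
      rw [IsPair] at hq
      rw [hq] at h1
      exact h1.trans (by gcongr))
  refine ⟨f, hf, fun a n => ?_⟩
  have := codesRat_iff.1 (hf' (a, n))
  rw [val, ← this.1, ← this.2.1, ← this.2.2]
  simp [rat, eps, div_eq_mul_inv]

/-- A code of the rational `a / 2 ^ n`. -/
noncomputable def dy (a n : M.N) : M.N := (exists_dy M).choose (a, n)

@[simp] theorem val_dy (a n : M.N) : val (dy a n) = M.toF a * eps n :=
  (exists_dy M).choose_spec.2 a n

@[fun_prop]
theorem Def.dy {f g : I → M.N} (hf : Def M f) (hg : Def M g) : Def M fun i => dy (f i) (g i) :=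
  (exists_dy M).choose_spec.1.comp (hf.prodMk hg)

end Mod

end HORM

namespace HORM

/-! ## Satisfaction of formulas about rational and real numbers -/

section Sat

variable {M : Mod} {Γ : Ctx} (e : M.Env Γ)

/-- The value of a triple of terms. -/
noncomputable def RatTm.ev (p : RatTm Γ) : M.F :=
  Mod.rat (p.pos.eval M.toStr e) (p.neg.eval M.toStr e) (p.den.eval M.toStr e)

/-- The denominator does not vanish. -/
def RatTm.Ok (p : RatTm Γ) : Prop := p.den.eval M.toStr e ≠ 0

@[simp] theorem RatTm.ok_mk (a b d : Tm Γ tp0) :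
    RatTm.Ok e ⟨a, b, d⟩ ↔ d.eval M.toStr e ≠ 0 := Iff.rfl

@[simp] theorem RatTm.ev_mk (a b d : Tm Γ tp0) : RatTm.ev e ⟨a, b, d⟩ =
    Mod.rat (a.eval M.toStr e) (b.eval M.toStr e) (d.eval M.toStr e) := rfl

@[simp] theorem RatTm.ok_add {p q : RatTm Γ} : (p + q).Ok e ↔ p.Ok e ∧ q.Ok e :=
  mul_ne_zero_iff

@[simp] theorem RatTm.ok_dyadic (a n : Tm Γ tp0) : (dyadic a n).Ok e := Mod.two_ne _

@[simp] theorem RatTm.ev_add {p q : RatTm Γ} (hp : p.Ok e) (hq : q.Ok e) :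
    (p + q).ev e = p.ev e + q.ev e := (Mod.rat_add hp hq).symm

@[simp] theorem RatTm.ev_dyadic (a n : Tm Γ tp0) :
    (dyadic a n).ev e = M.toF (a.eval M.toStr e) * Mod.eps (n.eval M.toStr e) := by
  simp [RatTm.ev, dyadic, Mod.rat, Mod.eps, div_eq_mul_inv]

@[simp] theorem RatTm.ev_up {Δ : Ctx} [Ext Δ Γ] {τ : Ty} (p : RatTm Δ) (d : M.D τ) :
    (p.up (Δ := τ :: Γ)).ev (e.push d) = (p.up (Δ := Γ)).ev e := by
  simp [RatTm.ev, RatTm.up]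

@[simp] theorem RatTm.ok_up {Δ : Ctx} [Ext Δ Γ] {τ : Ty} (p : RatTm Δ) (d : M.D τ) :
    (p.up (Δ := τ :: Γ)).Ok (e.push d) ↔ (p.up (Δ := Γ)).Ok e := by
  simp [RatTm.Ok, RatTm.up]

@[simp] theorem RatTm.up_refl (p : RatTm Γ) : p.up (Δ := Γ) = p := by
  simp [RatTm.up]

@[simp] theorem RatTm.up_mk {Δ : Ctx} [Ext Γ Δ] (a b c : Tm Γ tp0) :
    RatTm.up (Δ := Δ) ⟨a, b, c⟩ = ⟨a.up, b.up, c.up⟩ := rfl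

@[simp] theorem sat_rat_lt {p q : RatTm Γ} (hp : p.Ok e) (hq : q.Ok e) :
    (p.lt q).Sat M.toStr e ↔ p.ev e < q.ev e := (Mod.rat_lt hp hq).symm

@[simp] theorem sat_rat_le {p q : RatTm Γ} (hp : p.Ok e) (hq : q.Ok e) :
    (p.le q).Sat M.toStr e ↔ p.ev e ≤ q.ev e := by
  rw [RatTm.le, Mod.sat_le]
  exact (Mod.rat_le hp hq).symm

@[simp] theorem sat_isPair (c a b : Tm Γ tp0) : (isPair c a b).Sat M.toStr e ↔
    Mod.IsPair (c.eval M.toStr e) (a.eval M.toStr e) (b.eval M.toStr e) := Iff.rfl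

@[simp] theorem sat_codesRat (q u v d : Tm Γ tp0) : (codesRat q u v d).Sat M.toStr e ↔
    Mod.CodesRat (q.eval M.toStr e) (u.eval M.toStr e) (v.eval M.toStr e) (d.eval M.toStr e) := by
  simp [codesRat, Mod.CodesRat]

/-- Each number codes exactly one triple, so the three universal quantifiers amount to an evaluation
there. -/
theorem sat_decode (q : Tm Γ tp0) (F : RatTm (tp0 :: tp0 :: tp0 :: Γ) →
    Fm (tp0 :: tp0 :: tp0 :: Γ)) : (decode q F).Sat M.toStr e ↔
      (F ⟨Tm.var (.succ (.succ .zero)), Tm.var (.succ .zero), Tm.var .zero⟩).Sat M.toStr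
        (((e.push (Mod.ratPos (q.eval M.toStr e))).push (Mod.ratNeg (q.eval M.toStr e))).push
          (Mod.ratDen (q.eval M.toStr e))) := by
  simp only [decode, sat_fa, sat_imp, sat_codesRat, Tm.eval_up, Tm.up_refl, Tm.eval_var_zero,
    Mod.codesRat_iff]
  constructor
  · exact fun h => h _ _ _ ⟨rfl, rfl, rfl⟩
  · rintro h u v d ⟨rfl, rfl, rfl⟩
    exact h

namespace Mod

/-- `x` represents a real number. -/
def IsReal (x : M.D tp1) : Prop :=
  ∀ n i : M.N, |val (M.app x n) - val (M.app x (n + i))| < eps n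

/-- Equality of real numbers. -/
def EqReal (x y : M.D tp1) : Prop :=
  ∀ n : M.N, |val (M.app x n) - val (M.app y n)| ≤ 2 * eps n

/-- Positivity of real numbers. -/
def IsPos (x : M.D tp1) : Prop := ∃ n : M.N, eps n < val (M.app x n)

/-- Membership of the unit interval. -/
def InUnit (x : M.D tp1) : Prop :=
  ∀ n : M.N, 0 ≤ val (M.app x n) + eps n ∧ val (M.app x n) ≤ 1 + eps n

/-- The rational `a` lies in the open ball with centre `y` and radius `z`. -/
def InBall (a : M.F) (y z : M.D tp1) : Prop :=
  ∃ n : M.N, a + 2 * eps n < val (M.app y n) + val (M.app z n) ∧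
    val (M.app y n) + 2 * eps n < a + val (M.app z n)

/-- `Ψ` is a function from the reals to the positive reals. -/
def IsPosFun (Ψ : M.D (tp1 ⇾ tp1)) : Prop :=
  (∀ x, IsReal x → IsReal (M.app Ψ x) ∧ IsPos (M.app Ψ x)) ∧
    ∀ x y, IsReal x → IsReal y → EqReal x y → EqReal (M.app Ψ x) (M.app Ψ y)

end Mod

@[simp] theorem Mod.toF_ofNat_two {M : Mod} : M.toF 2 = 2 := map_ofNat M.toF 2

theorem rat_code {M : Mod} (q : M.N) :
    Mod.rat (Mod.ratPos q) (Mod.ratNeg q) (Mod.ratDen q) = Mod.val q := rfl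

@[simp] theorem sat_isReal (x : Tm Γ tp1) :
    (isReal x).Sat M.toStr e ↔ Mod.IsReal (x.eval M.toStr e) := by
  simp [isReal, sat_decode, RatTm.absLt, rat_code, Mod.IsReal, abs_sub_lt_iff, sub_lt_iff_lt_add',
    add_comm]

@[simp] theorem sat_eqReal (x y : Tm Γ tp1) :
    (eqReal x y).Sat M.toStr e ↔ Mod.EqReal (x.eval M.toStr e) (y.eval M.toStr e) := by
  simp [eqReal, sat_decode, RatTm.absLe, rat_code, Mod.EqReal, abs_sub_le_iff,
    add_comm, one_add_one_eq_two]

@[simp] theorem sat_isPos (x : Tm Γ tp1) :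
    (isPos x).Sat M.toStr e ↔ Mod.IsPos (x.eval M.toStr e) := by
  simp [isPos, sat_decode, rat_code, Mod.IsPos]

@[simp] theorem sat_inUnit (x : Tm Γ tp1) :
    (inUnit x).Sat M.toStr e ↔ Mod.InUnit (x.eval M.toStr e) := by
  simp [inUnit, sat_decode, rat_code, Mod.InUnit]

theorem sat_inBall {a : RatTm Γ} (ha : a.Ok e) (y z : Tm Γ tp1) :
    (inBall a y z).Sat M.toStr e ↔
      Mod.InBall (a.ev e) (y.eval M.toStr e) (z.eval M.toStr e) := by
  simp [inBall, sat_decode, rat_code, Mod.InBall, ha, one_add_one_eq_two]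

@[simp] theorem sat_isPosFun (Ψ : Tm Γ (tp1 ⇾ tp1)) :
    (isPosFun Ψ).Sat M.toStr e ↔ Mod.IsPosFun (Ψ.eval M.toStr e) := by
  simp [isPosFun, Mod.IsPosFun]

end Sat

end HORM

/-! ### The principles read inside a model. -/

namespace HORM

namespace Mod

variable {M : Mod}

/-- The values of `f` are `0` and `1`. -/
def IsBinary (f : M.D tp1) : Prop := ∀ n : M.N, M.app f n ≤ (1 : M.N)

/-- `T` is the characteristic function of a tree of codes of binary strings. -/
def IsTree (T : M.D tp1) : Prop :=
  IsBinary T ∧ M.app T (0 : M.N) = 0 ∧ ∀ c : M.N, 0 < c →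
    (M.app T (c + c) = (1 : M.N) ∨ M.app T (c + c + 1) = (1 : M.N)) → M.app T c = (1 : M.N)

/-- `f` is an infinite path through `T`. -/
def IsPath (T f : M.D tp1) : Prop :=
  IsBinary f ∧ ∃ c : M.D tp1, (M.app c (0 : M.N) = (1 : M.N) ∧
    ∀ n : M.N, M.app c (n + 1) = M.app c n + M.app c n + M.app f n) ∧
      ∀ n : M.N, M.app T (M.app c n) = (1 : M.N)

/-- The closed dyadic cell is contained in one of the given intervals. -/
def CellCovered (Ψ : M.D (tp1 ⇾ tp1)) (n : M.N) (y : M.D (tp0 ⇾ tp1)) (j l : M.N) : Prop :=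
  ∃ i : M.N, i < n ∧ InBall (M.toF j * eps l) (M.app y i) (M.app Ψ (M.app y i)) ∧
    InBall (M.toF (j + 1) * eps l) (M.app y i) (M.app Ψ (M.app y i))

/-- The union of the given intervals has length at least `1 - 1 / 2 ^ k`. -/
def UnionLengthGe (Ψ : M.D (tp1 ⇾ tp1)) (n : M.N) (y : M.D (tp0 ⇾ tp1)) (k : M.N) : Prop :=
  ∀ m : M.N, ∃ l : M.N, ∃ s g : M.D tp1, IsBinary s ∧ IsCount s g ∧
    (∀ j : M.N, j < two l → M.app s j = (1 : M.N) → CellCovered Ψ n y j l) ∧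
    1 ≤ M.toF (M.app g (two l)) * eps l + eps k + eps m

variable (M) in
/-- Weak weak König's lemma in `M`. -/
def WWKLIn : Prop :=
  ∀ T : M.D tp1, IsTree T → (¬ ∃ f, IsPath T f) → ∃ g, IsCount T g ∧
    ∀ k : M.N, ∃ N : M.N, ∀ n : M.N, N ≤ n →
      two k * M.app g (two (n + 1)) < two k * M.app g (two n) + two n

variable (M) in
/-- The existence of the functional `∃²` in `M`. -/
def E2In : Prop :=
  ∃ F : M.D tp2, (∀ f, M.app F f ≤ (1 : M.N)) ∧
    ∀ f, (∃ n : M.N, M.app f n = (0 : M.N)) ↔ M.app F f = (0 : M.N)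

variable (M) in
/-- The weak Heine-Borel theorem for uncountable covers in `M`. -/
def WHBUIn : Prop :=
  ∀ Ψ : M.D (tp1 ⇾ tp1), IsPosFun Ψ → ∀ k : M.N, ∃ n : M.N, ∃ y : M.D (tp0 ⇾ tp1),
    (∀ i : M.N, i < n → IsReal (M.app y i) ∧ InUnit (M.app y i)) ∧ UnionLengthGe Ψ n y k

end Mod

open HORM.Mod

variable {M : Mod} {Γ : Ctx} (e : M.Env Γ)

@[simp] theorem sat_isBinary (f : Tm Γ tp1) :
    (isBinary f).Sat M.toStr e ↔ IsBinary (f.eval M.toStr e) := by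
  simp [isBinary, IsBinary]

@[simp] theorem sat_isTree (T : Tm Γ tp1) :
    (isTree T).Sat M.toStr e ↔ IsTree (T.eval M.toStr e) := by
  simp [isTree, IsTree]

@[simp] theorem sat_isPath (T f : Tm Γ tp1) :
    (isPath T f).Sat M.toStr e ↔ IsPath (T.eval M.toStr e) (f.eval M.toStr e) := by
  simp [isPath, isInitSeg, IsPath]

@[simp] theorem sat_isCount (s g : Tm Γ tp1) :
    (isCount s g).Sat M.toStr e ↔ IsCount (s.eval M.toStr e) (g.eval M.toStr e) := by
  simp [isCount, IsCount]

theorem sat_WWKL : WWKL.Sat M.toStr M.nilEnv ↔ M.WWKLIn := by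
  simp [WWKL, WWKLIn]

theorem sat_E2 : E2.Sat M.toStr M.nilEnv ↔ M.E2In := by
  simp [E2, E2In]

@[simp] theorem sat_cellCovered (Ψ : Tm Γ (tp1 ⇾ tp1)) (n : Tm Γ tp0) (y : Tm Γ (tp0 ⇾ tp1))
    (j l : Tm Γ tp0) : (cellCovered Ψ n y j l).Sat M.toStr e ↔
      CellCovered (Ψ.eval M.toStr e) (n.eval M.toStr e) (y.eval M.toStr e) (j.eval M.toStr e)
        (l.eval M.toStr e) := by
  simp [cellCovered, CellCovered, sat_inBall]

@[simp] theorem sat_unionLengthGe (Ψ : Tm Γ (tp1 ⇾ tp1)) (n : Tm Γ tp0) (y : Tm Γ (tp0 ⇾ tp1))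
    (k : Tm Γ tp0) : (unionLengthGe Ψ n y k).Sat M.toStr e ↔
      UnionLengthGe (Ψ.eval M.toStr e) (n.eval M.toStr e) (y.eval M.toStr e)
        (k.eval M.toStr e) := by
  simp [unionLengthGe, UnionLengthGe]

theorem sat_WHBU : WHBU.Sat M.toStr M.nilEnv ↔ M.WHBUIn := by
  simp [WHBU, WHBUIn]

end HORM

namespace HORM

namespace Mod

variable {M : Mod}

/-! ## Arithmetical comprehension from `∃²` -/

instance : Cx M Unit where
  D := Set.univ
  const _ := trivial
  app _ _ := trivial

instance instCxEnv : (Γ : Ctx) → Cx M (M.Env Γ)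
  | [] => inferInstanceAs (Cx M Unit)
  | σ :: Γ => letI := instCxEnv Γ; inferInstanceAs (Cx M (M.Env Γ × M.D σ))

theorem def_get {Γ : Ctx} {σ : Ty} (x : Var Γ σ) : Def M fun e : M.Env Γ => x.get e := by
  induction x with
  | @zero Γ σ => exact Def.snd (I := M.Env Γ × M.D σ) (J := M.Env Γ) Def.id
  | @succ Γ σ τ x ih =>
    exact Def.comp (I := M.Env Γ × M.D σ) (f := fun e : M.Env Γ => x.get e) ih (Def.fst (J := M.Env Γ) (σ := σ) Def.id)

theorem def_eval {Γ : Ctx} {σ : Ty} (t : Tm Γ σ) : Def M fun e : M.Env Γ => t.eval M.toStr e := by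
  induction t with
  | var x => exact def_get x
  | app f t hf ht => exact hf.app ht
  | _ => exact .const _

/-- Applying `∃²` to the characteristic function of `P i` decides an unbounded quantifier. By
induction on formulas, every arithmetical formula then defines an element of the model. -/
theorem Def.exists_of_E2 (h : M.E2In) {I : Type} [Cx M I] {P : I → M.N → Prop}
    (hP : Def M fun p : I × M.N => P p.1 p.2) : Def M fun i => ∃ n, P i n := by
  obtain ⟨F, -, hF⟩ := h
  refine (Def.app (.const F) (Def.lam (f := fun i n => chi (P i n)) (def_chi.2 hP))).of_zero
    fun i => ?_
  have hi : Def M fun n => (chi (P i n) : M.N) :=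
    (def_chi.2 hP).slice (f := fun i n => chi (P i n)) i
  have := hF (Mod.lam fun n => chi (P i n))
  simp only [lam_app hi, chi_eq_zero] at this
  exact this.symm

theorem def_sat (h : M.E2In) {Γ : Ctx} {φ : Fm Γ} (hφ : φ.IsArithmetical) :
    Def M fun e : M.Env Γ => φ.Sat M.toStr e := by
  induction φ with
  | eq s t => exact (def_eval s).eq (def_eval t)
  | lt s t => exact (def_eval s).lt (def_eval t)
  | fal => exact .const False
  | imp φ ψ h1 h2 => exact (h1 hφ.1).imp (h2 hφ.2)
  | @all Γ σ φ ih =>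
    obtain ⟨rfl, hφ⟩ := hφ
    have := (Def.exists_of_E2 h (I := M.Env Γ) (P := fun e n => ¬ φ.Sat M.toStr (e.push n))
      (ih hφ).not).not
    convert this using 2 with e
    simp

theorem models_ACA (h : M.E2In) : M.Models ACA := by
  rintro _ ⟨Γ, φ, -, hφ, rfl⟩
  rw [sat_close]
  intro e
  classical
  have hd : Def M fun n : M.N => φ.Sat M.toStr (e.push n) :=
    (def_sat h hφ).slice (f := fun (e : M.Env Γ) (n : M.N) => φ.Sat M.toStr (e.push n)) e
  have hX : Def M fun n : M.N => if φ.Sat M.toStr (e.push n) then (1 : M.N) else 0 :=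
    hd.ite (.const _) (.const _)
  simp only [sat_ex, sat_conj, sat_isBinary, sat_fa, sat_iff, sat_eq, Tm.eval_app, Tm.eval_up,
    Tm.up_refl, Tm.eval_var_zero, Tm.eval_one]
  refine ⟨lam fun n : M.N => if φ.Sat M.toStr (e.push n) then (1 : M.N) else 0, fun n => ?_,
    fun n => ?_⟩
  · rw [lam_app hX]
    split
    · exact le_rfl
    · exact Mod.zero_le _
  · rw [lam_app hX, Fm.sat_ren (Ren.lift .succ) _ (e.push n) fun x => by cases x <;> rfl]
    split <;> simp_all

end Mod

end HORM

namespace HORM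

namespace Mod

variable {M : Mod} {I : Type} [Cx M I]

/-! ## Binary strings -/

theorem exists_len_off (c : M.N) (hc : 0 < c) : ∃ l j, c = two l + j ∧ j < two l := by
  obtain ⟨c, rfl⟩ := exists_pred hc.ne'
  suffices h : ∃ l, l < c + 1 ∧ ∃ j, j < c + 1 ∧ c + 1 = two l + j ∧ j < two l by
    obtain ⟨l, -, j, -, h⟩ := h
    exact ⟨l, j, h⟩
  refine induction (P := fun c : M.N => ∃ l, l < c + 1 ∧ ∃ j, j < c + 1 ∧
    (c + 1 = two l + j ∧ j < two l))
    (Def.exists_lt (Def.exists_lt (by fun_prop) (by fun_prop)) (by fun_prop)) ?_ ?_ c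
  · exact ⟨0, by simp, 0, by simp, by simp, by simp⟩
  · rintro c ⟨l, hl, j, hj, h, hlt⟩
    rcases (succ_le.2 hlt).lt_or_eq with h1 | h1
    · exact ⟨l, hl.trans_le le_self_add, j + 1, add_lt hj 1, by rw [h]; ring, h1⟩
    · refine ⟨l + 1, add_lt hl 1, 0, by simp, ?_, two_pos _⟩
      rw [h, two_succ, add_zero, add_assoc, h1]

theorem two_add_unique {l j l' j' : M.N} (h : two l + j = two l' + j') (hj : j < two l)
    (hj' : j' < two l') : l = l' ∧ j = j' := by
  have key : ∀ {l j l' j' : M.N}, two l + j = two l' + j' → j < two l → ¬ l < l' := by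
    intro l j l' j' h hj hl
    have h1 : two (l + 1) ≤ two l' := two_mono (succ_le.2 hl)
    rw [two_succ] at h1
    have h2 : two l + j < two l + two l := by gcongr
    exact absurd (h.ge.trans_lt (h2.trans_le h1)) (not_lt.2 le_self_add)
  obtain rfl : l = l' := le_antisymm (not_lt.1 (key h.symm hj')) (not_lt.1 (key h hj))
  exact ⟨rfl, add_left_cancel h⟩

theorem exists_def_len_off (M : Mod) : ∃ f g : M.N → M.N, Def M f ∧ Def M g ∧
    (∀ c, 0 < c → c = two (f c) + g c ∧ g c < two (f c)) ∧ f 0 = 0 ∧ g 0 = 0 := by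
  obtain ⟨f, hf, hf'⟩ := exists_def (M := M) (I := M.N) (b := fun c => c)
    -- The number `0` codes no string; it receives length and position `0` to keep the functions
    -- total.
    (P := fun c l => (c = 0 ∧ l = 0) ∨ ∃ j, j < c + 1 ∧ (c = two l + j ∧ j < two l))
    (by
      have := Def.exists_lt (M := M) (I := M.N × M.N)
        (P := fun p j => p.1 = two p.2 + j ∧ j < two p.2) (b := fun p => p.1 + 1)
        (by fun_prop) (by fun_prop)
      fun_prop) (by fun_prop) (fun c => by
      rcases (Mod.zero_le c).eq_or_lt with rfl | hc
      · exact ⟨0, le_rfl, .inl ⟨rfl, rfl⟩⟩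
      · obtain ⟨l, j, h, hj⟩ := exists_len_off c hc
        refine ⟨l, ?_, .inr ⟨j, lt_succ.2 ?_, h, hj⟩⟩
        · rw [h]; exact (lt_two l).le.trans le_self_add
        · rw [h]; exact le_add_self)
  obtain ⟨g, hg, hg'⟩ := exists_def (M := M) (I := M.N) (b := fun c => c)
    (P := fun c j => (c = 0 ∧ j = 0) ∨ (c = two (f c) + j ∧ j < two (f c)))
    (by fun_prop) (by fun_prop) (fun c => by
      rcases hf' c with ⟨rfl, hl⟩ | ⟨j, hj, h⟩
      · exact ⟨0, le_rfl, .inl ⟨rfl, rfl⟩⟩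
      · exact ⟨j, lt_succ.1 hj, .inr h⟩)
  refine ⟨f, g, hf, hg, fun c hc => (hg' c).resolve_left fun h => hc.ne' h.1, ?_, ?_⟩
  · rcases hf' 0 with ⟨-, h⟩ | ⟨j, -, h, -⟩
    · exact h
    · exact absurd h.symm (add_pos_of_pos_of_nonneg (two_pos _) (Mod.zero_le j)).ne'
  · rcases hg' 0 with ⟨-, h⟩ | ⟨h, -⟩
    · exact h
    · exact absurd h.symm (add_pos_of_pos_of_nonneg (two_pos _) (Mod.zero_le _)).ne'

/-- The length of the string with code `c`. -/
noncomputable def len (c : M.N) : M.N := (exists_def_len_off M).choose c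

/-- The position of the string with code `c` among the strings of its length. -/
noncomputable def off (c : M.N) : M.N := (exists_def_len_off M).choose_spec.choose c

@[fun_prop]
theorem Def.len {f : I → M.N} (hf : Def M f) : Def M fun i => len (f i) :=
  (exists_def_len_off M).choose_spec.choose_spec.1.comp hf

@[fun_prop]
theorem Def.off {f : I → M.N} (hf : Def M f) : Def M fun i => off (f i) :=
  (exists_def_len_off M).choose_spec.choose_spec.2.1.comp hf

theorem eq_len_off {c : M.N} (hc : 0 < c) : c = two (len c) + off c ∧ off c < two (len c) :=
  (exists_def_len_off M).choose_spec.choose_spec.2.2.1 c hc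

@[simp] theorem len_zero : len (0 : M.N) = 0 :=
  (exists_def_len_off M).choose_spec.choose_spec.2.2.2.1

@[simp] theorem off_zero : off (0 : M.N) = 0 :=
  (exists_def_len_off M).choose_spec.choose_spec.2.2.2.2

theorem len_off {l j : M.N} (hj : j < two l) : len (two l + j) = l ∧ off (two l + j) = j := by
  have h := eq_len_off (c := two l + j) (add_pos_of_pos_of_nonneg (two_pos _) (Mod.zero_le j))
  have := two_add_unique h.1 hj h.2
  exact ⟨this.1.symm, this.2.symm⟩

theorem len_double {c : M.N} (hc : 0 < c) : len (c + c) = len c + 1 ∧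
    len (c + c + 1) = len c + 1 := by
  obtain ⟨h1, h2⟩ := eq_len_off hc
  have h3 : off c + off c + 1 < two (len c + 1) := by
    rw [two_succ, ← succ_le]
    calc off c + off c + 1 + 1 = (off c + 1) + (off c + 1) := by ring
      _ ≤ _ := add_le_add (succ_le.2 h2) (succ_le.2 h2)
  constructor
  · have : c + c = two (len c + 1) + (off c + off c) := by
      rw [two_succ]; linear_combination h1 + h1
    rw [this, (len_off ((lt_succ.2 le_rfl).trans h3)).1]
  · have : c + c + 1 = two (len c + 1) + (off c + off c + 1) := by
      rw [two_succ]; linear_combination h1 + h1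
    rw [this, (len_off h3).1]

/-- The left endpoint of the dyadic cell of the string with code `c`. -/
noncomputable def pt (c : M.N) : M.F := M.toF (off c) * eps (len c)

/-- The string with code `c` is an initial segment of the one with code `d`. -/
def Pre (c d : M.N) : Prop := ∃ m, m < d + 1 ∧ (c * two m ≤ d ∧ d < (c + 1) * two m)

theorem Def.pre {f g : I → M.N} (hf : Def M f) (hg : Def M g) : Def M fun i => Pre (f i) (g i) :=
  Def.exists_lt (by fun_prop) (by fun_prop)

theorem Pre.of_le {c d m : M.N} (hc : 0 < c) (h1 : c * two m ≤ d) (h2 : d < (c + 1) * two m) :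
    Pre c d := by
  refine ⟨m, lt_succ.2 ?_, h1, h2⟩
  refine (lt_two m).le.trans (le_trans ?_ h1)
  exact le_mul_of_one_le_left (Mod.zero_le _) (by simpa using succ_le.2 hc)

theorem Pre.refl {c : M.N} (hc : 0 < c) : Pre c c := .of_le (m := 0) hc (by simp) (by simp)

theorem Pre.double {c d : M.N} (hc : 0 < c) (h : Pre c d) : Pre c (d + d) ∧ Pre c (d + d + 1) := by
  obtain ⟨m, -, h1, h2⟩ := h
  have h3 : d + d + 1 < (c + 1) * two (m + 1) := by
    rw [← succ_le, two_succ, mul_add]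
    calc d + d + 1 + 1 = (d + 1) + (d + 1) := by ring
      _ ≤ _ := add_le_add (succ_le.2 h2) (succ_le.2 h2)
  have h4 : c * two (m + 1) ≤ d + d := by
    rw [two_succ, mul_add]
    exact add_le_add h1 h1
  exact ⟨.of_le hc h4 ((lt_succ.2 le_rfl).trans h3), .of_le hc (h4.trans le_self_add) h3⟩

theorem Pre.le {c d : M.N} (h : Pre c d) : c ≤ d := by
  obtain ⟨m, -, h1, -⟩ := h
  exact (le_mul_of_one_le_right (Mod.zero_le _) (by simpa using succ_le.2 (two_pos m))).trans h1

/-- The cell of an extension is contained in the cell of the string. -/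
theorem Pre.pt {c d : M.N} (hc : 0 < c) (h : Pre c d) :
    pt c ≤ pt d ∧ pt d + eps (len d) ≤ pt c + eps (len c) := by
  obtain ⟨m, -, h1, h2⟩ := h
  obtain ⟨i, rfl⟩ := exists_add_of_le h1
  rw [add_mul, one_mul, add_lt_add_iff_left] at h2
  obtain ⟨h3, h4⟩ := eq_len_off hc
  have h5 : off c * two m + i < two (len c + m) := by
    rw [two_add]
    calc off c * two m + i < off c * two m + two m := by gcongr
      _ = (off c + 1) * two m := by ring
      _ ≤ _ := by gcongr; exact succ_le.2 h4
  have h6 : c * two m + i = two (len c + m) + (off c * two m + i) := by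
    rw [two_add]
    nth_rewrite 1 [h3]
    ring
  rw [Mod.pt, Mod.pt, h6, (len_off h5).1, (len_off h5).2, eps_add, map_add, map_mul]
  have h7 := eps_mul_two m
  have h8 := eps_pos (len c)
  have h9 := eps_pos m
  have h10 := toF_nonneg i
  have h11 := toF_succ_le (toF_lt.2 h2)
  have h12 : (M.toF (off c) * M.toF (two m) + M.toF i) * (eps (len c) * eps m) =
      M.toF (off c) * eps (len c) + M.toF i * (eps (len c) * eps m) := by
    linear_combination M.toF (off c) * eps (len c) * h7
  rw [h12]
  constructor
  · exact le_add_of_nonneg_right (by positivity)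
  · have : (M.toF i + 1) * eps m ≤ 1 :=
      calc _ ≤ M.toF (two m) * eps m := mul_le_mul_of_nonneg_right h11 h9.le
        _ = 1 := (_root_.mul_comm _ _).trans h7
    nlinarith

theorem pt_nonneg (c : M.N) : 0 ≤ pt c := mul_nonneg (toF_nonneg _) (eps_pos _).le

theorem pt_le_one (c : M.N) : pt c ≤ 1 := by
  rcases (Mod.zero_le c).eq_or_lt with rfl | hc
  · simp [pt]
  · have := toF_lt.2 (eq_len_off hc).2
    calc pt c ≤ M.toF (two (len c)) * eps (len c) :=
          mul_le_mul_of_nonneg_right this.le (eps_pos _).le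
      _ = 1 := (_root_.mul_comm _ _).trans (eps_mul_two _)

/-- A code of the left endpoint of the dyadic cell of the string with code `c`. -/
noncomputable def ptCode (c : M.N) : M.N := dy (off c) (len c)

@[simp] theorem val_ptCode (c : M.N) : val (ptCode c) = pt c := val_dy _ _

@[fun_prop]
theorem Def.ptCode {f : I → M.N} (hf : Def M f) : Def M fun i => ptCode (f i) := by
  unfold Mod.ptCode
  fun_prop

/-- The codes of the initial segments of a binary sequence. -/
def IsBranch (c : M.D tp1) : Prop := M.app c (0 : M.N) = (1 : M.N) ∧
  ∀ n : M.N, M.app c (n + 1) = M.app c n + M.app c n ∨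
    M.app c (n + 1) = M.app c n + M.app c n + 1

namespace IsBranch

variable {c : M.D tp1} (hc : IsBranch c)
include hc

theorem pos (n : M.N) : 0 < M.app c n := by
  refine induction (P := fun n => 0 < M.app c n) (by fun_prop) ?_ (fun n hn => ?_) n
  · rw [hc.1]; exact one_pos
  · rcases hc.2 n with h | h <;> rw [h]
    · exact add_pos hn hn
    · exact add_pos (add_pos hn hn) one_pos

theorem len_eq (n : M.N) : len (M.app c n) = n := by
  refine induction (P := fun n => len (M.app c n) = n) (by fun_prop) ?_ (fun n hn => ?_) n
  · have := (len_off (M := M) (l := 0) (j := 0) (by simp)).1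
    rw [hc.1]
    simpa using this
  · have := len_double (hc.pos n)
    rcases hc.2 n with h | h <;> rw [h]
    · rw [this.1, hn]
    · rw [this.2, hn]

theorem pre (n i : M.N) : Pre (M.app c n) (M.app c (n + i)) := by
  refine induction (P := fun i => Pre (M.app c n) (M.app c (n + i)))
    (Def.pre (by fun_prop) (by fun_prop)) ?_ (fun i hi => ?_) i
  · rw [add_zero]; exact .refl (hc.pos n)
  · have := hi.double (hc.pos n)
    rw [← add_assoc]
    rcases hc.2 (n + i) with h | h <;> rw [h]
    · exact this.1
    · exact this.2

theorem pt_le (n i : M.N) : pt (M.app c n) ≤ pt (M.app c (n + i)) ∧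
    pt (M.app c (n + i)) < pt (M.app c n) + eps n := by
  have := (hc.pre n i).pt (hc.pos n)
  rw [hc.len_eq, hc.len_eq] at this
  exact ⟨this.1, by linarith [eps_pos (n + i)]⟩

end IsBranch

end Mod

end HORM

namespace HORM

namespace Mod

variable {M : Mod}

/-! ## Coverings of most of Cantor space by an enumerated set of cells -/

theorem IsBinary.eq {f : M.D tp1} (hf : IsBinary f) (n : M.N) :
    M.app f n = 0 ∨ M.app f n = (1 : M.N) := by
  rcases (hf n).lt_or_eq with h | h
  · refine .inl (le_antisymm (lt_succ.1 ?_) (Mod.zero_le _))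
    rwa [zero_add]
  · exact .inr h

theorem IsPath.isBranch {T f : M.D tp1} (h : IsPath T f) :
    ∃ c, IsBranch c ∧ ∀ n : M.N, M.app T (M.app c n) = (1 : M.N) := by
  obtain ⟨hf, c, ⟨h0, h1⟩, hT⟩ := h
  refine ⟨c, ⟨h0, fun n => ?_⟩, hT⟩
  rcases hf.eq n with h | h
  · exact .inl (by rw [h1, h, add_zero])
  · exact .inr (by rw [h1, h])

/-- The cells `c` with `G c n` for some `n` form an enumerable set that every branch meets. A string
is bad if an initial segment has a witness `n` not exceeding the length of the string. This bound
makes badness decidable, and extensions of bad strings stay bad. The other strings form a tree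
without paths, so by WWKL almost all strings of some length are bad. -/
theorem exists_cover_of_WWKL (hW : M.WWKLIn) {G : M.N → M.N → Prop}
    (hG : Def M fun p : M.N × M.N => G p.1 p.2)
    (hbr : ∀ c, IsBranch c → ∃ m n : M.N, G (M.app c m) n) (k : M.N) :
    ∃ l : M.N, ∃ s g : M.D tp1, IsBinary s ∧ IsCount s g ∧
      (∀ j : M.N, j < two l → M.app s j = (1 : M.N) →
        ∃ c n : M.N, 0 < c ∧ Pre c (two l + j) ∧ G c n) ∧
      1 ≤ M.toF (M.app g (two l)) * eps l + eps k := by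
  classical
  let Bad : M.N → Prop := fun d => ∃ c, c < d + 1 ∧ ((0 < c ∧ Pre c d) ∧
    ∃ n, n < len d + 1 ∧ G c n)
  have hBad : Def M Bad := by
    refine Def.exists_lt (((Def.lt (by fun_prop) (by fun_prop)).and
      (Def.pre (by fun_prop) (by fun_prop))).and (Def.exists_lt ?_ (by fun_prop))) (by fun_prop)
    exact hG.comp (g := fun p : (M.N × M.N) × M.N => (p.1.2, p.2)) (by fun_prop)
  have hBad2 {d : M.N} (h : Bad d) (hd : 0 < d) : Bad (d + d) ∧ Bad (d + d + 1) := by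
    obtain ⟨c, -, ⟨hc, hp⟩, n, hn, hg⟩ := h
    have hn' : n < len d + 1 + 1 := hn.trans_le le_self_add
    obtain ⟨h1, h2⟩ := hp.double hc
    obtain ⟨h3, h4⟩ := len_double hd
    exact ⟨⟨c, lt_succ.2 h1.le, ⟨hc, h1⟩, n, by rwa [h3], hg⟩,
      ⟨c, lt_succ.2 h2.le, ⟨hc, h2⟩, n, by rwa [h4], hg⟩⟩
  have hT : Def M fun d : M.N => if 0 < d ∧ ¬ Bad d then (1 : M.N) else 0 :=
    (Def.and (by fun_prop) hBad.not).ite (.const _) (.const _)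
  let T : M.D tp1 := lam fun d : M.N => if 0 < d ∧ ¬ Bad d then (1 : M.N) else 0
  have hT1 (d : M.N) : M.app T d = (1 : M.N) ↔ 0 < d ∧ ¬ Bad d := by
    simp only [T, lam_app hT]
    split <;> simp_all
  have hT0 (d : M.N) (h : ¬ (0 < d ∧ ¬ Bad d)) : M.app T d = (0 : M.N) := by
    simp only [T, lam_app hT, if_neg h]
  have hTree : IsTree T := by
    refine ⟨fun d => ?_, hT0 _ fun h => h.1.false, fun c hc h => (hT1 c).2 ⟨hc, fun hb => ?_⟩⟩
    · by_cases h : 0 < d ∧ ¬ Bad d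
      · exact ((hT1 d).2 h).le
      · exact (hT0 d h).trans_le (Mod.zero_le _)
    · rcases h with h | h
      · exact ((hT1 _).1 h).2 (hBad2 hb hc).1
      · exact ((hT1 _).1 h).2 (hBad2 hb hc).2
  have hNo : ¬ ∃ f, IsPath T f := by
    rintro ⟨f, hf⟩
    obtain ⟨c, hc, hcT⟩ := hf.isBranch
    obtain ⟨m, n, hg⟩ := hbr c hc
    -- At length `m + n` the branch extends its segment of length `m` and is long enough for the
    -- witness `n`.
    refine ((hT1 _).1 (hcT (m + n))).2 ⟨M.app c m, lt_succ.2 (hc.pre m n).le,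
      ⟨hc.pos m, hc.pre m n⟩, n, ?_, hg⟩
    rw [hc.len_eq]
    exact lt_succ.2 le_add_self
  obtain ⟨gT, hgT, hlim⟩ := hW T hTree hNo
  obtain ⟨l, hl⟩ := hlim k
  have hs : Def M fun j : M.N => if Bad (two l + j) then (1 : M.N) else 0 :=
    (hBad.comp (g := fun j : M.N => two l + j) (by fun_prop)).ite (.const _) (.const _)
  obtain ⟨g, hg⟩ := exists_count (lam fun j : M.N => if Bad (two l + j) then (1 : M.N) else 0)
  refine ⟨l, lam fun j : M.N => if Bad (two l + j) then (1 : M.N) else 0, g, fun j => ?_, hg,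
    fun j _ h => ?_, ?_⟩
  · rw [lam_app hs]
    split
    · exact le_rfl
    · exact Mod.zero_le _
  · rw [lam_app hs] at h
    by_cases hb : Bad (two l + j)
    · obtain ⟨c, -, ⟨hc, hp⟩, n, -, hg⟩ := hb
      exact ⟨c, n, hc, hp, hg⟩
    · simp [hb] at h
  -- Each string of length `l` is counted exactly once, either in the tree or among the bad strings.
  · have key (j : M.N) : M.app gT (two l + j) + M.app g j = M.app gT (two l) + j := by
      refine induction (P := fun j => M.app gT (two l + j) + M.app g j = M.app gT (two l) + j)
        (by fun_prop) ?_ (fun j hj => ?_) j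
      · rw [add_zero, hg.1]
      · have h1 : M.app T (two l + j) + (if Bad (two l + j) then (1 : M.N) else 0) = 1 := by
          have : 0 < two l + j := add_pos_of_pos_of_nonneg (two_pos l) (Mod.zero_le j)
          by_cases hb : Bad (two l + j)
          · rw [hT0 _ fun h => h.2 hb, if_pos hb, zero_add]
          · rw [(hT1 _).2 ⟨this, hb⟩, if_neg hb, add_zero]
        rw [← add_assoc, hgT.2, hg.2, lam_app hs]
        calc _ = M.app gT (two l + j) + M.app g j +
              (M.app T (two l + j) + (if Bad (two l + j) then (1 : M.N) else 0)) := by ring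
          _ = _ := by rw [hj, h1, add_assoc]
    have h1 := key (two l)
    rw [← two_succ] at h1
    have h2 := toF_lt.2 (hl l le_rfl)
    have h3 := congrArg M.toF h1
    simp only [map_add, map_mul] at h2 h3
    have h4 := eps_mul_two k
    have h5 := eps_mul_two l
    have h6 := mul_pos (eps_pos (M := M) k) (eps_pos (M := M) l)
    have h7 := mul_lt_mul_of_pos_left h2 h6
    have h8 : M.toF (M.app gT (two (l + 1))) = M.toF (M.app gT (two l)) + M.toF (two l) -
      M.toF (M.app g (two l)) := by linear_combination h3
    rw [h8] at h7
    generalize M.toF (two k) = a at *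
    generalize M.toF (two l) = b at *
    have h9 : eps k * eps l * (a * (M.toF (M.app gT (two l)) + b - M.toF (M.app g (two l)))) =
      eps l * M.toF (M.app gT (two l)) + 1 - M.toF (M.app g (two l)) * eps l := by
      linear_combination (eps l * (M.toF (M.app gT (two l)) + b - M.toF (M.app g (two l)))) * h4
        + h5
    have h10 : eps k * eps l * (a * M.toF (M.app gT (two l)) + b) =
      eps l * M.toF (M.app gT (two l)) + eps k := by
      linear_combination (eps l * M.toF (M.app gT (two l))) * h4 + eps k * h5
    rw [h9, h10] at h7
    linarith

end Mod

end HORM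

namespace HORM

namespace Mod

variable {M : Mod} {I : Type} [Cx M I]

/-! ## Weak weak König's lemma and discontinuity -/

theorem bmu_le (f : M.D tp1) (n : M.N) : bmu f n ≤ n := by
  refine induction (P := fun n => bmu f n ≤ n) (by fun_prop) (bmu_zero f).le (fun n hn => ?_) n
  rw [bmu_succ]
  split
  · exact hn.trans le_self_add
  · gcongr

/-- The real number given by the left endpoint of the cell of the string with code `c`. -/
noncomputable def cst (c : M.N) : M.D tp1 := M.app (M.K tp0 tp0) (ptCode c)

@[simp] theorem cst_app (c n : M.N) : M.app (cst c) n = ptCode c := K_app _ _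

@[fun_prop]
theorem Def.cst {f : I → M.N} (hf : Def M f) : Def M fun i => cst (f i) := by
  unfold Mod.cst
  fun_prop

theorem isReal_cst (c : M.N) : IsReal (cst c) := fun n i => by simp [eps_pos]

theorem inUnit_cst (c : M.N) : InUnit (cst c) := fun n => by
  have h1 := pt_nonneg c
  have h2 := pt_le_one c
  have h3 := eps_pos n
  simp only [cst_app, val_ptCode]
  exact ⟨by linarith, by linarith⟩

theorem def_lam_branch (c : M.D tp1) {h : I → M.N → M.N}
    (hh : Def M fun p : I × M.N => h p.1 p.2) :
    Def M fun i => lam fun k => ptCode (M.app c (h i k)) :=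
  Def.lam (by fun_prop)

/-- Grilliot's trick: the value of `Ψ` at the real of a branch is approximated from initial
segments, unless `∃²` exists. -/
theorem exists_of_not_E2 (hE : ¬ M.E2In) {Ψ : M.D (tp1 ⇾ tp1)} (hΨ : IsPosFun Ψ) {c : M.D tp1}
    (hc : IsBranch c) :
    ∃ m n : M.N, eps m + 2 * eps n < val (M.app (M.app Ψ (cst (M.app c m))) n) := by
  by_contra! hno
  refine hE ?_
  -- A reindexing `h` of the branch gives a sequence of left end points. The identity gives the
  -- limit of the branch, and stopping at `N` gives a real equal to the left end point of the cell
  -- of length `N`.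
  let r : (M.N → M.N) → M.D tp1 := fun h => lam fun k => ptCode (M.app c (h k))
  have hr {h : M.N → M.N} (hh : Def M h) (k : M.N) : val (M.app (r h) k) = pt (M.app c (h k)) := by
    rw [lam_app (by fun_prop), val_ptCode]
  have hmin (N : M.N) : Def M fun k : M.N => if k ≤ N then k else N := by fun_prop
  have hz : IsReal (r fun k => k) := fun n i => by
    rw [hr .id, hr .id, abs_sub_lt_iff]
    obtain ⟨h1, h2⟩ := hc.pt_le n i
    exact ⟨by linarith [eps_pos n], by linarith⟩
  have hN (N : M.N) : IsReal (r fun k => if k ≤ N then k else N) := fun n i => by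
    rw [hr (hmin N), hr (hmin N)]
    by_cases hn : n ≤ N
    · obtain ⟨j, hj⟩ : ∃ j, (if n + i ≤ N then n + i else N) = n + j := by
        split
        · exact ⟨i, rfl⟩
        · exact exists_add_of_le hn
      obtain ⟨h1, h2⟩ := hc.pt_le n j
      rw [if_pos hn, hj, abs_sub_lt_iff]
      exact ⟨by linarith [eps_pos n], by linarith⟩
    · rw [if_neg hn, if_neg fun h => hn (le_self_add.trans h)]
      simp [eps_pos]
  have hNc (N : M.N) : EqReal (r fun k => if k ≤ N then k else N) (cst (M.app c N)) := fun n => by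
    rw [hr (hmin N), cst_app, val_ptCode]
    by_cases hn : n ≤ N
    · obtain ⟨j, rfl⟩ := exists_add_of_le hn
      obtain ⟨h1, h2⟩ := hc.pt_le n j
      rw [if_pos hn, abs_sub_le_iff]
      exact ⟨by linarith [eps_pos n], by linarith [eps_pos n]⟩
    · rw [if_neg hn]
      simp [(eps_pos n).le]
  obtain ⟨hzr, n₀, hn₀⟩ := hΨ.1 _ hz
  -- At index `n₀ + p` the value of `Ψ` exceeds `8 * eps p` at the limit, whereas at sequences
  -- stopped at some `N ≥ p` it is at most `5 * eps p`. The threshold `6 * eps p` separates the two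
  -- cases.
  obtain ⟨p, hp⟩ := exists_eps_lt (x := (val (M.app (M.app Ψ (r fun k => k)) n₀) - eps n₀) / 8)
    (by linarith)
  have hzq := (abs_sub_lt_iff.1 (hzr n₀ p)).1
  have hsmall (N : M.N) (hN' : p ≤ N) :
      val (M.app (M.app Ψ (r fun k => if k ≤ N then k else N)) (n₀ + p)) ≤ 5 * eps p := by
    have h1 := (abs_sub_le_iff.1 (hΨ.2 _ _ (hN N) (isReal_cst _) (hNc N) (n₀ + p))).1
    have h2 := hno N (n₀ + p)
    have h3 : eps (n₀ + p) ≤ eps p := eps_anti le_add_self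
    have h4 : eps N ≤ eps p := eps_anti hN'
    linarith
  -- The approximations follow the branch until `p` places after the first zero of `g`. If `g` has
  -- no zero, then `bmu g k = k` and they follow it forever. Thus a test of `Ψ` at this real decides
  -- whether `g` has a zero; the shift by `p` ensures a stop late enough for `hsmall`.
  let h : M.D tp1 → M.N → M.N := fun g k => if k ≤ bmu g k + p then k else bmu g k + p
  have hh : Def M fun q : M.D tp1 × M.N => h q.1 q.2 := by fun_prop
  have hF : Def M fun g => if 6 * eps p < val (M.app (M.app Ψ (r (h g))) (n₀ + p)) then
      (1 : M.N) else 0 := by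
    refine (DefF.lt (.const _) (DefF.val (Def.app (Def.app (.const _) ?_) (.const _)))).ite
      (.const _) (.const _)
    exact def_lam_branch c hh
  refine ⟨lam fun g => if 6 * eps p < val (M.app (M.app Ψ (r (h g))) (n₀ + p)) then
    (1 : M.N) else 0, fun g => ?_, fun g => ?_⟩
  · rw [lam_app hF]
    split
    · exact le_rfl
    · exact Mod.zero_le _
  rw [lam_app hF]
  constructor
  · rintro ⟨n, hn⟩
    obtain ⟨m, -, hm, hm'⟩ := exists_least (P := fun n => M.app g n = (0 : M.N)) (by fun_prop) hn
    have : h g = fun k => if k ≤ m + p then k else m + p := by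
      funext k
      rcases le_or_gt k m with hk | hk
      · have hb : bmu g k = k := by
          refine ((bmu_le g k).lt_or_eq).resolve_left fun hlt => ?_
          obtain ⟨y, hy, hy'⟩ := (bmu_lt_iff g k).1 hlt
          exact hm' y (hy.trans_le hk) hy'
        simp only [h, hb]
        rw [if_pos le_self_add, if_pos (hk.trans le_self_add)]
      · have hb : bmu g k = m := by
          have h0 := (bmu_spec g k).resolve_right ((bmu_lt_iff g k).2 ⟨m, hk, hm⟩).ne
          refine le_antisymm (not_lt.1 fun hlt => bmu_min g _ _ hlt hm) (not_lt.1 fun hlt => ?_)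
          exact hm' _ hlt h0
        simp only [h, hb]
    rw [this, if_neg]
    have h1 := hsmall (m + p) le_add_self
    have h2 := eps_pos p
    exact not_lt.2 (by linarith)
  · intro h0
    by_contra! hne
    have : h g = fun k => k := by
      funext k
      have hb : bmu g k = k := (bmu_spec g k).resolve_left (hne _)
      simp only [h, hb]
      rw [if_pos le_self_add]
    rw [this, if_pos (by linarith [eps_pos p])] at h0
    exact one_ne_zero h0

/-- Here `G c n` says that the approximation of `Ψ` at index `n` already shows that the closed cell
of `c` lies in the interval around its left end point. Grilliot's trick makes every branch meet such
a cell. -/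
theorem WHBUIn_of_not_E2 (hW : M.WWKLIn) (hE : ¬ M.E2In) : M.WHBUIn := by
  intro Ψ hΨ k
  obtain ⟨l, s, g, hs, hg, hcov, hlen⟩ := exists_cover_of_WWKL hW
    (G := fun c n => eps (len c) + 2 * eps n < val (M.app (M.app Ψ (cst c)) n))
    (DefF.lt (DefF.add (DefF.eps (by fun_prop)) (DefF.mul (.const _) (DefF.eps (by fun_prop))))
      (DefF.val (by fun_prop)))
    (fun c hc => by
      obtain ⟨m, n, h⟩ := exists_of_not_E2 hE hΨ hc
      exact ⟨m, n, by rwa [hc.len_eq]⟩) k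
  have hy (i : M.N) : M.app (lam cst) i = cst i := lam_app (Def.cst .id) i
  -- All strings of length at most `l` have codes below `2 ^ (l + 1)`, so these centres include
  -- every initial segment that is needed.
  refine ⟨two (l + 1), lam cst, fun i _ => ?_, fun m => ⟨l, s, g, hs, hg, fun j hj h => ?_, ?_⟩⟩
  · rw [hy]
    exact ⟨isReal_cst i, inUnit_cst i⟩
  · obtain ⟨c, n, hc, hp, hG⟩ := hcov j hj h
    have h1 := hp.pt hc
    obtain ⟨h2, h3⟩ := len_off hj
    rw [pt, pt, h2, h3, ← pt] at h1
    have h4 := eps_pos l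
    have h5 : M.toF (j + 1) * eps l = M.toF j * eps l + eps l := by
      rw [map_add, map_one]
      ring
    refine ⟨c, hp.le.trans_lt ?_, ?_, ?_⟩
    · rw [two_succ]
      gcongr
    all_goals
      rw [hy]
      refine ⟨n, ?_, ?_⟩ <;> rw [cst_app, val_ptCode] <;> linarith
  · linarith [eps_pos m]

end Mod

end HORM

namespace HORM

namespace Mod

variable {M : Mod} {I J : Type} [Cx M I] [Cx M J]

theorem DefF.comp {f : J → M.F} (hf : DefF f) {g : I → J} (hg : Def M g) :
    DefF fun i => f (g i) := by
  obtain ⟨u, v, d, hu, hv, hd, h⟩ := hf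
  exact ⟨_, _, _, hu.comp hg, hv.comp hg, hd.comp hg, fun i => h (g i)⟩

theorem DefF.pt {f : I → M.N} (hf : Def M f) : DefF fun i => pt (f i) :=
  (DefF.toF (by fun_prop)).mul (DefF.eps (by fun_prop))

/-! ## Strings of a fixed length -/

/-- `e` is the code of a string of length `n`. -/
def IsStr (n e : M.N) : Prop := two n ≤ e ∧ e < two (n + 1)

@[fun_prop]
theorem Def.isStr {f g : I → M.N} (hf : Def M f) (hg : Def M g) :
    Def M fun i => IsStr (f i) (g i) := by
  unfold IsStr
  fun_prop

namespace IsStr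

variable {n e d : M.N}

theorem pos (h : IsStr n e) : 0 < e := (two_pos n).trans_le h.1

theorem exists_eq (h : IsStr n e) : ∃ j, e = two n + j ∧ j < two n := by
  obtain ⟨j, rfl⟩ := exists_add_of_le h.1
  refine ⟨j, rfl, ?_⟩
  have := h.2
  rwa [two_succ, add_lt_add_iff_left] at this

theorem len_eq (h : IsStr n e) : len e = n := by
  obtain ⟨j, rfl, hj⟩ := h.exists_eq
  exact (len_off hj).1

theorem pt_eq (h : IsStr n e) : pt e = M.toF (off e) * eps n := by rw [pt, h.len_eq]

theorem of_pos (h : 0 < e) : IsStr (len e) e := by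
  obtain ⟨h1, h2⟩ := eq_len_off h
  constructor
  · exact le_self_add.trans h1.ge
  · rw [two_succ]
    exact h1.trans_lt (by gcongr)

theorem add_pt_le (h : IsStr n e) : pt e + eps n ≤ 1 := by
  have h1 := toF_succ_le (toF_lt.2 (eq_len_off h.pos).2)
  have h2 := mul_le_mul_of_nonneg_right h1 (eps_pos n).le
  have h3 := eps_mul_two n
  rw [h.len_eq] at h2
  rw [h.pt_eq]
  linarith

theorem eq_of_pt (he : IsStr n e) (hd : IsStr n d) (h : pt e = pt d) : e = d := by
  rw [he.pt_eq, hd.pt_eq, mul_left_inj' (eps_pos n).ne', toF_inj] at h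
  rw [(eq_len_off he.pos).1, (eq_len_off hd.pos).1, he.len_eq, hd.len_eq, h]

theorem pt_add_le (he : IsStr n e) (hd : IsStr n d) (h : pt e < pt d) : pt e + eps n ≤ pt d := by
  rw [he.pt_eq, hd.pt_eq] at *
  have h1 := toF_succ_le (lt_of_mul_lt_mul_right h (eps_pos n).le)
  have h2 := mul_le_mul_of_nonneg_right h1 (eps_pos n).le
  linarith

theorem double (h : IsStr n e) : IsStr (n + 1) (e + e) ∧ IsStr (n + 1) (e + e + 1) := by
  have h1 : two (n + 1) ≤ e + e := by
    rw [two_succ]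
    exact add_le_add h.1 h.1
  have h2 : e + e + 1 < two (n + 1 + 1) := by
    rw [← succ_le, two_succ (n + 1)]
    calc e + e + 1 + 1 = (e + 1) + (e + 1) := by ring
      _ ≤ _ := add_le_add (succ_le.2 h.2) (succ_le.2 h.2)
  exact ⟨⟨h1, (lt_succ.2 le_rfl).trans h2⟩, h1.trans le_self_add, h2⟩

theorem exists_half (h : IsStr (n + 1) e) : ∃ d, IsStr n d ∧ (e = d + d ∨ e = d + d + 1) := by
  obtain ⟨d, hd⟩ := even_or_odd e
  have h1 : d + d ≤ e := by
    rcases hd with rfl | rfl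
    · exact le_rfl
    · exact le_self_add
  have h2 : e < (d + 1) + (d + 1) := by
    have : (d + 1) + (d + 1) = d + d + 1 + 1 := by ring
    rw [this, lt_succ]
    rcases hd with rfl | rfl
    · exact le_self_add
    · exact le_rfl
  refine ⟨d, ⟨not_lt.1 fun hlt => ?_, not_le.1 fun hle => ?_⟩, hd⟩
  · have := (h.1.trans_lt h2).trans_le (add_le_add (succ_le.2 hlt) (succ_le.2 hlt))
    rw [two_succ] at this
    exact this.false
  · have := ((add_le_add hle hle).trans h1).trans_lt h.2
    rw [two_succ (n + 1)] at this
    exact this.false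

theorem pre (h : IsStr n e) {m : M.N} (h1 : e * two m ≤ d) (h2 : d < (e + 1) * two m) :
    IsStr (n + m) d ∧ Pre e d := by
  refine ⟨⟨?_, ?_⟩, .of_le h.pos h1 h2⟩
  · rw [two_add]
    exact (mul_le_mul_left h.1 _).trans h1
  · rw [add_right_comm, two_add]
    exact h2.trans_le (mul_le_mul_left (succ_le.2 h.2) _)

end IsStr

theorem pt_double {c : M.N} (hc : 0 < c) :
    pt (c + c) = pt c ∧ pt (c + c + 1) = pt c + eps (len c + 1) := by
  obtain ⟨h1, h2⟩ := eq_len_off hc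
  obtain ⟨h3, h4⟩ := (IsStr.of_pos hc).double
  obtain ⟨j, hj, hj'⟩ := h3.exists_eq
  obtain ⟨i, hi, hi'⟩ := h4.exists_eq
  have h5 := congrArg M.toF h1
  have h6 := congrArg M.toF hj
  have h7 := congrArg M.toF hi
  simp only [map_add, map_one, two_succ] at h5 h6 h7
  have h8 : M.toF j = 2 * M.toF (off c) := by linear_combination 2 * h5 - h6
  have h9 : M.toF i = 2 * M.toF (off c) + 1 := by linear_combination 2 * h5 - h7
  rw [h3.pt_eq, h4.pt_eq, hi, hj, (len_off hj').2, (len_off hi').2, h8, h9, pt, eps_succ]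
  exact ⟨by ring, by ring⟩

theorem IsTree.half {T : M.D tp1} (hT : IsTree T) {c d : M.N} (hc : 0 < c)
    (h : d = c + c ∨ d = c + c + 1) (hd : M.app T d = (1 : M.N)) : M.app T c = (1 : M.N) := by
  refine hT.2.2 c hc ?_
  rcases h with rfl | rfl
  · exact .inl hd
  · exact .inr hd

/-! ## Distance from the cells of a tree -/

/-- The cells of the strings of length `n` in `T` do not meet the open interval with centre `q`
and radius `ρ`. -/
def Avoid (T : M.D tp1) (q : M.F) (n : M.N) (ρ : M.F) : Prop :=
  ∀ e, e < two (n + 1) → ¬ ((IsStr n e ∧ M.app T e = (1 : M.N)) ∧ (pt e < q + ρ ∧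
    q - ρ < pt e + eps n))

theorem Def.avoid {T : I → M.D tp1} {q ρ : I → M.F} {n : I → M.N} (hT : Def M T) (hq : DefF q)
    (hn : Def M n) (hρ : DefF ρ) : Def M fun i => Avoid (T i) (q i) (n i) (ρ i) := by
  have hq' : DefF fun p : I × M.N => q p.1 := hq.comp (by fun_prop)
  have hρ' : DefF fun p : I × M.N => ρ p.1 := hρ.comp (by fun_prop)
  exact Def.forall_lt (((by fun_prop : Def M _).and ((DefF.lt (.pt (by fun_prop)) (hq'.add hρ')).and
    (DefF.lt (hq'.sub hρ') ((DefF.pt (by fun_prop)).add (.eps (by fun_prop)))))).not) (by fun_prop)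

variable {T : M.D tp1} {q ρ : M.F} {n : M.N}

theorem Avoid.mono {q' ρ' : M.F} (h : Avoid T q n ρ) (h1 : q' + ρ' ≤ q + ρ)
    (h2 : q - ρ ≤ q' - ρ') : Avoid T q' n ρ' := fun e he h' =>
  h e he ⟨h'.1, h'.2.1.trans_le h1, h2.trans_lt h'.2.2⟩

/-- A string of the tree one digit longer extends a string of the tree whose cell contains its own.
-/
theorem Avoid.succ (hT : IsTree T) (h : Avoid T q n ρ) : Avoid T q (n + 1) ρ := by
  rintro e - ⟨⟨h1, h2⟩, h3, h4⟩
  obtain ⟨d, hd, hde⟩ := h1.exists_half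
  have hp : Pre d e := by
    have := (Pre.refl hd.pos).double hd.pos
    rcases hde with rfl | rfl
    · exact this.1
    · exact this.2
  have := hp.pt hd.pos
  rw [h1.len_eq, hd.len_eq] at this
  exact h d hd.2 ⟨⟨hd, hT.half hd.pos hde h2⟩, this.1.trans_lt h3, h4.trans_le this.2⟩

theorem Avoid.add (hT : IsTree T) (h : Avoid T q n ρ) (i : M.N) : Avoid T q (n + i) ρ := by
  refine induction (P := fun i => Avoid T q (n + i) ρ)
    (Def.avoid (.const _) (.const _) (by fun_prop) (.const _)) ?_ (fun i hi => ?_) i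
  · rwa [add_zero]
  · rw [← add_assoc]
    exact hi.succ hT

/-- No string of `T` extends the string with code `c` by `m` digits. -/
def Dead (T : M.D tp1) (c m : M.N) : Prop :=
  ∀ d, d < (c + 1) * two m → (c * two m ≤ d → M.app T d ≠ (1 : M.N))

theorem Def.dead {c m : I → M.N} (hc : Def M c) (hm : Def M m) :
    Def M fun i => Dead T (c i) (m i) :=
  Def.forall_lt (Def.imp (by fun_prop) (Def.not (by fun_prop))) (by fun_prop)

theorem Dead.succ (hT : IsTree T) {c m : M.N} (hc : 0 < c) (h : Dead T c m) :
    Dead T c (m + 1) := by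
  intro d hd1 hd2 hd
  have hs := (IsStr.of_pos hc).pre hd2 hd1
  rw [← add_assoc] at hs
  obtain ⟨e, he, hed⟩ := hs.1.exists_half
  have h1 : e + e ≤ d := by
    rcases hed with rfl | rfl
    · exact le_rfl
    · exact le_self_add
  have h2 : d < (e + 1) + (e + 1) := by
    have : (e + 1) + (e + 1) = e + e + 1 + 1 := by ring
    rw [this, lt_succ]
    rcases hed with rfl | rfl
    · exact le_self_add
    · exact le_rfl
  rw [two_succ, mul_add] at hd1 hd2
  refine h e (not_le.1 fun hle => ?_) (not_lt.1 fun hlt => ?_) (hT.half he.pos hed hd)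
  · exact absurd ((add_le_add hle hle).trans h1) (not_le.2 hd1)
  · exact absurd (add_le_add (succ_le.2 hlt) (succ_le.2 hlt)) (not_le.2 (hd2.trans_lt h2))

theorem Dead.add (hT : IsTree T) {c m : M.N} (hc : 0 < c) (h : Dead T c m) (i : M.N) :
    Dead T c (m + i) := by
  refine induction (P := fun i => Dead T c (m + i)) (Def.dead (by fun_prop) (by fun_prop)) ?_
    (fun i hi => ?_) i
  · rwa [add_zero]
  · rw [← add_assoc]
    exact hi.succ hT hc

/-- Avoidance passes to level `n + len c`. A string of the tree of that length extending `c` would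
have its cell inside that of `c`, hence inside the avoided interval. -/
theorem Avoid.dead (hT : IsTree T) (h : Avoid T q n ρ) {c : M.N} (hc : 0 < c) (h1 : q - ρ < pt c)
    (h2 : pt c + eps (len c) < q + ρ) : Dead T c n := by
  intro d hd1 hd2 hd
  obtain ⟨hs, hp⟩ := (IsStr.of_pos hc).pre hd2 hd1
  rw [add_comm] at hs
  have := hp.pt hc
  rw [hs.len_eq] at this
  have h3 := eps_pos (n + len c)
  exact h.add hT (len c) d hs.2 ⟨⟨hs, hd⟩, by linarith, by linarith⟩

end Mod

end HORM

namespace HORM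

namespace Mod

variable {M : Mod} {I : Type} [Cx M I]

/-! ## The gauge function of a tree -/

/-- At some level `n ≤ K` the tree keeps distance `ρ ≤ 2 ^ (-n)` from `q`. -/
def Away (T : M.D tp1) (q : M.F) (K : M.N) (ρ : M.F) : Prop :=
  ∃ n, n < K + 1 ∧ (ρ ≤ eps n ∧ Avoid T q n ρ)

theorem Def.away {T : I → M.D tp1} {q ρ : I → M.F} {n : I → M.N} (hT : Def M T) (hq : DefF q)
    (hn : Def M n) (hρ : DefF ρ) : Def M fun i => Away (T i) (q i) (n i) (ρ i) := by
  have hq' : DefF fun p : I × M.N => q p.1 := hq.comp (by fun_prop)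
  have hρ' : DefF fun p : I × M.N => ρ p.1 := hρ.comp (by fun_prop)
  exact Def.exists_lt ((DefF.le hρ' (.eps (by fun_prop))).and
    (Def.avoid (by fun_prop) hq' (by fun_prop) hρ')) (by fun_prop)

/-- The clause `ρ ≤ eps n` in `Away` keeps every admissible radius at most `1`, so a largest
multiple of `eps K` is found by a search up to `two K`. The value `0` is the default if no positive
multiple is admissible. -/
theorem exists_def_gauge (T : M.D tp1) : ∃ f : M.N × M.N → M.N, Def M f ∧ ∀ q K,
    (f (q, K) = 0 ∨ Away T (val q) K (M.toF (f (q, K)) * eps K)) ∧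
      ¬ Away T (val q) K ((M.toF (f (q, K)) + 1) * eps K) := by
  have hd : Def M fun p : (M.N × M.N) × M.N =>
      ¬ Away T (val p.1.1) p.1.2 ((M.toF p.2 + 1) * eps p.1.2) :=
    (Def.away (.const _) (.val (by fun_prop)) (by fun_prop)
      (((DefF.toF (by fun_prop)).add (.const _)).mul (.eps (by fun_prop)))).not
  have hex (p : M.N × M.N) : ∃ r, r ≤ two p.2 ∧
      ((r = 0 ∨ Away T (val p.1) p.2 (M.toF r * eps p.2)) ∧
      ¬ Away T (val p.1) p.2 ((M.toF r + 1) * eps p.2)) := by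
    obtain ⟨q, K⟩ := p
    obtain ⟨m, hm, hm1, hm2⟩ := exists_least
      (P := fun r => ¬ Away T (val q) K ((M.toF r + 1) * eps K))
      (hd.slice (f := fun (p : M.N × M.N) r => ¬ Away T (val p.1) p.2 ((M.toF r + 1) * eps p.2))
        (q, K)) (n := two K) (by
          rintro ⟨n, -, h, -⟩
          have h1 := eps_mul_two K
          have h2 := eps_le_one n
          have h3 := eps_pos K
          linarith)
    refine ⟨m, hm, ?_, hm1⟩
    by_cases h0 : m = 0
    · exact .inl h0
    · obtain ⟨m, rfl⟩ := exists_pred h0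
      have := not_not.1 (hm2 m (lt_succ.2 le_rfl))
      rw [← map_one M.toF, ← map_add] at this
      exact .inr this
  obtain ⟨f, hf, h⟩ := exists_def (((by fun_prop : Def M _).or (Def.away (.const _)
    (.val (by fun_prop)) (by fun_prop) ((DefF.toF (by fun_prop)).mul (.eps (by fun_prop))))).and hd)
    (by fun_prop) hex
  exact ⟨f, hf, fun q K => h (q, K)⟩

/-- The largest multiple of `2 ^ (-K)` such that the tree keeps that distance from `q`. -/
noncomputable def gauge (T : M.D tp1) (q K : M.N) : M.F :=
  M.toF ((exists_def_gauge T).choose (q, K)) * eps K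

theorem gauge_nonneg (T : M.D tp1) (q K : M.N) : 0 ≤ gauge T q K :=
  mul_nonneg (toF_nonneg _) (eps_pos _).le

theorem gauge_away (T : M.D tp1) (q K : M.N) :
    gauge T q K = 0 ∨ Away T (val q) K (gauge T q K) := by
  rcases ((exists_def_gauge T).choose_spec.2 q K).1 with h | h
  · exact .inl (by rw [gauge, h, map_zero, zero_mul])
  · exact .inr h

theorem not_away_gauge (T : M.D tp1) (q K : M.N) : ¬ Away T (val q) K (gauge T q K + eps K) := by
  have := ((exists_def_gauge T).choose_spec.2 q K).2
  rwa [add_mul, one_mul] at this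

/-- The gauge is Lipschitz with constant `1` up to rounding. A level `n ≤ L` that serves `q` serves
`q'` with the radius reduced by `δ`. If `n > L`, the radius is at most `eps n < eps L` anyway, which
is why `Away` ties the radius to the level. -/
theorem gauge_lt (T : M.D tp1) (q q' K L : M.N) {δ : M.F} (h : |val q - val q'| ≤ δ) :
    gauge T q K < gauge T q' L + δ + eps L := by
  have h0 : 0 ≤ δ := (abs_nonneg _).trans h
  have h1 := gauge_nonneg T q' L
  have h2 := eps_pos L
  rcases gauge_away T q K with h3 | ⟨n, -, h3, h4⟩
  · linarith
  · rcases le_or_gt n L with hn | hn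
    · by_contra! hle
      refine not_away_gauge T q' L ⟨n, lt_succ.2 hn, by linarith, ?_⟩
      obtain ⟨h5, h6⟩ := abs_sub_le_iff.1 h
      exact h4.mono (by linarith) (by linarith)
    · have h5 : eps n ≤ eps (L + 1) := eps_anti (succ_le.2 hn)
      rw [eps_succ] at h5
      linarith

/-- The shift of index to `n + 1` halves both errors, that of the argument and that of rounding, so
that the values converge at the rate required of a real. -/
theorem exists_gaugeFun (T : M.D tp1) : ∃ Ψ : M.D (tp1 ⇾ tp1), ∀ x n,
    val (M.app (M.app Ψ x) n) = gauge T (M.app x (n + 1)) (n + 1) := by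
  have hf := (exists_def_gauge T).choose_spec.1
  have hd : Def M fun p : M.D tp1 × M.N =>
      dy ((exists_def_gauge T).choose (M.app p.1 (p.2 + 1), p.2 + 1)) (p.2 + 1) :=
    (hf.comp (g := fun p : M.D tp1 × M.N => (M.app p.1 (p.2 + 1), p.2 + 1)) (by fun_prop)).dy
      (by fun_prop)
  refine ⟨lam fun x => lam fun n =>
    dy ((exists_def_gauge T).choose (M.app x (n + 1), n + 1)) (n + 1), fun x n => ?_⟩
  rw [lam_app (Def.lam hd), lam_app (hd.slice (f := fun (x : M.D tp1) n =>
    dy ((exists_def_gauge T).choose (M.app x (n + 1), n + 1)) (n + 1)) x), val_dy, gauge]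

/-- The value of the gauge function, a sequence of rationals, at a sequence of rationals. -/
noncomputable def gaugeFun (T : M.D tp1) : M.D (tp1 ⇾ tp1) := (exists_gaugeFun T).choose

theorem val_gaugeFun (T x : M.D tp1) (n : M.N) :
    val (M.app (M.app (gaugeFun T) x) n) = gauge T (M.app x (n + 1)) (n + 1) :=
  (exists_gaugeFun T).choose_spec x n

theorem isReal_gaugeFun (T : M.D tp1) {x : M.D tp1} (hx : IsReal x) :
    IsReal (M.app (gaugeFun T) x) := fun n i => by
  have h := (hx (n + 1) i).le
  rw [add_right_comm] at h
  have h1 := gauge_lt T _ _ (n + 1) (n + i + 1) h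
  rw [abs_sub_comm] at h
  have h2 := gauge_lt T _ _ (n + i + 1) (n + 1) h
  have h3 : eps (n + i + 1) ≤ eps (n + 1) := eps_anti (by rw [add_right_comm]; exact le_self_add)
  have h4 := eps_succ n
  rw [val_gaugeFun, val_gaugeFun, abs_sub_lt_iff]
  exact ⟨by linarith, by linarith⟩

theorem eqReal_gaugeFun (T : M.D tp1) {x y : M.D tp1} (h : EqReal x y) :
    EqReal (M.app (gaugeFun T) x) (M.app (gaugeFun T) y) := fun n => by
  have h := h (n + 1)
  have h1 := gauge_lt T _ _ (n + 1) (n + 1) h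
  rw [abs_sub_comm] at h
  have h2 := gauge_lt T _ _ (n + 1) (n + 1) h
  have h3 := eps_succ n
  have h4 := eps_pos n
  rw [val_gaugeFun, val_gaugeFun, abs_sub_le_iff]
  exact ⟨by linarith, by linarith⟩

/-- A cell contained in an interval of the gauge function is eventually free of strings of `T`. -/
theorem exists_dead_of_inBall {T y : M.D tp1} (hT : IsTree T) (hy : IsReal y) {c : M.N}
    (hc : 0 < c) (h1 : InBall (pt c) y (M.app (gaugeFun T) y))
    (h2 : InBall (pt c + eps (len c)) y (M.app (gaugeFun T) y)) : ∃ n, Dead T c n := by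
  obtain ⟨m, h3, h4⟩ := h1
  obtain ⟨n, h5, h6⟩ := h2
  have hz := isReal_gaugeFun T hy
  -- The slack `2 * eps` in `InBall` pays for moving both the centre and its gauge to a common later
  -- index, so both end points are compared with one rational centre and one radius.
  have a1 := abs_sub_lt_iff.1 (hy m (n + 1))
  have a2 := abs_sub_lt_iff.1 (hz m n)
  have a3 := abs_sub_lt_iff.1 (hy n (m + 1))
  have a4 := abs_sub_lt_iff.1 (hz n m)
  rw [← add_assoc] at a1 a3
  rw [add_comm n m] at a3 a4
  rw [val_gaugeFun _ _ (m + n)] at a2 a4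
  rcases gauge_away T (M.app y (m + n + 1)) (m + n + 1) with h | ⟨l, -, -, h⟩
  · rw [h] at a2
    linarith
  · exact ⟨l, h.dead hT hc (by linarith) (by linarith)⟩

end Mod

end HORM

namespace HORM

namespace Mod

variable {M : Mod}

/-! ## Trees without paths stay away from every real number -/

/-- The branch turns right exactly when `D` holds of the current string, and a right turn moves the
left end point by half the cell. -/
theorem exists_branch {D : M.N → Prop} (hD : Def M D) : ∃ c, IsBranch c ∧ ∀ n : M.N,
    (D (M.app c n) ∧ pt (M.app c (n + 1)) = pt (M.app c n) + eps (n + 1)) ∨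
      (¬ D (M.app c n) ∧ pt (M.app c (n + 1)) = pt (M.app c n)) := by
  classical
  obtain ⟨c, h0, hs⟩ := exists_prec (M := M) 1 (h := fun _ d => if D d then d + d + 1 else d + d)
    (Def.ite (hD.comp (g := fun p : M.N × M.N => p.2) (by fun_prop)) (by fun_prop) (by fun_prop))
  have hc : IsBranch c := ⟨h0, fun n => by
    rw [hs]
    split
    · exact .inr rfl
    · exact .inl rfl⟩
  refine ⟨c, hc, fun n => ?_⟩
  obtain ⟨h1, h2⟩ := pt_double (hc.pos n)
  rw [hc.len_eq] at h2
  rw [hs]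
  by_cases h : D (M.app c n)
  · exact .inl ⟨h, by rw [if_pos h, h2]⟩
  · exact .inr ⟨h, by rw [if_neg h, h1]⟩

theorem IsBranch.isStr {c : M.D tp1} (hc : IsBranch c) (n : M.N) : IsStr n (M.app c n) := by
  have := IsStr.of_pos (hc.pos n)
  rwa [hc.len_eq] at this

theorem IsBranch.isPath {T c : M.D tp1} (hc : IsBranch c)
    (h : ∀ n : M.N, M.app T (M.app c n) = (1 : M.N)) : ∃ f, IsPath T f := by
  have hd : Def M fun n : M.N => if M.app c (n + 1) = M.app c n + M.app c n then (0 : M.N) else 1 := by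
    fun_prop
  refine ⟨lam fun n : M.N => if M.app c (n + 1) = M.app c n + M.app c n then (0 : M.N) else 1,
    fun n => ?_, c, ⟨hc.1, fun n => ?_⟩, h⟩
  · rw [lam_app hd]
    split
    · exact Mod.zero_le _
    · exact le_rfl
  · rw [lam_app hd]
    split
    · rw [add_zero]
      assumption
    · exact (hc.2 n).resolve_left ‹_›

theorem IsBranch.tree {T c : M.D tp1} (hT : IsTree T) (hc : IsBranch c) {n : M.N} (i : M.N)
    (h : M.app T (M.app c (n + i)) = (1 : M.N)) : M.app T (M.app c n) = (1 : M.N) := by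
  refine induction (P := fun i => ¬ (M.app T (M.app c (n + i)) = (1 : M.N) ∧
    M.app T (M.app c n) ≠ (1 : M.N))) (by fun_prop) ?_ ?_ i |> fun h' => not_not.1 fun h'' => h' ⟨h, h''⟩
  · rw [add_zero]
    exact fun h => h.2 h.1
  · rintro i hi ⟨h1, h2⟩
    rw [← add_assoc] at h1
    exact hi ⟨hT.half (hc.pos _) (hc.2 _) h1, h2⟩

/-- The rational number `b` is a lower bound of the real number `x`. -/
def Lo (x : M.D tp1) (b : M.F) : Prop := ∀ n : M.N, b ≤ val (M.app x n) + eps n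

/-- The rational number `b` is an upper bound of the real number `x`. -/
def Hi (x : M.D tp1) (b : M.F) : Prop := ∀ n : M.N, val (M.app x n) ≤ b + eps n

theorem lo_or_hi {x : M.D tp1} (hx : IsReal x) (b : M.F) : Lo x b ∨ Hi x b := by
  by_contra! h
  simp only [Lo, Hi, not_forall, not_le] at h
  obtain ⟨⟨m, hm⟩, n, hn⟩ := h
  have h1 := abs_sub_lt_iff.1 (hx m n)
  have h2 := abs_sub_lt_iff.1 (hx n m)
  rw [add_comm n m] at h2
  linarith

theorem Lo.le_of_hi {x : M.D tp1} {a b : M.F} (ha : Lo x a) (hb : Hi x b) : a ≤ b := by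
  by_contra! h
  obtain ⟨n, hn⟩ := exists_eps_lt (x := (a - b) / 2) (by linarith)
  linarith [ha n, hb n]

/-- A rational can be a common end point of two cells of a level. The branch `c` takes the right
cell at ties and `d` the left one, so at every level the tree contains the string of one of them. If
it omits `c` at some level, it omits `c` from there on, and therefore contains all of `d`. -/
theorem exists_path_of_rat {T x : M.D tp1} (hT : IsTree T)
    (hnear : ∀ m : M.N, ∃ e, (IsStr m e ∧ M.app T e = (1 : M.N)) ∧ Lo x (pt e) ∧ Hi x (pt e + eps m))
    {b : M.F} (hl : Lo x b) (hh : Hi x b) : ∃ f, IsPath T f := by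
  obtain ⟨c, hc, hcD⟩ := exists_branch (M := M) (D := fun c => pt c + eps (len c + 1) ≤ b)
    (DefF.le ((DefF.pt .id).add (.eps (by fun_prop))) (.const _))
  obtain ⟨d, hd, hdD⟩ := exists_branch (M := M) (D := fun c => pt c + eps (len c + 1) < b)
    (DefF.lt ((DefF.pt .id).add (.eps (by fun_prop))) (.const _))
  simp only [hc.len_eq] at hcD
  simp only [hd.len_eq] at hdD
  have hb : 0 ≤ b ∧ b ≤ 1 := by
    obtain ⟨e, ⟨h1, -⟩, h2, h3⟩ := hnear 0
    have h4 := h2.le_of_hi hh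
    have h5 := hl.le_of_hi h3
    have h6 := h1.add_pt_le
    exact ⟨(pt_nonneg e).trans h4, h5.trans h6⟩
  have pt0 {c : M.D tp1} (hc : IsBranch c) : pt (M.app c (0 : M.N)) = 0 := by
    have h1 := (hc.isStr 0).add_pt_le
    rw [eps_zero] at h1
    exact le_antisymm (by linarith) (pt_nonneg _)
  have hcI (m : M.N) : pt (M.app c m) ≤ b ∧ (b < pt (M.app c m) + eps m ∨ 1 ≤ b) := by
    refine induction (P := fun m => pt (M.app c m) ≤ b ∧ (b < pt (M.app c m) + eps m ∨ 1 ≤ b))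
      ((DefF.le (.pt (by fun_prop)) (.const _)).and ((DefF.lt (.const _)
        ((DefF.pt (by fun_prop)).add (.eps (by fun_prop)))).or (.const _))) ?_ (fun m hm => ?_) m
    · rw [pt0 hc, eps_zero, zero_add]
      exact ⟨hb.1, lt_or_ge b 1⟩
    · have := eps_succ m
      rcases hcD m with ⟨h1, h2⟩ | ⟨h1, h2⟩ <;> rw [h2]
      · exact ⟨h1, hm.2.imp_left fun h => by linarith⟩
      · exact ⟨hm.1, .inl (not_le.1 h1)⟩
  have hdI (m : M.N) : b ≤ pt (M.app d m) + eps m ∧ (pt (M.app d m) < b ∨ b ≤ 0) := by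
    refine induction (P := fun m => b ≤ pt (M.app d m) + eps m ∧ (pt (M.app d m) < b ∨ b ≤ 0))
      ((DefF.le (.const _) ((DefF.pt (by fun_prop)).add (.eps (by fun_prop)))).and ((DefF.lt
        (.pt (by fun_prop)) (.const _)).or (.const _))) ?_ (fun m hm => ?_) m
    · rw [pt0 hd, eps_zero, zero_add]
      exact ⟨hb.2, lt_or_ge 0 b⟩
    · have := eps_succ m
      rcases hdD m with ⟨h1, h2⟩ | ⟨h1, h2⟩ <;> rw [h2]
      · exact ⟨by linarith, .inl h1⟩
      · exact ⟨not_lt.1 h1, hm.2⟩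
  have key (m : M.N) : M.app T (M.app c m) = (1 : M.N) ∨ M.app T (M.app d m) = (1 : M.N) := by
    obtain ⟨e, ⟨h1, h2⟩, h3, h4⟩ := hnear m
    have h5 := h3.le_of_hi hh
    have h6 := hl.le_of_hi h4
    have h7 := h1.add_pt_le
    rcases h6.lt_or_eq with h6 | h6
    · left
      suffices e = M.app c m by rwa [← this]
      refine h1.eq_of_pt (hc.isStr m) (le_antisymm (not_lt.1 fun h => ?_) (not_lt.1 fun h => ?_))
      · have := (hc.isStr m).pt_add_le h1 h
        rcases (hcI m).2 with h8 | h8 <;> linarith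
      · have := h1.pt_add_le (hc.isStr m) h
        linarith [(hcI m).1]
    · right
      suffices e = M.app d m by rwa [← this]
      have h9 := eps_pos m
      have h10 := pt_nonneg e
      refine h1.eq_of_pt (hd.isStr m) (le_antisymm (not_lt.1 fun h => ?_) (not_lt.1 fun h => ?_))
      · have := (hd.isStr m).pt_add_le h1 h
        linarith [(hdI m).1]
      · have := h1.pt_add_le (hd.isStr m) h
        rcases (hdI m).2 with h8 | h8 <;> linarith
  by_cases hall : ∀ m, M.app T (M.app c m) = (1 : M.N)
  · exact hc.isPath hall
  · obtain ⟨k, hk⟩ := not_forall.1 hall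
    refine hd.isPath fun m => hd.tree hT k ((key (m + k)).resolve_left fun h => hk ?_)
    rw [add_comm] at h
    exact hc.tree hT m h

/-- A real that equals no rational is strictly apart from every midpoint. Choice supplies for each
cell an index at which this comparison is decided, so the binary expansion of `x` becomes definable.
Since `x` is never an end point, the string close to it at each level is unique and lies on that
branch. -/
theorem exists_path_of_not_rat {T x : M.D tp1} (hx : IsReal x)
    (hnear : ∀ m : M.N, ∃ e, (IsStr m e ∧ M.app T e = (1 : M.N)) ∧ Lo x (pt e) ∧ Hi x (pt e + eps m))
    (hb : ∀ b, ¬ (Lo x b ∧ Hi x b)) : ∃ f, IsPath T f := by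
  have hmid : DefF (M := M) fun p : M.N × M.N => pt p.1 + eps (len p.1 + 1) :=
    (DefF.pt (by fun_prop)).add (.eps (by fun_prop))
  have hval : DefF (M := M) fun p : M.N × M.N => val (M.app x p.2) + eps p.2 :=
    (DefF.val (by fun_prop)).add (.eps (by fun_prop))
  have hval' : DefF (M := M) fun p : M.N × M.N => val (M.app x p.2) - eps p.2 :=
    (DefF.val (by fun_prop)).sub (.eps (by fun_prop))
  obtain ⟨Y, hY⟩ := choice_nat (M := M)
    (P := fun c n => val (M.app x n) + eps n < pt c + eps (len c + 1) ∨
      pt c + eps (len c + 1) < val (M.app x n) - eps n)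
    ((hval.lt hmid).or (hmid.lt hval')) (fun c => by
      have := hb (pt c + eps (len c + 1))
      simp only [Lo, Hi, not_and_or, not_forall, not_le] at this
      rcases this with ⟨n, h⟩ | ⟨n, h⟩
      · exact ⟨n, .inl h⟩
      · exact ⟨n, .inr (lt_sub_iff_add_lt.2 h)⟩)
  obtain ⟨c, hc, hcD⟩ := exists_branch (M := M)
    (D := fun c => pt c + eps (len c + 1) < val (M.app x (M.app Y c)) - eps (M.app Y c))
    ((hmid.lt hval').comp (g := fun c : M.N => (c, M.app Y c)) (by fun_prop))
  simp only [hc.len_eq] at hcD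
  have hin (m : M.N) : Lo x (pt (M.app c m)) ∧ Hi x (pt (M.app c m) + eps m) := by
    obtain ⟨e, ⟨h1, -⟩, h2, h3⟩ := hnear 0
    have h4 : pt e = 0 := by
      have := h1.add_pt_le
      rw [eps_zero] at this
      exact le_antisymm (by linarith) (pt_nonneg _)
    have h5 : pt (M.app c (0 : M.N)) = 0 := by
      have := (hc.isStr 0).add_pt_le
      rw [eps_zero] at this
      exact le_antisymm (by linarith) (pt_nonneg _)
    -- `Lo` and `Hi` hide an unbounded quantifier over `n`. It is fixed before the induction on `m`,
    -- whose predicate must be definable.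
    suffices h : ∀ n, pt (M.app c m) ≤ val (M.app x n) + eps n ∧
        val (M.app x n) ≤ pt (M.app c m) + eps m + eps n from ⟨fun n => (h n).1, fun n => (h n).2⟩
    intro n
    refine induction (P := fun m => pt (M.app c m) ≤ val (M.app x n) + eps n ∧
        val (M.app x n) ≤ pt (M.app c m) + eps m + eps n) ((DefF.le (.pt (by fun_prop))
        (.const _)).and (DefF.le (.const _) (((DefF.pt (by fun_prop)).add (.eps (by fun_prop))).add
          (.const _)))) ?_ (fun m hm => ?_) m
    · rw [h5, ← h4]
      exact ⟨h2 n, h3 n⟩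
    · have h6 := eps_succ m
      have h7 := hY (M.app c m)
      rw [hc.len_eq] at h7
      rcases hcD m with ⟨h8, h9⟩ | ⟨h8, h9⟩ <;> rw [h9]
      · have h10 : Lo x (pt (M.app c m) + eps (m + 1)) := by
          refine (lo_or_hi hx _).resolve_right fun h => ?_
          linarith [h (M.app Y (M.app c m))]
        exact ⟨h10 n, by linarith⟩
      · have h10 : Hi x (pt (M.app c m) + eps (m + 1)) := by
          refine (lo_or_hi hx _).resolve_left fun h => ?_
          linarith [h (M.app Y (M.app c m)), h7.resolve_right h8]
        exact ⟨hm.1, h10 n⟩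
  refine hc.isPath fun m => ?_
  obtain ⟨e, ⟨h1, h2⟩, h3, h4⟩ := hnear m
  suffices e = M.app c m by rwa [← this]
  obtain ⟨h5, h6⟩ := hin m
  refine h1.eq_of_pt (hc.isStr m) (le_antisymm (not_lt.1 fun h => ?_) (not_lt.1 fun h => ?_))
  · have := (hc.isStr m).pt_add_le h1 h
    exact hb _ ⟨h3, fun n => (h6 n).trans (by linarith)⟩
  · have := h1.pt_add_le (hc.isStr m) h
    exact hb _ ⟨h5, fun n => (h4 n).trans (by linarith)⟩

theorem exists_path_of_near {T x : M.D tp1} (hT : IsTree T) (hx : IsReal x)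
    (hnear : ∀ m : M.N, ∃ e, (IsStr m e ∧ M.app T e = (1 : M.N)) ∧ Lo x (pt e) ∧ Hi x (pt e + eps m)) :
    ∃ f, IsPath T f := by
  by_cases h : ∃ b, Lo x b ∧ Hi x b
  · obtain ⟨b, hl, hh⟩ := h
    exact exists_path_of_rat hT hnear hl hh
  · exact exists_path_of_not_rat hx hnear (not_exists.1 h)

/-! ## Positivity of the gauge function -/

/-- Collection from choice: the sum of the chosen witnesses below `b` bounds each of them. -/
theorem exists_bound {P : M.N → M.N → Prop} (hP : Def M fun p : M.N × M.N => P p.1 p.2) (b : M.N)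
    (h : ∀ e, e < b → ∃ K, P e K) : ∃ B, ∀ e, e < b → ∃ K, K ≤ B ∧ P e K := by
  obtain ⟨Y, hY⟩ := choice_nat (M := M) (P := fun e K => ¬ (e < b ∧ ¬ P e K))
    ((Def.lt (by fun_prop) (by fun_prop)).and hP.not).not (fun e => by
      by_cases he : e < b
      · obtain ⟨K, hK⟩ := h e he
        exact ⟨K, fun h => h.2 hK⟩
      · exact ⟨0, fun h => he h.1⟩)
  obtain ⟨g, hg⟩ := exists_count Y
  have hmono (m i : M.N) : M.app g m ≤ M.app g (m + i) := by
    refine induction (P := fun i => M.app g m ≤ M.app g (m + i)) (by fun_prop) ?_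
      (fun i hi => ?_) i
    · rw [add_zero]
    · rw [← add_assoc, hg.2]
      exact hi.trans le_self_add
  refine ⟨M.app g b, fun e he => ⟨M.app Y e, ?_, by_contra fun h => hY e ⟨he, h⟩⟩⟩
  obtain ⟨i, rfl⟩ := exists_add_of_le (succ_le.2 he)
  refine le_trans ?_ (hmono _ _)
  rw [hg.2]
  exact le_add_self

/-- By `exists_path_of_near` there is a level `m` at which each cell of the tree is apart from `x`.
Collection bounds the indices at which the apartness shows, and beyond that bound the tree keeps a
positive distance, contradicting that all values of the gauge are small. -/
theorem isPos_gaugeFun {T x : M.D tp1} (hT : IsTree T) (hno : ¬ ∃ f, IsPath T f) (hx : IsReal x) :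
    IsPos (M.app (gaugeFun T) x) := by
  by_contra hpos
  simp only [IsPos, not_exists, not_lt, val_gaugeFun] at hpos
  refine hno (exists_path_of_near hT hx fun m => by_contra fun hm => ?_)
  simp only [not_exists, not_and] at hm
  obtain ⟨B, hB⟩ := exists_bound (M := M) (P := fun e K => (¬ (IsStr m e ∧ M.app T e = (1 : M.N))) ∨
      val (M.app x K) + 4 * eps K < pt e ∨ pt e + eps m < val (M.app x K) - 4 * eps K)
    ((by fun_prop : Def M _).or ((DefF.lt ((DefF.val (by fun_prop)).add
      ((DefF.const _).mul (.eps (by fun_prop)))) (.pt (by fun_prop))).or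
      (DefF.lt ((DefF.pt (by fun_prop)).add (.const _)) ((DefF.val (by fun_prop)).sub
        ((DefF.const _).mul (.eps (by fun_prop))))))) (two (m + 1)) (fun e _ => by
      by_cases he : IsStr m e ∧ M.app T e = (1 : M.N)
      · by_cases hl : Lo x (pt e)
        · have hh := hm e he hl
          simp only [Hi, not_forall, not_le] at hh
          obtain ⟨n, hn⟩ := hh
          obtain ⟨p, hp⟩ := exists_eps_lt (x := (val (M.app x n) - (pt e + eps m + eps n)) / 4)
            (by linarith)
          have h1 : eps (n + p) ≤ eps p := eps_anti le_add_self
          have h2 := (abs_sub_lt_iff.1 (hx n p)).1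
          exact ⟨n + p, .inr (.inr (by linarith))⟩
        · simp only [Lo, not_forall, not_le] at hl
          obtain ⟨n, hn⟩ := hl
          obtain ⟨p, hp⟩ := exists_eps_lt (x := (pt e - (val (M.app x n) + eps n)) / 4)
            (by linarith)
          have h1 : eps (n + p) ≤ eps p := eps_anti le_add_self
          have h2 := (abs_sub_lt_iff.1 (hx n p)).2
          exact ⟨n + p, .inr (.inl (by linarith))⟩
      · exact ⟨0, .inl he⟩)
  have h1 := hpos (B + m + 1)
  have h2 := eps_succ (B + m + 1)
  -- By `hpos` the radius tested here is at most `3 * eps (B + m + 2)`. That is below `eps m`, and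
  -- together with the error `eps K` of the centre it stays within the margin `4 * eps K` of the
  -- apartness.
  refine not_away_gauge T (M.app x (B + m + 1 + 1)) (B + m + 1 + 1) ⟨m, ?_, ?_, ?_⟩
  · rw [lt_succ, add_assoc, add_assoc, add_left_comm]
    exact le_self_add
  · have h3 : eps (B + m + 1 + 1) ≤ eps (m + 1 + 1) := eps_anti (by
      rw [add_assoc B, add_assoc B]
      exact le_add_self)
    rw [eps_succ (m + 1), eps_succ m] at h3
    linarith [eps_pos m]
  · rintro e he ⟨h3, h4, h5⟩
    obtain ⟨K, hK, h6⟩ := hB e he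
    obtain ⟨i, rfl⟩ := exists_add_of_le hK
    have h7 := abs_sub_lt_iff.1 (hx K (i + m + 1 + 1))
    rw [← add_assoc, ← add_assoc, ← add_assoc] at h7
    have h8 : eps (K + i + m + 1 + 1) ≤ eps K := eps_anti (by
      rw [add_assoc, add_assoc, add_assoc]
      exact le_self_add)
    rcases h6 with h6 | h6 | h6
    · exact h6 h3
    · linarith
    · linarith

theorem isPosFun_gaugeFun {T : M.D tp1} (hT : IsTree T) (hno : ¬ ∃ f, IsPath T f) :
    IsPosFun (gaugeFun T) :=
  ⟨fun _ hx => ⟨isReal_gaugeFun T hx, isPos_gaugeFun hT hno hx⟩,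
    fun _ _ _ _ h => eqReal_gaugeFun T h⟩

end Mod

end HORM

namespace HORM

namespace Mod

variable {M : Mod}

/-! ## The weak Heine-Borel theorem implies weak weak König's lemma -/

theorem IsCount.add_le {s g : M.D tp1} (hs : IsBinary s) (hg : IsCount s g) (a i : M.N) :
    M.app g (a + i) ≤ M.app g a + i := by
  refine induction (P := fun i => M.app g (a + i) ≤ M.app g a + i) (by fun_prop) ?_
    (fun i hi => ?_) i
  · rw [add_zero, add_zero]
  · rw [← add_assoc, hg.2, ← add_assoc]
    exact add_le_add hi (hs _)

/-- The extensions of `c` by `m` digits have consecutive codes, and none of them lies in `T`, so the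
count does not grow over this block. -/
theorem IsCount.add_eq {T g : M.D tp1} (hT : IsBinary T) (hg : IsCount T g) {c m : M.N}
    (h : Dead T c m) : M.app g ((c + 1) * two m) = M.app g (c * two m) := by
  have key : ∀ i, ¬ (i ≤ two m ∧ M.app g (c * two m + i) ≠ M.app g (c * two m)) := by
    refine induction (((Def.le (by fun_prop) (by fun_prop)).and (by fun_prop)).not) ?_ ?_
    · rw [add_zero]
      exact fun h => h.2 rfl
    · rintro i hi ⟨h1, h2⟩
      have h3 := succ_le.1 h1
      refine hi ⟨h3.le, fun h4 => h2 ?_⟩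
      rw [← add_assoc, hg.2, h4, (hT.eq _).resolve_right (h _ ?_ le_self_add), add_zero]
      rw [add_mul, one_mul]
      gcongr
  by_contra h'
  refine key (two m) ⟨le_rfl, ?_⟩
  rwa [add_mul, one_mul] at h'

/-- The strings of length `l + m` fall into one block of `two m` codes for each string of length
`l`. Blocks marked by `s` contribute nothing to the count of `T`, and the others at most `two m`. -/
theorem IsCount.le_of_dead {T gT s g : M.D tp1} (hT : IsBinary T) (hgT : IsCount T gT)
    (hs : IsBinary s) (hg : IsCount s g) {l m : M.N}
    (h : ∀ j, j < two l → M.app s j = (1 : M.N) → Dead T (two l + j) m) :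
    M.app gT (two (l + m + 1)) + two m * M.app g (two l) ≤
      M.app gT (two (l + m)) + two (l + m) := by
  have key : ∀ j, ¬ (j ≤ two l ∧ ¬ M.app gT ((two l + j) * two m) + two m * M.app g j ≤
      M.app gT (two l * two m) + j * two m) := by
    refine induction (((Def.le (by fun_prop) (by fun_prop)).and (by fun_prop)).not) ?_ ?_
    · rw [add_zero, hg.1, mul_zero, zero_mul]
      exact fun h => h.2 le_rfl
    · rintro j hj ⟨h1, h2⟩
      have h3 := succ_le.1 h1
      refine h2 ?_
      have h4 := not_not.1 fun h => hj ⟨h3.le, h⟩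
      rw [← add_assoc, hg.2]
      rcases hs.eq j with h5 | h5
      · rw [h5, add_zero, add_mul (_ + _), one_mul, add_mul j, one_mul, ← add_assoc]
        calc _ ≤ M.app gT ((two l + j) * two m) + two m + two m * M.app g j := by
              gcongr
              exact hgT.add_le hT _ _
          _ = M.app gT ((two l + j) * two m) + two m * M.app g j + two m := by ring
          _ ≤ _ := by gcongr
      · rw [h5, hgT.add_eq hT (h j h3 h5), mul_add, mul_one, add_mul j, one_mul, ← add_assoc,
          ← add_assoc]
        gcongr
  have := not_not.1 fun h => key (two l) ⟨le_rfl, h⟩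
  have h1 : two (l + m + 1) = (two l + two l) * two m := by
    rw [add_right_comm, two_add, two_succ]
  rwa [h1, two_add]

theorem WWKLIn_of_WHBUIn (hH : M.WHBUIn) : M.WWKLIn := by
  intro T hT hno
  obtain ⟨gT, hgT⟩ := exists_count T
  refine ⟨gT, hgT, fun k => ?_⟩
  -- The error of the covering and that of the inner content are each a quarter of `eps k`. Their
  -- sum is half of it, which leaves room for the strict inequality.
  obtain ⟨n, y, hy, hlen⟩ := hH (gaugeFun T) (isPosFun_gaugeFun hT hno) (k + 1 + 1)
  obtain ⟨l, s, g, hs, hg, hcov, hlen⟩ := hlen (k + 1 + 1)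
  have hdead (j : M.N) (hj : j < two l) (h : M.app s j = (1 : M.N)) :
      ∃ m, Dead T (two l + j) m := by
    obtain ⟨i, hi, h1, h2⟩ := hcov j hj h
    have hc : 0 < two l + j := add_pos_of_pos_of_nonneg (two_pos l) (Mod.zero_le j)
    obtain ⟨h3, h4⟩ := len_off hj
    refine exists_dead_of_inBall hT (hy i hi).1 hc ?_ ?_
    · rwa [pt, h3, h4]
    · rw [pt, h3, h4]
      rwa [map_add, map_one, add_mul, one_mul] at h2
  obtain ⟨B, hB⟩ := exists_bound (M := M)
    (P := fun j m => M.app s j ≠ (1 : M.N) ∨ Dead T (two l + j) m)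
    ((by fun_prop : Def M _).or (Def.dead (by fun_prop) (by fun_prop))) (two l) (fun j hj => by
      by_cases h : M.app s j = (1 : M.N)
      · obtain ⟨m, hm⟩ := hdead j hj h
        exact ⟨m, .inr hm⟩
      · exact ⟨0, .inl h⟩)
  -- Every cell marked by `s` is free of strings of the tree once it is extended by `B` or more
  -- digits.
  refine ⟨l + B, fun N hN => ?_⟩
  obtain ⟨i, rfl⟩ := exists_add_of_le hN
  have h1 := hgT.le_of_dead hT.1 hs hg (m := B + i) (fun j hj h => by
    obtain ⟨K, hK, h1⟩ := hB j hj
    obtain ⟨p, rfl⟩ := exists_add_of_le hK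
    rw [add_assoc]
    exact (h1.resolve_left (not_not.2 h)).add hT
      (add_pos_of_pos_of_nonneg (two_pos l) (Mod.zero_le j)) _)
  rw [← add_assoc] at h1
  have h2 := toF_le.2 h1
  rw [← toF_lt]
  simp only [map_add, map_mul] at h2 ⊢
  have h3 : M.toF (two (l + B + i)) = M.toF (two l) * M.toF (two (B + i)) := by
    rw [add_assoc, two_add, map_mul]
  have h4 := eps_mul_two l
  have h5 := eps_mul_two k
  have h6 := eps_succ (k + 1)
  rw [eps_succ k] at h6
  have h7 := toF_two_pos (M := M) (l + B + i)
  have h8 := mul_le_mul_of_nonneg_left hlen h7.le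
  have h9 : M.toF (two (l + B + i)) * (M.toF (M.app g (two l)) * eps l + eps (k + 1 + 1) +
      eps (k + 1 + 1)) = M.toF (two (B + i)) * M.toF (M.app g (two l)) +
        M.toF (two (l + B + i)) * eps k / 2 := by
    rw [h3, h6]
    linear_combination M.toF (two (B + i)) * M.toF (M.app g (two l)) * h4
  have h10 := mul_pos h7 (eps_pos k)
  have h11 : M.toF (M.app gT (two (l + B + i + 1))) < M.toF (M.app gT (two (l + B + i))) +
      M.toF (two (l + B + i)) * eps k := by linarith
  have h12 := mul_lt_mul_of_pos_left h11 (toF_two_pos k)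
  have h13 : M.toF (two k) * (M.toF (M.app gT (two (l + B + i))) +
      M.toF (two (l + B + i)) * eps k) = M.toF (two k) * M.toF (M.app gT (two (l + B + i))) +
        M.toF (two (l + B + i)) := by
    linear_combination M.toF (two (l + B + i)) * h5
  rwa [h13] at h12

end Mod

/-! ## The equivalences -/

theorem Proves.E2_to_sentence {X : Sentence} (hACA : Proves (RCA0ω ∪ ACA) X) (M : Mod)
    (h : M.E2In) : X.Sat M.toStr M.nilEnv :=
  hACA.sound fun φ hφ => hφ.elim (M.ax φ) (Mod.models_ACA h φ)

theorem Proves.sentence_to_WWKL {X : Sentence} (hWWKL : Proves (RCA0ω ∪ {X}) WWKL) (M : Mod)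
    (h : X.Sat M.toStr M.nilEnv) : M.WWKLIn :=
  sat_WWKL.1 <| hWWKL.sound fun φ hφ => hφ.elim (M.ax φ) fun h' => h' ▸ h

end HORM

theorem mainTheorem12 (X : Sentence) (hX : X.IsSecondOrder)
    (hACA : Proves (RCA0ω ∪ ACA) X)
    (hWWKL : Proves (RCA0ω ∪ {X}) WWKL) :
    Proves RCA0ω (WWKL ⭤ (E2 ⋎ WHBU)) ∧
    Proves RCA0ω ((E2 ⋎ WHBU) ⭤ (X ⋎ WHBU)) := by
  have h1 (M : Mod) : M.WWKLIn → M.E2In ∨ M.WHBUIn := fun h =>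
    or_iff_not_imp_left.2 fun hE => Mod.WHBUIn_of_not_E2 h hE
  constructor
  · refine Proves.of_mods fun M => ?_
    rw [sat_iff, sat_disj, sat_WWKL, sat_E2, sat_WHBU]
    refine ⟨h1 M, fun h => h.elim (fun h => ?_) Mod.WWKLIn_of_WHBUIn⟩
    exact hWWKL.sentence_to_WWKL M (hACA.E2_to_sentence M h)
  · refine Proves.of_mods fun M => ?_
    rw [sat_iff, sat_disj, sat_disj, sat_E2, sat_WHBU]
    exact ⟨fun h => h.imp_left (hACA.E2_to_sentence M),
      fun h => h.elim (fun h => h1 M (hWWKL.sentence_to_WWKL M h)) .inr⟩
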